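/- **Setting.** Let $d\ge 1$, $r>0$, and let $\mathcal X\subset[0,r]^d$ be nonempty, compact and convex. Let $f\sim\mathcal{GP}(0,k)$ be a Gaussian process on $\mathcal X$ with mean zero and positive semidefinite covariance kernel $k$, $k(x,x)\le 1$. Assume that almost surely the sample path $f$ is differentiable on $\mathcal X$, and that for some constants $a,b>0$, for every coordinate $j\in\{1,\dots,d\}$ and every $L>0$, $$\Pr\Bigl(\sup_{x\in\mathcal X}\Bigl|\frac{\partial f}{\partial x_j}(x)\Bigr|>L\Bigr)\le a\exp\bigl(-(L/b)^2\bigr).$$ Let $\epsilon_1,\epsilon_2,\dots$ be i.i.d. $\mathcal N(0,\sigma^2)$ with $\sigma>0$. For a data set $\mathcal D_{t-1}=\{(x_i,y_i)\}_{i=1}^{t-1}$ put $\mathbf k_{t-1}(x)=(k(x,x_i))_{i<t}$, $\mathbf K=(k(x_i,x_j))_{i,j<t}$, $\mathbf y_{t-1}=(y_i)_{i<t}$ and $$\mu_{t-1}(x)=\mathbf k_{t-1}(x)^\top(\mathbf K+\sigma^2\mathbf I)^{-1}\mathbf y_{t-1},\qquad \sigma_{t-1}^2(x)=k(x,x)-\mathbf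 k_{t-1}(x)^\top(\mathbf K+\sigma^2\mathbf I)^{-1}\mathbf k_{t-1}(x).$$ **Algorithm (IRGP-UCB).** Let $\zeta_1,\zeta_2,\dots$ be independent, where $\zeta_t$ is distributed as $s_t+Z_t$ with $Z_t$ exponential of rate $\lambda=1/2$ and $$s_t=2d\log\Bigl(b\,d\,r\,t^2\bigl(\sqrt{\log(ad)}+\sqrt\pi/2\bigr)\Bigr)-2\log 2 .$$ The process $f$ and the sequences $(\epsilon_t)_{t\ge1}$, $(\zeta_t)_{t\ge1}$ are independent. In round $t=1,2,\dots$ the algorithm queries $$x_t\in\operatorname*{argmax}_{x\in\mathcal X}\ \mu_{t-1}(x)+\zeta_t^{1/2}\sigma_{t-1}(x),$$ the maximizer being chosen as a measurable function of $(\mathcal D_{t-1},\zeta_t)$, and observes $y_t=f(x_t)+\epsilon_t$. Square roots of negative numbers are read as $0$ throughout. Let $\gamma_T=\sup_{a_1,\dots,a_T\in\mathcal X} I\bigl((f(a_i)+\epsilon_i)_{i\le T};\,(f(a_i))_{i\le T}\bigr)$ be the maximum information gain ($I$ is the Shannon mutual information), $C_1=2/\log(1+\sigma^{-2})$, and $f(x^*)=\max_{x\in\mathcal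 X}f(x)$. **Theorem.** Let $\delta\in(0,1)$. For every $T$ the cumulative regret $\sum_{t=1}^T\bigl(f(x^*)-f(x_t)\bigr)$ is integrable, and $$\Pr\left(\forall T\ge1:\ \mathbb E\Bigl[\sum_{t=1}^T \bigl(f(x^*)-f(x_t)\bigr)\,\Big|\,\{\zeta_t\}_{t\ge1}\Bigr]\le U(T,\delta)\right)\ge 1-\delta,$$ where $$U(T,\delta)=\frac{\pi^2}{6}+6\sqrt{T\log\frac{\pi^2T^2}{3\delta}}+\sqrt{C_1\gamma_T\left(Ts_T+T+2\sqrt{T\log\frac{\pi^2T^2}{3\delta}}+2\log\frac{\pi^2T^2}{3\delta}\right)} .$$ -/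

import Mathlib

open MeasureTheory ProbabilityTheory InformationTheory Set
open scoped ENNReal

noncomputable section

namespace GPBandit

/-! ### Gaussian-process posterior and the acquisition function

A data set with `t` observations on a space `E` is a function `D : Fin t → E × ℝ`;
`(D i).1` is the `i`-th input and `(D i).2` the `i`-th observed value. -/

section Posterior

variable {E : Type*} {t : ℕ}

/-- The kernel matrix of the inputs of `D`. -/
def gram (k : E → E → ℝ) (D : Fin t → E × ℝ) : Matrix (Fin t) (Fin t) ℝ :=
  Matrix.of fun i j => k (D i).1 (D j).1

/-- The vector `(k(x, x₁), …, k(x, x_t))`. -/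
def kvec (k : E → E → ℝ) (D : Fin t → E × ℝ) (x : E) : Fin t → ℝ :=
  fun i => k x (D i).1

/-- Posterior mean `k_t(x)ᵀ (K + σ² I)⁻¹ y`. -/
def postMean (k : E → E → ℝ) (σ : ℝ) (D : Fin t → E × ℝ) (x : E) : ℝ :=
  kvec k D x ⬝ᵥ Matrix.mulVec (gram k D + σ ^ 2 • (1 : Matrix (Fin t) (Fin t) ℝ))⁻¹
    (fun i => (D i).2)

/-- Posterior variance `k(x, x) - k_t(x)ᵀ (K + σ² I)⁻¹ k_t(x)`. -/
def postVar (k : E → E → ℝ) (σ : ℝ) (D : Fin t → E × ℝ) (x : E) : ℝ :=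
  k x x - kvec k D x ⬝ᵥ Matrix.mulVec (gram k D + σ ^ 2 • (1 : Matrix (Fin t) (Fin t) ℝ))⁻¹
    (kvec k D x)

/-- Upper confidence bound with confidence parameter `z`. -/
def ucb (k : E → E → ℝ) (σ : ℝ) (D : Fin t → E × ℝ) (z : ℝ) (x : E) : ℝ :=
  postMean k σ D x + Real.sqrt z * Real.sqrt (postVar k σ D x)

end Posterior

/-! ### The algorithm -/

section Algorithm

variable {E : Type*}

/-- A measurable choice of a maximizer over `X` of the upper confidence bound, as a function of
the data set and of the confidence parameter (that is, the `argmax` step of the algorithm together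
with a measurable way of breaking ties). -/
structure IsArgmaxRule [MeasurableSpace E] (X : Set E) (k : E → E → ℝ) (σ : ℝ)
    (sel : ∀ t : ℕ, (Fin t → E × ℝ) → ℝ → E) : Prop where
  measurable : ∀ t, Measurable (Function.uncurry (sel t))
  mem : ∀ (t : ℕ) (D : Fin t → E × ℝ) (z : ℝ), (∀ i, (D i).1 ∈ X) → sel t D z ∈ X
  isMaxOn : ∀ (t : ℕ) (D : Fin t → E × ℝ) (z : ℝ), (∀ i, (D i).1 ∈ X) →
    IsMaxOn (ucb k σ D z) X (sel t D z)

/-- The data set after `t` rounds of the algorithm, run on the objective `f` with noise `ε` and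
confidence parameters `ζ`. Rounds are counted from `0`: round `t` uses `ζ t`, queries
`x = sel t D (ζ t)` for the current data set `D`, and observes `f x + ε t`. -/
def dataset (sel : ∀ t : ℕ, (Fin t → E × ℝ) → ℝ → E) (f : E → ℝ) (ε ζ : ℕ → ℝ) :
    (t : ℕ) → (Fin t → E × ℝ)
  | 0 => Fin.elim0
  | t + 1 => Fin.snoc (α := fun _ => E × ℝ) (dataset sel f ε ζ t)
      (sel t (dataset sel f ε ζ t) (ζ t), f (sel t (dataset sel f ε ζ t) (ζ t)) + ε t)

/-- The input queried in round `t` (counted from `0`). -/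
def query (sel : ∀ t : ℕ, (Fin t → E × ℝ) → ℝ → E) (f : E → ℝ) (ε ζ : ℕ → ℝ) (t : ℕ) : E :=
  sel t (dataset sel f ε ζ t) (ζ t)

/-- Cumulative regret over `X` of the first `T` rounds. -/
def cumRegret (X : Set E) (sel : ∀ t : ℕ, (Fin t → E × ℝ) → ℝ → E) (f : E → ℝ) (ε ζ : ℕ → ℝ)
    (T : ℕ) : ℝ :=
  ∑ t ∈ Finset.range T, ((⨆ x : X, f x) - f (query sel f ε ζ t))

/-- Law of `s + Z` with `Z` exponential of rate `lam`. -/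
def shiftedExp (s lam : ℝ) : Measure ℝ :=
  (expMeasure lam).map fun z => s + z

end Algorithm

/-! ### The probabilistic model -/

section Model

variable {Ω : Type*} [MeasurableSpace Ω]

/-- Restricted to `X`, the random function `f` is a Gaussian process with mean zero and
covariance `k` (so `k` is automatically a positive semidefinite kernel on `X`). -/
structure IsCenteredGP {E : Type*} (P : Measure Ω) (X : Set E) (k : E → E → ℝ)
    (f : E → Ω → ℝ) : Prop where
  measurable : ∀ x ∈ X, Measurable (f x)
  isGaussian : IsGaussianProcess (fun x : X => f x) P
  mean_zero : ∀ x ∈ X, ∫ ω, f x ω ∂P = 0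
  cov_eq : ∀ x ∈ X, ∀ y ∈ X, covariance (f x) (f y) P = k x y

/-- Independent `N(0, σ²)` noise. -/
structure IsGaussianNoise (P : Measure Ω) (σ : ℝ) (ε : ℕ → Ω → ℝ) : Prop where
  measurable : ∀ t, Measurable (ε t)
  law : ∀ t, P.map (ε t) = gaussianReal 0 (σ ^ 2).toNNReal
  indep : iIndepFun ε P

/-- Independent confidence parameters; `ζ t` follows the shifted exponential distribution with
shift `s (t + 1)` and rate `lam` (`ζ t` is used in the `(t + 1)`-st round). -/
structure IsShiftedExpSeq (P : Measure Ω) (s : ℕ → ℝ) (lam : ℝ) (ζ : ℕ → Ω → ℝ) : Prop where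
  measurable : ∀ t, Measurable (ζ t)
  law : ∀ t, P.map (ζ t) = shiftedExp (s (t + 1)) lam
  indep : iIndepFun ζ P

/-- Almost surely the sample path is differentiable on `X` (with gradient `G x ω` at `x`), and
`P (sup_{x ∈ X} |∂f/∂x_j| > L) ≤ a exp(-(L/b)²)` for every coordinate `j` and every `L > 0`. -/
def HasDerivTail {d : ℕ} (P : Measure Ω) (X : Set (EuclideanSpace ℝ (Fin d)))
    (f : EuclideanSpace ℝ (Fin d) → Ω → ℝ) (a b : ℝ) : Prop :=
  ∃ G : EuclideanSpace ℝ (Fin d) → Ω → EuclideanSpace ℝ (Fin d),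
    (∀ᵐ ω ∂P, ∀ x ∈ X, HasGradientWithinAt (fun y => f y ω) (G x ω) X x) ∧
    ∀ (j : Fin d) (L : ℝ), 0 < L →
      P {ω | ∃ x ∈ X, L < |G x ω j|} ≤ ENNReal.ofReal (a * Real.exp (-(L / b) ^ 2))

/-- Shannon mutual information: the divergence of the joint law from the product of the
marginal laws. -/
def mutualInfo {α β : Type*} [MeasurableSpace α] [MeasurableSpace β] (P : Measure Ω)
    (Y : Ω → α) (F : Ω → β) : ℝ≥0∞ :=
  klDiv (P.map fun ω => (Y ω, F ω)) ((P.map Y).prod (P.map F))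

/-- Maximum information gain `γ_T`: the supremum, over all choices of `T` inputs of `X`, of the
mutual information between the noisy values and the values of `f` at these inputs. -/
def maxInfoGain {E : Type*} (P : Measure Ω) (X : Set E) (f : E → Ω → ℝ) (ε : ℕ → Ω → ℝ)
    (T : ℕ) : ℝ :=
  (⨆ A : Fin T → X, mutualInfo P (fun ω i => f (A i) ω + ε i ω) (fun ω i => f (A i) ω)).toReal

/-- The `σ`-algebra generated by the whole sequence `ζ`. -/
@[reducible] def sigmaOf (ζ : ℕ → Ω → ℝ) : MeasurableSpace Ω :=
  MeasurableSpace.comap (fun ω t => ζ t ω) MeasurableSpace.pi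

end Model

/-! ### Constants -/

/-- The shift `s_t = 2d log(b d r t² (√(log(ad)) + √π / 2)) - 2 log 2`. -/
def shift (d : ℕ) (a b r : ℝ) (t : ℕ) : ℝ :=
  2 * d * Real.log (b * d * r * (t : ℝ) ^ 2 *
    (Real.sqrt (Real.log (a * d)) + Real.sqrt Real.pi / 2)) - 2 * Real.log 2

/-- `C₁ = 2 / log(1 + σ⁻²)`. -/
def C₁ (σ : ℝ) : ℝ := 2 / Real.log (1 + (σ ^ 2)⁻¹)

/-- `log(π² T² / (3δ))`. -/
def logTerm (T : ℕ) (δ : ℝ) : ℝ := Real.log (Real.pi ^ 2 * (T : ℝ) ^ 2 / (3 * δ))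

/-- The regret bound `U(T, δ)`, as a function of `C₁`, `γ_T` and `s_T`. -/
def regretBound (C γT sT : ℝ) (T : ℕ) (δ : ℝ) : ℝ :=
  Real.pi ^ 2 / 6 + 6 * Real.sqrt (T * logTerm T δ) +
    Real.sqrt (C * γT * (T * sT + T + 2 * Real.sqrt (T * logTerm T δ) + 2 * logTerm T δ))

end GPBandit

end

-- Since `ζ` is independent of path and noise, conditioning on it amounts to freezing `ζ = z` and
-- integrating over path and noise (`condExp_comap_of_indepFun`). Write U_t(β) = `meanUcb` for the
-- mean of the maximal upper confidence bound when round t uses β. Given the data, f at the query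
-- has mean equal to the posterior mean there, so the mean regret of round t is E max f − U_t(z_t) +
-- √z_t · E σ(x_t) (`integral_query`).
--
-- The shifted exponential law is made so that E max_G f ≤ ∫ U_t(β) for every finite grid G with |G|
-- ≤ 2 exp(s_t/2) (`integral_max_le`). If a is the parameter at which the maximal bound crosses the
-- level c, a union bound over Gaussian posteriors gives P(max_G f > c) ≤ |G| exp(−a/2)/2, and for
-- such G this is at most exp(−(a − s_t)/2), the tail of ζ_t beyond a. A grid of this size also
-- approximates max f within 1/t² in mean, because the tail of the derivatives bounds the expected
-- Lipschitz constant. Hence the regret of round t is at most 1/t² + (∫ U_t − U_t(ζ_t)) + √ζ_t · E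
-- σ(x_t).
--
-- Three sums remain. The first is at most π²/6. The second is a martingale in `ζ`, since U_t
-- depends only on earlier parameters; U_t is 1-Lipschitz in √β, which makes the increments
-- subgaussian (`integral_exp_centered_le`), and Chernoff's bound gives 5√(Tl) with l = `logTerm`.
-- For the third, Cauchy–Schwarz is combined with the information bound on the sum of posterior
-- variances, valid on every trajectory (`CenteredGP.sum_seqVar_le`), and with an upper tail of Σ
-- ζ_t (`IsShiftedExpSeq.sum_tail_shift`). The exponential parts have mean 2 each while the bound
-- grants only 1; the growth of s_t pays the difference, because T s_T exceeds Σ s_t by 4 log 2 for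
-- every round after the first one counted.
--
-- Each of the two events at horizon T fails with probability at most exp(−l) = 3δ/(π²T²), and these
-- sum to δ. Early rounds, where κt² < 2 for κ = `shiftCoeff` and s_t may be negative, are charged
-- the expected oscillation of f, at most κ each; this costs at most 1 in total, absorbed by 6√(Tl)
-- in place of 5√(Tl).
--
-- Two points need care. Inputs are adaptive, so Bayes' rule is proved for every data set and not
-- just almost every one. Joint measurability in point and outcome is obtained by replacing f by a
-- random element of the space of Lipschitz paths.

set_option linter.unusedSectionVars false

noncomputable section
namespace GPBandit

open Matrix Filter Topology TopologicalSpace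
open scoped NNReal BoundedContinuousFunction

-- The posterior mean as a linear predictor with independent residual.

section Residual

variable {𝒳 Ω : Type*} [MeasurableSpace Ω]

/-- A Gaussian process on the whole index type, with mean zero and covariance `k`. -/
structure CenteredGP (P : Measure Ω) (k : 𝒳 → 𝒳 → ℝ) (f : 𝒳 → Ω → ℝ) : Prop where
  measurable : ∀ x, Measurable (f x)
  isGaussian : IsGaussianProcess f P
  mean_zero : ∀ x, ∫ ω, f x ω ∂P = 0
  cov_eq : ∀ x y, covariance (f x) (f y) P = k x y

variable {P : Measure Ω} {k : 𝒳 → 𝒳 → ℝ} {f : 𝒳 → Ω → ℝ} {σ : ℝ} {t : ℕ}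

theorem CenteredGP.memLp (h : CenteredGP P k f) (x : 𝒳) : MemLp (f x) 2 P :=
  (h.isGaussian.hasGaussianLaw_eval x).memLp_two

theorem CenteredGP.symm (h : CenteredGP P k f) (x y : 𝒳) : k x y = k y x := by
  rw [← h.cov_eq, ← h.cov_eq, covariance_comm]

/-- The regularized kernel matrix. -/
def noisyGram (k : 𝒳 → 𝒳 → ℝ) (σ : ℝ) (D : Fin t → 𝒳 × ℝ) : Matrix (Fin t) (Fin t) ℝ :=
  gram k D + σ ^ 2 • (1 : Matrix (Fin t) (Fin t) ℝ)

/-- The coefficients of the posterior mean at `x` as a linear function of the observations. -/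
def postWeight (k : 𝒳 → 𝒳 → ℝ) (σ : ℝ) (D : Fin t → 𝒳 × ℝ) (x : 𝒳) : Fin t → ℝ :=
  (noisyGram k σ D)⁻¹ *ᵥ kvec k D x

/-- The quadratic form at `v` is the variance of Σ v_i f(x_i). -/
theorem CenteredGP.gram_posSemidef [IsProbabilityMeasure P] (h : CenteredGP P k f)
    (D : Fin t → 𝒳 × ℝ) : (gram k D).PosSemidef := by
  refine .of_dotProduct_mulVec_nonneg ?_ fun v => ?_
  · ext i j
    simp [gram, h.symm (D j).1]
  · have : star v ⬝ᵥ gram k D *ᵥ v =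
        covariance (fun ω => ∑ i, v i * f (D i).1 ω) (fun ω => ∑ i, v i * f (D i).1 ω) P := by
      rw [covariance_fun_sum_fun_sum (fun i => (h.memLp _).const_mul _)
        (fun i => (h.memLp _).const_mul _)]
      simp only [dotProduct, mulVec, gram, of_apply, star_trivial, Finset.mul_sum,
        covariance_const_mul_left, covariance_const_mul_right, h.cov_eq]
      refine Finset.sum_congr rfl fun i _ => Finset.sum_congr rfl fun j _ => by ring
    rw [this, covariance_self]
    · exact variance_nonneg _ _
    · exact Finset.aemeasurable_fun_sum _ fun i _ => ((h.measurable _).const_mul _).aemeasurable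

theorem CenteredGP.noisyGram_posDef [IsProbabilityMeasure P] (h : CenteredGP P k f) (hσ : 0 < σ)
    (D : Fin t → 𝒳 × ℝ) : (noisyGram k σ D).PosDef :=
  PosDef.posSemidef_add (h.gram_posSemidef D) (PosDef.one.smul (by positivity))

theorem CenteredGP.noisyGram_mulVec_postWeight [IsProbabilityMeasure P] (h : CenteredGP P k f)
    (hσ : 0 < σ) (D : Fin t → 𝒳 × ℝ) (x : 𝒳) :
    noisyGram k σ D *ᵥ postWeight k σ D x = kvec k D x := by
  rw [postWeight, mulVec_mulVec, mul_nonsing_inv _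
    ((isUnit_iff_isUnit_det _).1 (h.noisyGram_posDef hσ D).isUnit), one_mulVec]

theorem CenteredGP.postMean_eq [IsProbabilityMeasure P] (h : CenteredGP P k f) (hσ : 0 < σ)
    (D : Fin t → 𝒳 × ℝ) (x : 𝒳) :
    postMean k σ D x = ∑ i, postWeight k σ D x i * (D i).2 := by
  have hs : ((noisyGram k σ D)⁻¹)ᵀ = (noisyGram k σ D)⁻¹ := by
    simpa [IsHermitian] using (h.noisyGram_posDef hσ D).inv.isHermitian
  change kvec k D x ⬝ᵥ (noisyGram k σ D)⁻¹ *ᵥ _ = _ ⬝ᵥ (fun i => (D i).2)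
  rw [dotProduct_mulVec, postWeight, ← hs, vecMul_transpose, hs]

theorem postVar_eq (D : Fin t → 𝒳 × ℝ) (x : 𝒳) :
    postVar k σ D x = k x x - ∑ i, postWeight k σ D x i * k x (D i).1 := by
  change k x x - kvec k D x ⬝ᵥ postWeight k σ D x = _
  rw [dotProduct_comm]
  rfl

theorem CenteredGP.postVar_le [IsProbabilityMeasure P] (h : CenteredGP P k f) (hσ : 0 < σ)
    (D : Fin t → 𝒳 × ℝ) (x : 𝒳) : postVar k σ D x ≤ k x x := by
  have := (h.noisyGram_posDef hσ D).inv.posSemidef.dotProduct_mulVec_nonneg (kvec k D x)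
  rw [star_trivial] at this
  change k x x - kvec k D x ⬝ᵥ (noisyGram k σ D)⁻¹ *ᵥ kvec k D x ≤ _
  linarith

/-- The error of predicting `f x` by the posterior mean given the observations `Y`. -/
def residual (k : 𝒳 → 𝒳 → ℝ) (σ : ℝ) (D : Fin t → 𝒳 × ℝ) (x : 𝒳) (f : 𝒳 → Ω → ℝ)
    (N : Fin t → Ω → ℝ) (ω : Ω) : ℝ :=
  f x ω - ∑ i, postWeight k σ D x i * (f (D i).1 ω + N i ω)

variable {N : Fin t → Ω → ℝ}

/-- The weights solve the normal equations (K + σ²I)w = k(x), so the residual is uncorrelated with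
every observation; joint Gaussianity turns this into independence. Orthogonality also makes its
variance equal to its covariance with `f x`, which is the posterior variance. -/
theorem CenteredGP.residual_law [IsProbabilityMeasure P] (h : CenteredGP P k f) (hσ : 0 < σ)
    (D : Fin t → 𝒳 × ℝ) (x : 𝒳) (hN : ∀ i, Measurable (N i))
    (hNlaw : ∀ i, P.map (N i) = gaussianReal 0 (σ ^ 2).toNNReal) (hNind : iIndepFun N P)
    (hfN : IndepFun (fun ω x => f x ω) (fun ω i => N i ω) P) :
    0 ≤ postVar k σ D x ∧
    P.map (residual k σ D x f N) = gaussianReal 0 (postVar k σ D x).toNNReal ∧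
    IndepFun (residual k σ D x f N) (fun ω i => f (D i).1 ω + N i ω) P := by
  classical
  set w := postWeight k σ D x with hw
  have hNg : ∀ i, HasGaussianLaw (N i) P := fun i => ⟨by rw [hNlaw]; infer_instance⟩
  have hNm : ∀ i, MemLp (N i) 2 P := fun i => (hNg i).memLp_two
  have hYm : ∀ i, MemLp (fun ω => f (D i).1 ω + N i ω) 2 P :=
    fun i => (h.memLp _).add (hNm i)
  have hfNi : ∀ x i, covariance (f x) (N i) P = 0 := fun x i =>
    (hfN.comp (measurable_pi_apply x) (measurable_pi_apply i)).covariance_eq_zero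
      (h.memLp x) (hNm i)
  have hNN : ∀ i j, covariance (N i) (N j) P = if i = j then σ ^ 2 else 0 := by
    intro i j
    split_ifs with hij
    · subst hij
      rw [covariance_self (hN i).aemeasurable,
        ← variance_fun_id_gaussianReal (μ := 0) (v := (σ ^ 2).toNNReal) |>.trans
          (Real.coe_toNNReal _ (by positivity)), ← hNlaw i,
        variance_map (by fun_prop) (hN i).aemeasurable]
      rfl
    · exact (hNind.indepFun hij).covariance_eq_zero (hNm i) (hNm j)
  have hYY : ∀ i j, covariance (fun ω => f (D i).1 ω + N i ω)
      (fun ω => f (D j).1 ω + N j ω) P = noisyGram k σ D i j := by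
    intro i j
    change covariance (f (D i).1 + N i) (f (D j).1 + N j) P = _
    rw [covariance_add_left (h.memLp _) (hNm i) ((h.memLp _).add (hNm j)),
      covariance_add_right (h.memLp _) (h.memLp _) (hNm j),
      covariance_add_right (hNm i) (h.memLp _) (hNm j), h.cov_eq, hfNi, hNN,
      covariance_comm (N i), hfNi]
    simp [noisyGram, gram, one_apply]
  have hfY : ∀ x j, covariance (f x) (fun ω => f (D j).1 ω + N j ω) P = k x (D j).1 := by
    intro x j
    change covariance (f x) (f (D j).1 + N j) P = _
    rw [covariance_add_right (h.memLp _) (h.memLp _) (hNm j), h.cov_eq, hfNi, add_zero]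
  have hSm : MemLp (fun ω => ∑ i, w i * (f (D i).1 ω + N i ω)) 2 P :=
    memLp_finsetSum _ fun i _ => (hYm i).const_mul (w i)
  have hrm : MemLp (residual k σ D x f N) 2 P := (h.memLp x).sub hSm
  have hrY : ∀ j, covariance (residual k σ D x f N) (fun ω => f (D j).1 ω + N j ω) P = 0 := by
    intro j
    unfold residual
    rw [covariance_fun_sub_left (h.memLp x) hSm (hYm j), hfY,
      covariance_fun_sum_left (fun i => (hYm i).const_mul (w i)) (hYm j)]
    simp only [covariance_const_mul_left, hYY]
    have := congrFun (h.noisyGram_mulVec_postWeight hσ D x) j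
    simp only [mulVec, dotProduct, kvec] at this
    rw [← this, sub_eq_zero]
    refine Finset.sum_congr rfl fun i _ => ?_
    have hsym : noisyGram k σ D i j = noisyGram k σ D j i := by
      rw [← hYY, ← hYY, covariance_comm]
    rw [hsym, mul_comm]
  have hrmeas : Measurable (residual k σ D x f N) := by
    unfold residual
    have := h.measurable
    fun_prop
  have hvar : variance (residual k σ D x f N) P = postVar k σ D x := by
    rw [← covariance_self hrmeas.aemeasurable]
    have : covariance (residual k σ D x f N) (residual k σ D x f N) P =
        covariance (residual k σ D x f N) (f x) P - covariance (residual k σ D x f N)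
          (fun ω => ∑ i, w i * (f (D i).1 ω + N i ω)) P :=
      covariance_fun_sub_right hrm (h.memLp x) hSm
    rw [this, covariance_fun_sum_right (fun i => (hYm i).const_mul (w i)) hrm]
    simp only [covariance_const_mul_right, hrY, mul_zero, Finset.sum_const_zero, sub_zero]
    unfold residual
    rw [covariance_fun_sub_left (h.memLp x) hSm (h.memLp x), h.cov_eq,
      covariance_fun_sum_left (fun i => (hYm i).const_mul (w i)) (h.memLp x), postVar_eq]
    simp only [covariance_comm _ (f x), covariance_const_mul_right, hfY, hw]
  have hmean : ∫ ω, residual k σ D x f N ω ∂P = 0 := by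
    unfold residual
    have hi : ∀ i, ∫ ω, N i ω ∂P = 0 := fun i => by
      have : ∫ ω, N i ω ∂P = ∫ y, y ∂(P.map (N i)) :=
        (integral_map (f := fun y : ℝ => y) (hN i).aemeasurable
          aestronglyMeasurable_id).symm
      rw [this, hNlaw, integral_id_gaussianReal]
    rw [integral_sub ((h.memLp x).integrable (by norm_num)) (hSm.integrable (by norm_num)),
      integral_finsetSum _ fun i _ => ((hYm i).const_mul (w i)).integrable (by norm_num),
      h.mean_zero]
    simp only [integral_const_mul]
    simp only [integral_add ((h.memLp _).integrable one_le_two)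
      ((hNm _).integrable one_le_two), h.mean_zero, hi]
    simp
  -- Residual and observations are a linear image of finitely many values of f together with the
  -- noise. The residual is written as a family over `Unit` to fit the covariance criterion for
  -- independence.
  have hjoint : HasGaussianLaw (fun ω => ((fun _ : Unit => residual k σ D x f N ω),
      (fun i => f (D i).1 ω + N i ω))) P := by
    let I : Finset 𝒳 := insert x (Finset.univ.image fun i => (D i).1)
    have hN' : HasGaussianLaw (fun ω i => N i ω) P := hNind.hasGaussianLaw hNg
    have hI : IndepFun (fun ω => I.restrict (f · ω)) (fun ω i => N i ω) P :=
      hfN.comp (φ := fun g => I.restrict g) (by fun_prop) measurable_id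
    have hJ := hI.hasGaussianLaw (h.isGaussian.hasGaussianLaw I) hN'
    have hxI : x ∈ I := Finset.mem_insert_self _ _
    have hDI : ∀ i, (D i).1 ∈ I := fun i =>
      Finset.mem_insert_of_mem (Finset.mem_image_of_mem _ (Finset.mem_univ i))
    let Yl : Fin t → ((I → ℝ) × (Fin t → ℝ)) →L[ℝ] ℝ := fun i =>
      (ContinuousLinearMap.proj (⟨(D i).1, hDI i⟩ : I)).comp
          (ContinuousLinearMap.fst ℝ (I → ℝ) (Fin t → ℝ)) +
        (ContinuousLinearMap.proj i).comp (ContinuousLinearMap.snd ℝ (I → ℝ) (Fin t → ℝ))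
    let rl : ((I → ℝ) × (Fin t → ℝ)) →L[ℝ] ℝ :=
      (ContinuousLinearMap.proj (⟨x, hxI⟩ : I)).comp
          (ContinuousLinearMap.fst ℝ (I → ℝ) (Fin t → ℝ)) - ∑ i, w i • Yl i
    refine (hJ.map_fun ((ContinuousLinearMap.pi fun _ : Unit => rl).prod
      (ContinuousLinearMap.pi Yl))).congr (.of_forall fun ω => ?_)
    ext i <;> simp [rl, Yl, residual, hw, mul_add]
  have hlaw : HasGaussianLaw (residual k σ D x f N) P := by
    have := hjoint.map ((ContinuousLinearMap.proj ()).comp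
      (ContinuousLinearMap.fst ℝ (Unit → ℝ) (Fin t → ℝ)))
    exact this
  refine ⟨hvar ▸ variance_nonneg _ _, ?_, ?_⟩
  · rw [hlaw.map_eq_gaussianReal, hmean, hvar]
  · have := hjoint.indepFun_of_covariance_eval (X := fun _ : Unit => residual k σ D x f N)
      (Y := fun i ω => f (D i).1 ω + N i ω) fun _ j => hrY j
    exact this.comp (measurable_pi_apply ()) measurable_id

end Residual

-- Bayes' rule for Gaussian observations.

section Bayes

theorem gaussianPDFReal_le (m : ℝ) (v : ℝ≥0) (x : ℝ) :
    gaussianPDFReal m v x ≤ (√(2 * Real.pi * v))⁻¹ := by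
  rw [gaussianPDFReal]
  refine mul_le_of_le_one_right (by positivity) (Real.exp_le_one_iff.2 ?_)
  rw [neg_div]
  exact neg_nonpos.2 (by positivity)

theorem continuous_gaussianPDFReal (v : ℝ≥0) :
    Continuous fun p : ℝ × ℝ => gaussianPDFReal p.1 v p.2 := by
  simp only [gaussianPDFReal]
  fun_prop

theorem continuous_gaussianPDF (v : ℝ≥0) :
    Continuous fun p : ℝ × ℝ => gaussianPDF p.1 v p.2 :=
  ENNReal.continuous_ofReal.comp (continuous_gaussianPDFReal v)

theorem gaussianPDF_le (m : ℝ) (v : ℝ≥0) (x : ℝ) :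
    gaussianPDF m v x ≤ ENNReal.ofReal (√(2 * Real.pi * v))⁻¹ :=
  ENNReal.ofReal_le_ofReal (gaussianPDFReal_le m v x)

theorem withDensity_prod_gaussianPDF {ι : Type*} [Fintype ι] (c : ι → ℝ) {v : ℝ≥0} (hv : v ≠ 0) :
    (volume : Measure (ι → ℝ)).withDensity (fun y => ∏ i, gaussianPDF (c i) v (y i)) =
      Measure.pi fun i => gaussianReal (c i) v := by
  refine (Measure.pi_eq fun s hs => ?_).symm
  rw [withDensity_apply _ (MeasurableSet.univ_pi hs), volume_pi, Measure.restrict_pi_pi]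
  have hint : ∀ i, Integrable (gaussianPDFReal (c i) v) (volume.restrict (s i)) :=
    fun i => (integrable_gaussianPDFReal _ _).restrict
  have h1 : ∀ y : ι → ℝ, ∏ i, gaussianPDF (c i) v (y i) =
      ENNReal.ofReal (∏ i, gaussianPDFReal (c i) v (y i)) := fun y => by
    rw [ENNReal.ofReal_prod_of_nonneg fun i _ => gaussianPDFReal_nonneg _ _ _]
    rfl
  simp_rw [h1]
  rw [← ofReal_integral_eq_lintegral_ofReal (Integrable.fintype_prod hint)
    (.of_forall fun y => Finset.prod_nonneg fun i _ => gaussianPDFReal_nonneg _ _ _),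
    integral_fintype_prod_eq_prod, ENNReal.ofReal_prod_of_nonneg fun i _ =>
      integral_nonneg fun y => gaussianPDFReal_nonneg _ _ _]
  exact Finset.prod_congr rfl fun i _ => (gaussianReal_apply_eq_integral _ hv _).symm

/-- Used to upgrade identities between densities from almost every observation to every observation.
-/
theorem continuous_lintegral_of_bounded {Ω Y : Type*} [MeasurableSpace Ω] [TopologicalSpace Y]
    [FirstCountableTopology Y] (P : Measure Ω) [IsFiniteMeasure P] {F : Y → Ω → ℝ≥0∞} {C : ℝ≥0∞}
    (hC : C ≠ ∞) (hF : ∀ y, Measurable (F y)) (hFC : ∀ y ω, F y ω ≤ C)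
    (hcont : ∀ ω, Continuous fun y => F y ω) : Continuous fun y => ∫⁻ ω, F y ω ∂P := by
  refine continuous_iff_continuousAt.2 fun y => ?_
  refine tendsto_lintegral_filter_of_dominated_convergence (fun _ => C)
    (.of_forall hF) (.of_forall fun y => .of_forall (hFC y)) ?_
    (.of_forall fun ω => (hcont ω).tendsto y)
  simpa using ENNReal.mul_ne_top hC (measure_ne_top _ _)

variable {𝒳 Ω : Type*} [MeasurableSpace Ω] {P : Measure Ω} {k : 𝒳 → 𝒳 → ℝ} {f : 𝒳 → Ω → ℝ}
  {σ : ℝ} {t : ℕ}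

/-- The likelihood of the objective `g` for the data set `D`. -/
def lik (σ : ℝ) (D : Fin t → 𝒳 × ℝ) (g : 𝒳 → ℝ) : ℝ≥0∞ :=
  ∏ i, gaussianPDF (g (D i).1) (σ ^ 2).toNNReal (D i).2

theorem lik_def (D : Fin t → 𝒳 × ℝ) (g : 𝒳 → ℝ) :
    lik σ D g = ∏ i, gaussianPDF (g (D i).1) (σ ^ 2).toNNReal (D i).2 := rfl

attribute [irreducible] lik

/-- An upper bound of the likelihood of a data set with `t` observations. -/
def likBound (σ : ℝ) (t : ℕ) : ℝ≥0∞ :=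
  ∏ _i : Fin t, ENNReal.ofReal (√(2 * Real.pi * (σ ^ 2).toNNReal))⁻¹

theorem likBound_ne_top (σ : ℝ) (t : ℕ) : likBound σ t ≠ ∞ :=
  ENNReal.prod_ne_top fun _ _ => ENNReal.ofReal_ne_top

theorem lik_le (D : Fin t → 𝒳 × ℝ) (g : 𝒳 → ℝ) : lik σ D g ≤ likBound σ t := by
  rw [lik_def]
  exact Finset.prod_le_prod' fun _ _ => gaussianPDF_le _ _ _

theorem CenteredGP.measurable_lik (h : CenteredGP P k f) (D : Fin t → 𝒳 × ℝ) :
    Measurable fun ω => lik σ D (f · ω) := by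
  simp only [lik_def]
  refine Finset.measurable_fun_prod _ fun i _ => ?_
  exact (continuous_gaussianPDF (σ ^ 2).toNNReal).measurable.comp
    (f := fun ω => (f (D i).1 ω, (D i).2)) ((h.measurable _).prodMk measurable_const)

/-- Makes room for auxiliary noise, independent of the process, on a second factor. -/
theorem CenteredGP.comp_fst {Ω' : Type*} [MeasurableSpace Ω'] [IsProbabilityMeasure P]
    (h : CenteredGP P k f)
    (Q : Measure Ω') [IsProbabilityMeasure Q] :
    CenteredGP (P.prod Q) k (fun x (p : Ω × Ω') => f x p.1) := by
  have hmap : (P.prod Q).map Prod.fst = P := by simp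
  refine ⟨fun x => (h.measurable x).comp measurable_fst, ⟨fun I => ⟨?_⟩⟩, fun x => ?_,
    fun x y => ?_⟩
  · have := (h.isGaussian.hasGaussianLaw I).isGaussian_map
    have hm := h.measurable
    rw [← hmap, Measure.map_map (by fun_prop) (by fun_prop)] at this
    exact this
  · rw [← h.mean_zero x]
    conv_rhs => rw [← hmap]
    exact (integral_map measurable_fst.aemeasurable
      (h.measurable x).aestronglyMeasurable).symm
  · rw [← h.cov_eq x y]
    conv_rhs => rw [← hmap]
    exact (covariance_map_fun (h.measurable x).aestronglyMeasurable
      (h.measurable y).aestronglyMeasurable measurable_fst.aemeasurable).symm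

/-- Keep the inputs of `D` and let the observed values y vary. On an enlarged space, f(x) = m(Y) + R
with R independent of the observations Y, and Y has the mean likelihood as its density. Testing
against sets of y gives the identity for almost every y. Both sides are continuous in y, so it holds
at the values recorded in `D`. -/
theorem CenteredGP.posterior_test [IsProbabilityMeasure P] (h : CenteredGP P k f) (hσ : 0 < σ)
    (D : Fin t → 𝒳 × ℝ) (x : 𝒳) {φ : ℝ → ℝ≥0} (hφc : Continuous φ) {C : ℝ≥0} (hφb : ∀ a, φ a ≤ C) :
    ∫⁻ ω, φ (f x ω) * lik σ D (f · ω) ∂P =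
      (∫⁻ u, φ (postMean k σ D x + u) ∂gaussianReal 0 (postVar k σ D x).toNNReal) *
        ∫⁻ ω, lik σ D (f · ω) ∂P := by
  set v := (σ ^ 2).toNNReal with hvdef
  have hv : v ≠ 0 := by
    rw [hvdef]; exact (Real.toNNReal_pos.2 (by positivity)).ne'
  set w := postWeight k σ D x with hw
  let E : (Fin t → ℝ) → Fin t → 𝒳 × ℝ := fun y i => ((D i).1, y i)
  have hE : E (fun i => (D i).2) = D := rfl
  let G : Measure (Fin t → ℝ) := Measure.pi fun _ => gaussianReal 0 v
  let Y : Ω × (Fin t → ℝ) → Fin t → ℝ := fun p i => f (D i).1 p.1 + p.2 i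
  have hm := h.measurable
  have hY : Measurable Y := by fun_prop
  let H : ℝ → ℝ≥0∞ := fun c => ∫⁻ u, φ (c + u) ∂gaussianReal 0 (postVar k σ D x).toNNReal
  let m : (Fin t → ℝ) → ℝ := fun y => ∑ i, w i * y i
  have hφ : Measurable fun a => (φ a : ℝ≥0∞) := hφc.measurable.coe_nnreal_ennreal
  have hφC : ∀ a, (φ a : ℝ≥0∞) ≤ C := fun a => ENNReal.coe_le_coe.2 (hφb a)
  have hHcont : Continuous H :=
    continuous_lintegral_of_bounded _ (C := C) ENNReal.coe_ne_top
      (fun c => hφ.comp (measurable_const_add c)) (fun c u => hφC _)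
      (fun u => ENNReal.continuous_coe.comp (hφc.comp (by fun_prop)))
  have hmcont : Continuous m := by fun_prop
  have hlikm : Measurable fun p : Ω × (Fin t → ℝ) => lik σ (E p.2) (f · p.1) := by
    simp only [lik_def]
    refine Finset.measurable_fun_prod _ fun i _ => ?_
    exact (continuous_gaussianPDF v).measurable.comp
      (f := fun p : Ω × (Fin t → ℝ) => (f (D i).1 p.1, p.2 i)) (by fun_prop)
  -- integration against the law of the observations
  have key : ∀ (a : Ω → ℝ≥0∞) (g : (Fin t → ℝ) → ℝ≥0∞), Measurable a → Measurable g →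
      ∫⁻ p, a p.1 * g (Y p) ∂(P.prod G) =
        ∫⁻ y, g y * ∫⁻ ω, a ω * lik σ (E y) (f · ω) ∂P := by
    intro a g ha hg
    rw [lintegral_prod _ (by fun_prop)]
    have h1 : ∀ ω, ∫⁻ e, a ω * g (Y (ω, e)) ∂G =
        ∫⁻ y, a ω * g y * lik σ (E y) (f · ω) := by
      intro ω
      have hG : G.map (fun e i => f (D i).1 ω + e i) =
          volume.withDensity (fun y => lik σ (E y) (f · ω)) := by
        simp only [lik_def, E, ← hvdef]
        rw [withDensity_prod_gaussianPDF _ hv]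
        have := Measure.pi_map_pi (μ := fun _ : Fin t => gaussianReal 0 v)
          (f := fun i y => f (D i).1 ω + y) (fun i => (measurable_const_add _).aemeasurable)
        rw [this]
        simp [gaussianReal_map_const_add]
      have h2 := lintegral_map (μ := G) (f := fun y => a ω * g y)
        (g := fun e i => f (D i).1 ω + e i) (by fun_prop) (by fun_prop)
      rw [← h2, hG, lintegral_withDensity_eq_lintegral_mul _
        (f := fun y => lik σ (E y) (f · ω)) (hlikm.comp measurable_prodMk_left)
        (g := fun y => a ω * g y) (by fun_prop)]
      simp only [Pi.mul_apply, mul_comm]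
    simp_rw [h1]
    rw [lintegral_lintegral_swap]
    · refine lintegral_congr fun y => ?_
      rw [← lintegral_const_mul _ (f := fun ω => a ω * lik σ (E y) (f · ω))
        (ha.mul (hlikm.comp measurable_prodMk_right))]
      exact lintegral_congr fun ω => by ring
    · exact (((ha.comp measurable_fst).mul (hg.comp measurable_snd)).mul hlikm).aemeasurable
  -- the residual is independent of the observations
  have hres := (h.comp_fst G).residual_law hσ D x (N := fun i p => p.2 i) (fun i => by fun_prop)
    (fun i => by
      have : (fun p : Ω × (Fin t → ℝ) => p.2 i) = (Function.eval i) ∘ Prod.snd := rfl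
      rw [this, ← Measure.map_map (measurable_pi_apply i) measurable_snd, Measure.map_snd_prod]
      simp [G, Measure.pi_map_eval, hvdef])
    (by
      rw [iIndepFun_iff_map_fun_eq_pi_map fun i => by fun_prop]
      have h1 : ∀ i, (P.prod G).map (fun p => p.2 i) = gaussianReal 0 v := fun i => by
        have : (fun p : Ω × (Fin t → ℝ) => p.2 i) = (Function.eval i) ∘ Prod.snd := rfl
        rw [this, ← Measure.map_map (measurable_pi_apply i) measurable_snd, Measure.map_snd_prod]
        simp [G, Measure.pi_map_eval]
      simp_rw [h1]
      change (P.prod G).map Prod.snd = G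
      simp)
    (indepFun_prod (X := fun ω x => f x ω) (Y := fun e : Fin t → ℝ => e) (by fun_prop)
      (by fun_prop))
  obtain ⟨-, hrlaw, hrind⟩ := hres
  set R := residual k σ D x (fun x (p : Ω × (Fin t → ℝ)) => f x p.1) (fun i p => p.2 i) with hR
  have hRm : Measurable R := by unfold R residual; fun_prop
  have hfx : ∀ p, f x p.1 = m (Y p) + R p := fun p => by
    simp [hR, residual, m, Y, hw]
  -- Both sides are compared on every measurable set `s` of observations: `key` rewrites them as
  -- expectations involving Y, and the left one is then split by independence of R and Y.
  have hae : (fun y => ∫⁻ ω, φ (f x ω) * lik σ (E y) (f · ω) ∂P) =ᵐ[volume]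
      fun y => H (m y) * ∫⁻ ω, 1 * lik σ (E y) (f · ω) ∂P := by
    have hLm : ∀ a : Ω → ℝ≥0∞, Measurable a →
        Measurable fun y => ∫⁻ ω, a ω * lik σ (E y) (f · ω) ∂P := fun a ha =>
      ((ha.comp measurable_fst).mul hlikm).lintegral_prod_left'
    refine ae_eq_of_forall_setLIntegral_eq_of_sigmaFinite (hLm _ (hφ.comp (h.measurable x)))
      ((hHcont.measurable.comp hmcont.measurable).mul (hLm _ measurable_const)) fun s hs _ => ?_
    have hgs : Measurable (s.indicator (fun _ => (1 : ℝ≥0∞))) := measurable_const.indicator hs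
    have hind : ∀ F : (Fin t → ℝ) → ℝ≥0∞, ∫⁻ y in s, F y =
        ∫⁻ y, s.indicator (fun _ => (1 : ℝ≥0∞)) y * F y := fun F => by
      rw [← lintegral_indicator hs]
      exact lintegral_congr fun y => by by_cases hy : y ∈ s <;> simp [hy]
    rw [hind, hind, ← key (fun ω => φ (f x ω)) _ (hφ.comp (h.measurable x)) hgs]
    have e1 : ∫⁻ y, s.indicator (fun _ => (1 : ℝ≥0∞)) y *
        (H (m y) * ∫⁻ ω, 1 * lik σ (E y) (f · ω) ∂P) =
        ∫⁻ p, 1 * (s.indicator (fun _ => (1 : ℝ≥0∞)) (Y p) * H (m (Y p))) ∂(P.prod G) := by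
      rw [key (fun _ => 1) (fun y => s.indicator (fun _ => (1 : ℝ≥0∞)) y * H (m y))
        measurable_const (hgs.mul (hHcont.measurable.comp hmcont.measurable))]
      exact lintegral_congr fun y => by ring
    rw [e1]
    have e2 : ∀ p : Ω × (Fin t → ℝ), (φ (f x p.1) : ℝ≥0∞) *
        s.indicator (fun _ => (1 : ℝ≥0∞)) (Y p) =
        (fun q : ℝ × (Fin t → ℝ) => (φ (m q.2 + q.1) : ℝ≥0∞) *
          s.indicator (fun _ => (1 : ℝ≥0∞)) q.2) (R p, Y p) := fun p => by
      simp only [hfx p]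
    have hq : Measurable fun q : ℝ × (Fin t → ℝ) => (φ (m q.2 + q.1) : ℝ≥0∞) *
        s.indicator (fun _ => (1 : ℝ≥0∞)) q.2 :=
      (hφ.comp (by fun_prop)).mul (hgs.comp measurable_snd)
    rw [lintegral_congr e2, ← lintegral_map hq (hRm.prodMk hY),
      (indepFun_iff_map_prod_eq_prod_map_map hRm.aemeasurable hY.aemeasurable).1 hrind,
      lintegral_prod_symm _ hq.aemeasurable, lintegral_map hq.lintegral_prod_left' hY]
    refine lintegral_congr fun p => ?_
    rw [hrlaw]
    simp only
    rw [lintegral_mul_const _ (f := fun u => (φ (m (Y p) + u) : ℝ≥0∞))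
      (hφ.comp (measurable_const_add _)), one_mul, mul_comm]
  have hlikcont : ∀ ω, Continuous fun y => lik σ (E y) (f · ω) := fun ω => by
    have h1 : ∀ y, lik σ (E y) (f · ω) =
        ENNReal.ofReal (∏ i, gaussianPDFReal (f (D i).1 ω) v (y i)) := fun y => by
      rw [ENNReal.ofReal_prod_of_nonneg fun i _ => gaussianPDFReal_nonneg _ _ _, lik_def]
      rfl
    simp_rw [h1]
    refine ENNReal.continuous_ofReal.comp (continuous_finsetProd _ fun i _ => ?_)
    exact (continuous_gaussianPDFReal v).comp
      (f := fun y : Fin t → ℝ => (f (D i).1 ω, y i)) (by fun_prop)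
  have hpcont : ∀ (a : Ω → ℝ≥0∞) (C : ℝ≥0∞), C ≠ ∞ → Measurable a → (∀ ω, a ω ≤ C) →
      Continuous fun y => ∫⁻ ω, a ω * lik σ (E y) (f · ω) ∂P := fun a C hC ha haC =>
    continuous_lintegral_of_bounded P (C := C * likBound σ t)
      (ENNReal.mul_ne_top hC (likBound_ne_top σ t))
      (fun y => ha.mul (hlikm.comp measurable_prodMk_right))
      (fun y ω => mul_le_mul' (haC ω) (lik_le _ _))
      (fun ω => ENNReal.continuous_const_mul (ne_top_of_le_ne_top hC (haC ω)) |>.comp (hlikcont ω))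
  have hfin : ∀ y, ∫⁻ ω, 1 * lik σ (E y) (f · ω) ∂P ≠ ∞ := fun y => by
    refine ne_top_of_le_ne_top (likBound_ne_top σ t) ?_
    calc _ ≤ ∫⁻ _, likBound σ t ∂P := lintegral_mono fun ω => by rw [one_mul]; exact lik_le _ _
      _ = _ := by simp
  have hHfin : ∀ c, H c ≠ ∞ := fun c => by
    refine ne_top_of_le_ne_top (ENNReal.coe_ne_top (r := C)) ?_
    calc _ ≤ ∫⁻ _, (C : ℝ≥0∞) ∂(gaussianReal 0 (postVar k σ D x).toNNReal) :=
          lintegral_mono fun u => hφC _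
      _ = _ := by simp
  have heq := (Continuous.ae_eq_iff_eq volume (hpcont (fun ω => φ (f x ω)) C ENNReal.coe_ne_top
    (hφ.comp (h.measurable x)) (fun ω => hφC _)) (by
      refine continuous_iff_continuousAt.2 fun y => ENNReal.Tendsto.mul
        ((hHcont.comp hmcont).tendsto y) (.inr (hfin y))
        ((hpcont (fun _ => 1) 1 ENNReal.one_ne_top measurable_const (fun _ => le_rfl)).tendsto y)
        (.inr (hHfin _)))).1 hae
  have := congrFun heq (fun i => (D i).2)
  simp only [one_mul, hE] at this
  rw [h.postMean_eq hσ D x]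
  exact this

/-- Bounded continuous tests determine a finite measure. The posterior is left unnormalized, so that
nothing has to be divided by the evidence. -/
theorem CenteredGP.posterior [IsProbabilityMeasure P] (h : CenteredGP P k f) (hσ : 0 < σ)
    (D : Fin t → 𝒳 × ℝ) (x : 𝒳) :
    (P.withDensity fun ω => lik σ D (f · ω)).map (f x) =
      (∫⁻ ω, lik σ D (f · ω) ∂P) •
        gaussianReal (postMean k σ D x) (postVar k σ D x).toNNReal := by
  have hfin : IsFiniteMeasure (P.withDensity fun ω => lik σ D (f · ω)) := by
    refine isFiniteMeasure_withDensity (ne_top_of_le_ne_top (likBound_ne_top σ t) ?_)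
    calc _ ≤ ∫⁻ _, likBound σ t ∂P := lintegral_mono fun ω => lik_le _ _
      _ = _ := by simp
  refine ext_of_forall_lintegral_eq_of_IsFiniteMeasure fun φ => ?_
  have hφ : Measurable fun a => (φ a : ℝ≥0∞) := φ.continuous.measurable.coe_nnreal_ennreal
  rw [lintegral_map hφ (h.measurable x), lintegral_withDensity_eq_lintegral_mul _
    (h.measurable_lik D) (by exact hφ.comp (h.measurable x)), lintegral_smul_measure]
  have := h.posterior_test hσ D x φ.continuous
    (BoundedContinuousFunction.NNReal.upper_bound φ)
  simp only [Pi.mul_apply, mul_comm (lik _ _ _), this]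
  rw [smul_eq_mul, mul_comm]
  congr 1
  have hg := gaussianReal_map_const_add (μ := 0) (v := (postVar k σ D x).toNNReal)
    (postMean k σ D x)
  rw [zero_add] at hg
  rw [← hg, lintegral_map hφ (measurable_const_add _)]

end Bayes

-- Measurability of the posterior and of the collected data.

section Measurability

variable {𝒳 : Type*} [MeasurableSpace 𝒳] {t : ℕ}

theorem measurable_det {ι α : Type*} [Fintype ι] [DecidableEq ι] [MeasurableSpace α]
    {A : α → Matrix ι ι ℝ} (hA : ∀ i j, Measurable fun a => A a i j) :
    Measurable fun a => (A a).det := by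
  simp only [det_apply]
  refine Finset.measurable_fun_sum _ fun τ _ => ?_
  exact (Finset.measurable_fun_prod _ fun i _ => hA _ _).const_smul _

theorem measurable_matrix_inv {ι α : Type*} [Fintype ι] [DecidableEq ι] [MeasurableSpace α]
    {A : α → Matrix ι ι ℝ} (hA : ∀ i j, Measurable fun a => A a i j) (i j : ι) :
    Measurable fun a => (A a)⁻¹ i j := by
  simp only [inv_def, Ring.inverse_eq_inv', Matrix.smul_apply, smul_eq_mul, adjugate_apply]
  refine (measurable_det hA).inv.mul (measurable_det fun i' j' => ?_)
  simp only [updateRow_apply]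
  split_ifs
  · exact measurable_const
  · exact hA _ _

variable {k : 𝒳 → 𝒳 → ℝ}

theorem measurable_inv_gram (hk : Measurable (Function.uncurry k)) (σ : ℝ) (i j : Fin t) :
    Measurable fun p : (Fin t → 𝒳 × ℝ) × 𝒳 =>
      (gram k p.1 + σ ^ 2 • (1 : Matrix (Fin t) (Fin t) ℝ))⁻¹ i j := by
  refine measurable_matrix_inv (A := fun p : (Fin t → 𝒳 × ℝ) × 𝒳 =>
    gram k p.1 + σ ^ 2 • (1 : Matrix (Fin t) (Fin t) ℝ)) (fun i j => ?_) i j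
  simp only [gram, Matrix.add_apply, of_apply]
  refine Measurable.add_const ?_ _
  exact hk.comp (g := Function.uncurry k)
    (f := fun p : (Fin t → 𝒳 × ℝ) × 𝒳 => ((p.1 i).1, (p.1 j).1)) (by fun_prop)

theorem measurable_kvec (hk : Measurable (Function.uncurry k)) (i : Fin t) :
    Measurable fun p : (Fin t → 𝒳 × ℝ) × 𝒳 => kvec k p.1 p.2 i :=
  hk.comp (g := Function.uncurry k)
    (f := fun p : (Fin t → 𝒳 × ℝ) × 𝒳 => (p.2, (p.1 i).1)) (by fun_prop)

theorem measurable_postMean (hk : Measurable (Function.uncurry k)) (σ : ℝ) :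
    Measurable fun p : (Fin t → 𝒳 × ℝ) × 𝒳 => postMean k σ p.1 p.2 := by
  simp only [postMean, dotProduct, mulVec]
  exact Finset.measurable_fun_sum _ fun i _ => (measurable_kvec hk i).mul
    (Finset.measurable_fun_sum _ fun j _ => (measurable_inv_gram hk σ i j).mul (by fun_prop))

theorem measurable_postVar (hk : Measurable (Function.uncurry k)) (σ : ℝ) :
    Measurable fun p : (Fin t → 𝒳 × ℝ) × 𝒳 => postVar k σ p.1 p.2 := by
  simp only [postVar, dotProduct, mulVec]
  refine Measurable.sub ?_ ?_
  · exact hk.comp (g := Function.uncurry k)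
      (f := fun p : (Fin t → 𝒳 × ℝ) × 𝒳 => (p.2, p.2)) (by fun_prop)
  · exact Finset.measurable_fun_sum _ fun i _ => (measurable_kvec hk i).mul
      (Finset.measurable_fun_sum _ fun j _ => (measurable_inv_gram hk σ i j).mul
        (measurable_kvec hk j))

theorem measurable_snoc {α : Type*} [MeasurableSpace α] {D : α → Fin t → 𝒳 × ℝ}
    {y : α → 𝒳 × ℝ} (hD : Measurable D) (hy : Measurable y) :
    Measurable fun a => (Fin.snoc (α := fun _ => 𝒳 × ℝ) (D a) (y a) : Fin (t + 1) → 𝒳 × ℝ) := by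
  refine measurable_pi_iff.2 fun i => ?_
  induction i using Fin.lastCases with
  | last => simpa using hy
  | cast i => simpa [Function.comp_def] using (measurable_pi_apply i).comp hD

variable {sel : ∀ t : ℕ, (Fin t → 𝒳 × ℝ) → ℝ → 𝒳}

theorem measurable_dataset {S : Type*} [MeasurableSpace S] {f : 𝒳 → S → ℝ}
    (hf : Measurable (Function.uncurry f)) (hsel : ∀ t, Measurable (Function.uncurry (sel t)))
    (t : ℕ) : Measurable fun p : S × (ℕ → ℝ) × (ℕ → ℝ) =>
      dataset sel (f · p.1) p.2.1 p.2.2 t := by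
  induction t with
  | zero => exact measurable_const
  | succ t ih =>
    have hx : Measurable fun p : S × (ℕ → ℝ) × (ℕ → ℝ) =>
        sel t (dataset sel (f · p.1) p.2.1 p.2.2 t) (p.2.2 t) :=
      (hsel t).comp (g := Function.uncurry (sel t)) (ih.prodMk (by fun_prop))
    simp only [dataset]
    refine measurable_snoc ih (hx.prodMk (Measurable.add ?_ (by fun_prop)))
    exact hf.comp (hx.prodMk measurable_fst)

theorem dataset_congr (g : 𝒳 → ℝ) {e e' z z' : ℕ → ℝ} {t : ℕ} (he : ∀ i < t, e i = e' i)
    (hz : ∀ i < t, z i = z' i) : dataset sel g e z t = dataset sel g e' z' t := by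
  induction t with
  | zero => rfl
  | succ t ih =>
    have := ih (fun i hi => he i (by omega)) (fun i hi => hz i (by omega))
    simp only [dataset, this, he t (by omega), hz t (by omega)]

end Measurability

/-- By `hdep`, `H` factors through the first `t` coordinates; padding these by zeros does not change
its value. -/
theorem indepFun_of_past {Ω α : Type*} [MeasurableSpace Ω] [MeasurableSpace α] {P : Measure Ω}
    {ξ : ℕ → Ω → ℝ} (hm : ∀ t, Measurable (ξ t)) (hind : iIndepFun ξ P) {t : ℕ}
    {H : (ℕ → ℝ) → α} (hH : Measurable H)
    (hdep : ∀ z z' : ℕ → ℝ, (∀ i < t, z i = z' i) → H z = H z') :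
    IndepFun (fun ω => H fun i => ξ i ω) (ξ t) P := by
  classical
  let ext : (Finset.range t → ℝ) → ℕ → ℝ := fun e i =>
    if h : i ∈ Finset.range t then e ⟨i, h⟩ else 0
  have hext : Measurable ext := measurable_pi_iff.2 fun i => by
    simp only [ext]
    split_ifs
    · fun_prop
    · exact measurable_const
  have h1 := hind.indepFun_finset (Finset.range t) {t} (by simp) hm
  have h2 := h1.comp (hH.comp hext) (measurable_pi_apply (⟨t, by simp⟩ : ({t} : Finset ℕ)))
  refine h2.congr (.of_forall fun ω => ?_) (.of_forall fun ω => rfl)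
  refine hdep _ _ fun i hi => ?_
  simp [ext, hi]

-- The law of adaptively collected data.

section Adaptive

variable {𝒳 : Type*} [MeasurableSpace 𝒳] {sel : ∀ t : ℕ, (Fin t → 𝒳 × ℝ) → ℝ → 𝒳} {σ : ℝ}

/-- The reference measure on data sets under which the inputs follow the selection rule and the
observed values are distributed according to the Lebesgue measure. -/
def base (sel : ∀ t : ℕ, (Fin t → 𝒳 × ℝ) → ℝ → 𝒳) (z : ℕ → ℝ) :
    (t : ℕ) → Measure (Fin t → 𝒳 × ℝ)
  | 0 => Measure.dirac Fin.elim0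
  | t + 1 => ((base sel z t).prod (volume : Measure ℝ)).map fun p =>
      Fin.snoc (α := fun _ => 𝒳 × ℝ) p.1 (sel t p.1 (z t), p.2)

instance base_sFinite (z : ℕ → ℝ) (t : ℕ) : SFinite (base sel z t) := by
  induction t with
  | zero => rw [base]; infer_instance
  | succ t ih => rw [base]; infer_instance

theorem lik_snoc {t : ℕ} (D : Fin t → 𝒳 × ℝ) (x : 𝒳) (w : ℝ) (g : 𝒳 → ℝ) :
    lik σ (Fin.snoc (α := fun _ => 𝒳 × ℝ) D (x, w) : Fin (t + 1) → 𝒳 × ℝ) g =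
      lik σ D g * gaussianPDF (g x) (σ ^ 2).toNNReal w := by
  simp [lik_def, Fin.prod_univ_castSucc]

theorem measurable_lik_uncurry {S : Type*} [MeasurableSpace S] {f : 𝒳 → S → ℝ}
    (hf : Measurable (Function.uncurry f)) (t : ℕ) :
    Measurable fun p : (Fin t → 𝒳 × ℝ) × S => lik σ p.1 (f · p.2) := by
  simp only [lik_def]
  refine Finset.measurable_fun_prod _ fun i _ => ?_
  refine (continuous_gaussianPDF (σ ^ 2).toNNReal).measurable.comp
    (f := fun p : (Fin t → 𝒳 × ℝ) × S => (f (p.1 i).1 p.2, (p.1 i).2)) (Measurable.prodMk ?_ ?_)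
  · exact hf.comp (f := fun p : (Fin t → 𝒳 × ℝ) × S => ((p.1 i).1, p.2)) (by fun_prop)
  · fun_prop

variable {Ω : Type*} [MeasurableSpace Ω] {ν : Measure Ω} [IsProbabilityMeasure ν]
  {ε : ℕ → Ω → ℝ}

/-- Given the past, a new value is Gaussian around g at the selected input, so each round
contributes one likelihood factor relative to Lebesgue measure. The selection rule never sees `g`,
hence one reference measure serves all objectives. -/
theorem lintegral_dataset (hσ : 0 < σ) (hε : IsGaussianNoise ν σ ε)
    (hsel : ∀ t, Measurable (Function.uncurry (sel t))) {g : 𝒳 → ℝ} (hg : Measurable g)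
    (z : ℕ → ℝ) (t : ℕ) {ψ : (Fin t → 𝒳 × ℝ) → ℝ≥0∞} (hψ : Measurable ψ) :
    ∫⁻ ω, ψ (dataset sel g (fun i => ε i ω) z t) ∂ν =
      ∫⁻ D, ψ D * lik σ D g ∂base sel z t := by
  set v := (σ ^ 2).toNNReal with hvdef
  have hv : v ≠ 0 := by
    rw [hvdef]; exact (Real.toNNReal_pos.2 (by positivity)).ne'
  induction t with
  | zero => simp [dataset, base, lik_def]
  | succ t ih =>
    have hx : Measurable fun D : Fin t → 𝒳 × ℝ => sel t D (z t) :=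
      (hsel t).comp (g := Function.uncurry (sel t)) (measurable_id.prodMk measurable_const)
    have hsn : Measurable fun p : (Fin t → 𝒳 × ℝ) × ℝ =>
        (Fin.snoc (α := fun _ => 𝒳 × ℝ) p.1 (sel t p.1 (z t), p.2) : Fin (t + 1) → 𝒳 × ℝ) :=
      measurable_snoc measurable_fst ((hx.comp measurable_fst).prodMk measurable_snd)
    have hgx : Measurable fun D : Fin t → 𝒳 × ℝ => g (sel t D (z t)) := hg.comp hx
    have hdat : Measurable fun e : ℕ → ℝ => dataset sel g e z t := by
      have := measurable_dataset (S := Unit) (f := fun x _ => g x) (sel := sel)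
        (hg.comp measurable_fst) hsel t
      exact this.comp (f := fun e : ℕ → ℝ => ((), e, z)) (by fun_prop)
    have hdatε : Measurable fun ω => dataset sel g (fun i => ε i ω) z t :=
      hdat.comp (measurable_pi_iff.2 hε.measurable)
    have hind : IndepFun (fun ω => dataset sel g (fun i => ε i ω) z t) (ε t) ν :=
      indepFun_of_past hε.measurable hε.indep hdat
        fun e e' he => dataset_congr g he fun _ _ => rfl
    let F : (Fin t → 𝒳 × ℝ) × ℝ → ℝ≥0∞ := fun p => ψ (Fin.snoc (α := fun _ => 𝒳 × ℝ) p.1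
      (sel t p.1 (z t), g (sel t p.1 (z t)) + p.2))
    have hF : Measurable F := hψ.comp (hsn.comp (f := fun p : (Fin t → 𝒳 × ℝ) × ℝ =>
      (p.1, g (sel t p.1 (z t)) + p.2)) (by fun_prop))
    have h1 : ∀ D : Fin t → 𝒳 × ℝ, ∫⁻ e, F (D, e) ∂gaussianReal 0 v =
        ∫⁻ w, ψ (Fin.snoc (α := fun _ => 𝒳 × ℝ) D (sel t D (z t), w)) *
          gaussianPDF (g (sel t D (z t))) v w := by
      intro D
      have hψD : Measurable fun w => ψ (Fin.snoc (α := fun _ => 𝒳 × ℝ) D (sel t D (z t), w)) :=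
        hψ.comp (hsn.comp measurable_prodMk_left)
      have hs := gaussianReal_map_const_add (μ := 0) (v := v) (g (sel t D (z t)))
      rw [zero_add, gaussianReal_of_var_ne_zero (g (sel t D (z t))) hv] at hs
      have hm := lintegral_map (μ := gaussianReal 0 v) hψD
        (measurable_const_add (g (sel t D (z t))))
      rw [hs] at hm
      change ∫⁻ e, ψ (Fin.snoc (α := fun _ => 𝒳 × ℝ) D
        (sel t D (z t), g (sel t D (z t)) + e)) ∂gaussianReal 0 v = _
      rw [← hm, lintegral_withDensity_eq_lintegral_mul _ (measurable_gaussianPDF _ _) hψD]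
      simp only [Pi.mul_apply, mul_comm]
    calc ∫⁻ ω, ψ (dataset sel g (fun i => ε i ω) z (t + 1)) ∂ν
        = ∫⁻ ω, F (dataset sel g (fun i => ε i ω) z t, ε t ω) ∂ν := rfl
      _ = ∫⁻ ω, ∫⁻ e, F (dataset sel g (fun i => ε i ω) z t, e) ∂gaussianReal 0 v ∂ν := by
          rw [← lintegral_map hF (hdatε.prodMk (hε.measurable t)),
            (indepFun_iff_map_prod_eq_prod_map_map hdatε.aemeasurable
              (hε.measurable t).aemeasurable).1 hind, lintegral_prod _ hF.aemeasurable, hε.law,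
            lintegral_map hF.lintegral_prod_right' hdatε]
      _ = ∫⁻ D, (∫⁻ e, F (D, e) ∂gaussianReal 0 v) * lik σ D g ∂base sel z t :=
          ih hF.lintegral_prod_right'
      _ = ∫⁻ D, ∫⁻ w, ψ (Fin.snoc (α := fun _ => 𝒳 × ℝ) D (sel t D (z t), w)) *
            lik σ (Fin.snoc (α := fun _ => 𝒳 × ℝ) D (sel t D (z t), w) :
              Fin (t + 1) → 𝒳 × ℝ) g ∂volume ∂base sel z t := by
          refine lintegral_congr fun D => ?_
          rw [h1, ← lintegral_mul_const'' _ (Measurable.aemeasurable ?_)]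
          · refine lintegral_congr fun w => ?_
            rw [lik_snoc]
            ring
          · exact (hψ.comp (hsn.comp measurable_prodMk_left)).mul (measurable_gaussianPDF _ _)
      _ = _ := by
          have hl : Measurable fun D : Fin (t + 1) → 𝒳 × ℝ => lik σ D g :=
            (measurable_lik_uncurry (S := Unit) (f := fun x _ => g x)
              (hg.comp measurable_fst) (t + 1)).comp
              (f := fun D : Fin (t + 1) → 𝒳 × ℝ => (D, ())) (by fun_prop)
          rw [base, lintegral_map (f := fun D => ψ D * lik σ D g) (hψ.mul hl) hsn]
          exact (lintegral_prod _ ((hψ.mul hl).comp hsn).aemeasurable).symm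

variable {S : Type*} [MeasurableSpace S] {μ : Measure S} [IsProbabilityMeasure μ]
  {f : 𝒳 → S → ℝ}

/-- The unnormalized posterior distribution given the data set `D`. -/
def post (μ : Measure S) (f : 𝒳 → S → ℝ) (σ : ℝ) {t : ℕ} (D : Fin t → 𝒳 × ℝ) : Measure S :=
  μ.withDensity fun s => lik σ D (f · s)

instance post_finite {t : ℕ} (D : Fin t → 𝒳 × ℝ) : IsFiniteMeasure (post μ f σ D) := by
  refine isFiniteMeasure_withDensity (ne_top_of_le_ne_top (likBound_ne_top σ t) ?_)
  calc _ ≤ ∫⁻ _, likBound σ t ∂μ := lintegral_mono fun ω => lik_le _ _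
    _ = _ := by simp

/-- The data set collected in the first `t` rounds, as a random variable. -/
def dat (sel : ∀ t : ℕ, (Fin t → 𝒳 × ℝ) → ℝ → 𝒳) (f : 𝒳 → S → ℝ) (ε : ℕ → Ω → ℝ) (z : ℕ → ℝ)
    (t : ℕ) (p : S × Ω) : Fin t → 𝒳 × ℝ :=
  dataset sel (f · p.1) (fun i => ε i p.2) z t

theorem measurable_dat (hε : IsGaussianNoise ν σ ε)
    (hsel : ∀ t, Measurable (Function.uncurry (sel t))) (hf : Measurable (Function.uncurry f))
    (z : ℕ → ℝ) (t : ℕ) : Measurable (dat sel f ε z t) := by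
  have hεm := hε.measurable
  exact (measurable_dataset hf hsel t).comp
    (f := fun p : S × Ω => (p.1, fun i => ε i p.2, z)) (by fun_prop)

/-- As `base` does not depend on the path, Tonelli exchanges data and path. Statements about fixed
data sets under `post` thereby apply to adaptive data. -/
theorem lintegral_dat (hσ : 0 < σ) (hε : IsGaussianNoise ν σ ε)
    (hsel : ∀ t, Measurable (Function.uncurry (sel t))) (hf : Measurable (Function.uncurry f))
    (z : ℕ → ℝ) (t : ℕ) {Ψ : (Fin t → 𝒳 × ℝ) × S → ℝ≥0∞} (hΨ : Measurable Ψ) :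
    ∫⁻ p, Ψ (dat sel f ε z t p, p.1) ∂(μ.prod ν) =
      ∫⁻ D, ∫⁻ s, Ψ (D, s) ∂post μ f σ D ∂base sel z t := by
  have hl := measurable_lik_uncurry (σ := σ) hf t
  rw [lintegral_prod (fun p : S × Ω => Ψ (dat sel f ε z t p, p.1)) (hΨ.comp
    ((measurable_dat hε hsel hf z t).prodMk measurable_fst)).aemeasurable]
  simp only [dat]
  have h1 : ∀ s, ∫⁻ ω, Ψ (dataset sel (f · s) (fun i => ε i ω) z t, s) ∂ν =
      ∫⁻ D, Ψ (D, s) * lik σ D (f · s) ∂base sel z t := fun s =>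
    lintegral_dataset hσ hε hsel (hf.comp measurable_prodMk_right) z t
      (hΨ.comp measurable_prodMk_right)
  simp_rw [h1]
  rw [lintegral_lintegral_swap]
  · refine lintegral_congr fun D => ?_
    rw [post, lintegral_withDensity_eq_lintegral_mul _ (f := fun s => lik σ D (f · s))
      (hl.comp measurable_prodMk_left) (g := fun s => Ψ (D, s)) (hΨ.comp measurable_prodMk_left)]
    simp only [Pi.mul_apply, mul_comm]
  · exact ((hΨ.mul hl).comp measurable_swap).aemeasurable

theorem lintegral_dat_mono (hσ : 0 < σ) (hε : IsGaussianNoise ν σ ε)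
    (hsel : ∀ t, Measurable (Function.uncurry (sel t))) (hf : Measurable (Function.uncurry f))
    (z : ℕ → ℝ) (t : ℕ) {Ψ Ψ' : (Fin t → 𝒳 × ℝ) × S → ℝ≥0∞} (hΨ : Measurable Ψ)
    (hΨ' : Measurable Ψ')
    (h : ∀ D, ∫⁻ s, Ψ (D, s) ∂post μ f σ D ≤ ∫⁻ s, Ψ' (D, s) ∂post μ f σ D) :
    ∫⁻ p, Ψ (dat sel f ε z t p, p.1) ∂(μ.prod ν) ≤
      ∫⁻ p, Ψ' (dat sel f ε z t p, p.1) ∂(μ.prod ν) := by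
  rw [lintegral_dat hσ hε hsel hf z t hΨ, lintegral_dat hσ hε hsel hf z t hΨ']
  exact lintegral_mono h

end Adaptive

-- Gaussian tails.

section GaussianTail

theorem gaussianReal_Ioi_zero_le : gaussianReal 0 1 (Ioi 0) ≤ 2⁻¹ := by
  have h1 : gaussianReal 0 1 (Iio 0) = gaussianReal 0 1 (Ioi 0) := by
    have h := gaussianReal_map_neg (μ := 0) (v := 1)
    rw [neg_zero] at h
    conv_lhs => rw [← h]
    rw [Measure.map_apply measurable_neg measurableSet_Iio]
    congr 1
    ext x
    simp
  have h2 : gaussianReal 0 1 (Iio 0) + gaussianReal 0 1 (Ioi 0) ≤ 1 := by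
    rw [← measure_union (by
      rw [Set.disjoint_left]; intro x hx hx'; exact absurd (mem_Iio.1 hx) (mem_Ioi.1 hx').not_gt)
      measurableSet_Ioi]
    exact prob_le_one
  rw [h1, ← two_mul] at h2
  rwa [← one_div, ENNReal.le_div_iff_mul_le (by simp) (by simp), mul_comm]

/-- Shift the integral by x and use (u + x)² ≥ u² + x² for u, x ≥ 0. -/
theorem gaussianReal_Ioi_le {x : ℝ} (hx : 0 ≤ x) :
    gaussianReal 0 1 (Ioi x) ≤ ENNReal.ofReal (Real.exp (-x ^ 2 / 2)) * 2⁻¹ := by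
  have hpdf : ∀ u, 0 < u → gaussianPDF 0 1 (u + x) ≤
      ENNReal.ofReal (Real.exp (-x ^ 2 / 2)) * gaussianPDF 0 1 u := by
    intro u hu
    rw [gaussianPDF, gaussianPDF, ← ENNReal.ofReal_mul (Real.exp_nonneg _)]
    refine ENNReal.ofReal_le_ofReal ?_
    rw [gaussianPDFReal, gaussianPDFReal, mul_left_comm, ← Real.exp_add]
    refine mul_le_mul_of_nonneg_left (Real.exp_le_exp.2 ?_) (by positivity)
    simp only [NNReal.coe_one, sub_zero, mul_one]
    nlinarith [mul_nonneg hu.le hx]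
  rw [gaussianReal_apply _ one_ne_zero, ← lintegral_indicator measurableSet_Ioi,
    ← lintegral_add_right_eq_self _ x]
  calc ∫⁻ u, (Ioi x).indicator (fun y => gaussianPDF 0 1 y) (u + x)
      ≤ ∫⁻ u, (Ioi 0).indicator
          (fun u => ENNReal.ofReal (Real.exp (-x ^ 2 / 2)) * gaussianPDF 0 1 u) u := by
        refine lintegral_mono fun u => ?_
        by_cases hu : 0 < u
        · rw [indicator_of_mem (by simpa using hu), indicator_of_mem (by simpa using hu)]
          exact hpdf u hu
        · rw [indicator_of_notMem (by simpa using hu)]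
          exact zero_le
    _ = ENNReal.ofReal (Real.exp (-x ^ 2 / 2)) * gaussianReal 0 1 (Ioi 0) := by
        rw [lintegral_indicator measurableSet_Ioi, lintegral_const_mul _
          (measurable_gaussianPDF _ _), gaussianReal_apply _ one_ne_zero]
    _ ≤ _ := by gcongr; exact gaussianReal_Ioi_zero_le

theorem gaussianReal_eq_map_std (m v : ℝ) (hv : 0 ≤ v) :
    gaussianReal m v.toNNReal = (gaussianReal 0 1).map fun u => m + √v * u := by
  have h1 := gaussianReal_map_const_mul (μ := 0) (v := 1) √v
  have h2 := gaussianReal_map_const_add (μ := √v * 0)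
    (v := NNReal.mk (√v ^ 2) (sq_nonneg _) * 1) m
  rw [← h1, Measure.map_map (by fun_prop) (by fun_prop)] at h2
  change Measure.map (fun u => m + √v * u) (gaussianReal 0 1) = _ at h2
  rw [h2, mul_zero, zero_add, mul_one]
  congr 1
  exact NNReal.eq (by simp [Real.sq_sqrt hv, hv])

/-- The factor 1/2 is what later allows a union bound over 2 exp(s/2) points, and so accounts for −2
log 2 in `shift`. -/
theorem gaussianReal_Ioi_ucb_le {m v a c : ℝ} (hv : 0 ≤ v) (ha : 0 ≤ a) (hc : m + √a * √v ≤ c) :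
    gaussianReal m v.toNNReal (Ioi c) ≤ ENNReal.ofReal (Real.exp (-a / 2)) * 2⁻¹ := by
  rw [gaussianReal_eq_map_std m v hv, Measure.map_apply (by fun_prop) measurableSet_Ioi]
  refine (measure_mono fun u hu => ?_).trans
    ((gaussianReal_Ioi_le (Real.sqrt_nonneg a)).trans_eq (by rw [Real.sq_sqrt ha]))
  have hu' : c < m + √v * u := hu
  by_contra h
  have : √v * u ≤ √v * √a := mul_le_mul_of_nonneg_left (not_lt.1 h) (Real.sqrt_nonneg v)
  nlinarith

end GaussianTail

-- The shifted exponential law and domination of expectations.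

section ShiftedExp

instance expMeasure_half : IsProbabilityMeasure (expMeasure (1 / 2)) :=
  isProbabilityMeasure_expMeasure (by norm_num)

instance shiftedExp_prob (s : ℝ) : IsProbabilityMeasure (shiftedExp s (1 / 2)) :=
  Measure.isProbabilityMeasure_map (by fun_prop)

theorem lintegral_shiftedExp (s : ℝ) {F : ℝ → ℝ≥0∞} (hF : Measurable F) :
    ∫⁻ β, F β ∂shiftedExp s (1 / 2) = ∫⁻ z, F (s + z) ∂expMeasure (1 / 2) :=
  lintegral_map hF (by fun_prop)

theorem lintegral_expMeasure {F : ℝ → ℝ≥0∞} (hF : Measurable F) :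
    ∫⁻ z, F z ∂expMeasure (1 / 2) = ∫⁻ z, exponentialPDF (1 / 2) z * F z := by
  change ∫⁻ z, F z ∂(volume.withDensity (exponentialPDF (1 / 2))) = _
  rw [lintegral_withDensity_eq_lintegral_mul _ (f := exponentialPDF (1 / 2))
    (measurable_exponentialPDFReal _).ennreal_ofReal hF]
  rfl

/-- Tilting the density of rate 1/2 gives a multiple of the density of rate (1 − θ)/2. -/
theorem lintegral_exp_expMeasure {θ : ℝ} (hθ : θ < 1) :
    ∫⁻ z, ENNReal.ofReal (Real.exp (θ * z / 2)) ∂expMeasure (1 / 2) =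
      ENNReal.ofReal (1 / (1 - θ)) := by
  have h0 : 0 < 1 - θ := by linarith
  rw [lintegral_expMeasure (by fun_prop)]
  have h1 : ∀ z, exponentialPDF (1 / 2) z * ENNReal.ofReal (Real.exp (θ * z / 2)) =
      ENNReal.ofReal (1 / (1 - θ)) * exponentialPDF ((1 - θ) / 2) z := by
    intro z
    rcases lt_or_ge z 0 with hz | hz
    · simp [exponentialPDF_of_neg hz]
    · rw [exponentialPDF_of_nonneg hz, exponentialPDF_of_nonneg hz,
        ← ENNReal.ofReal_mul (by positivity), ← ENNReal.ofReal_mul (by positivity)]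
      congr 1
      rw [mul_assoc, ← Real.exp_add]
      field_simp
      ring_nf
  simp_rw [h1]
  rw [lintegral_const_mul _ (f := exponentialPDF ((1 - θ) / 2))
      (measurable_exponentialPDFReal _).ennreal_ofReal,
    lintegral_exponentialPDF_eq_one (by linarith), mul_one]

theorem expMeasure_nonneg : ∀ᵐ z ∂expMeasure (1 / 2), 0 ≤ z := by
  have h : expMeasure (1 / 2) (Iio 0) = 0 := by
    have := lintegral_expMeasure (F := (Iio 0).indicator 1) (measurable_one.indicator
      measurableSet_Iio)
    rw [lintegral_indicator_one measurableSet_Iio] at this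
    rw [this, lintegral_eq_zero_iff' ?_]
    · refine .of_forall fun z => ?_
      by_cases hz : z < 0
      · simp [exponentialPDF_of_neg hz]
      · simp [hz]
    · exact ((measurable_exponentialPDFReal _).ennreal_ofReal.mul (measurable_one.indicator
        measurableSet_Iio)).aemeasurable
  rw [ae_iff]
  convert h using 2
  ext z
  simp

theorem expMeasure_Ioi (a : ℝ) :
    expMeasure (1 / 2) (Ioi a) = ENNReal.ofReal (min 1 (Real.exp (-a / 2))) := by
  have h1 := cdf_expMeasure_eq (r := 1 / 2) (by norm_num) a
  rw [cdf_eq_real] at h1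
  have h2 : (expMeasure (1 / 2)).real (Ioi a) = 1 - (expMeasure (1 / 2)).real (Iic a) := by
    rw [← compl_Iic, probReal_compl_eq_one_sub measurableSet_Iic]
  rw [← ENNReal.ofReal_toReal (measure_ne_top (expMeasure (1 / 2)) (Ioi a))]
  congr 1
  change (expMeasure (1 / 2)).real (Ioi a) = _
  rw [h2, h1]
  split_ifs with ha
  · rw [min_eq_right (Real.exp_le_one_iff.2 (by linarith))]
    ring_nf
  · rw [min_eq_left (Real.one_le_exp (by linarith))]
    simp

theorem shiftedExp_Ioi (s a : ℝ) :
    shiftedExp s (1 / 2) (Ioi a) = ENNReal.ofReal (min 1 (Real.exp (-(a - s) / 2))) := by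
  rw [shiftedExp, Measure.map_apply (by fun_prop) measurableSet_Ioi, ← expMeasure_Ioi]
  congr 1
  ext z
  simp [sub_lt_iff_lt_add']

theorem shiftedExp_ge (s : ℝ) : ∀ᵐ β ∂shiftedExp s (1 / 2), s ≤ β := by
  rw [shiftedExp, ae_map_iff (by fun_prop) measurableSet_Ici]
  filter_upwards [expMeasure_nonneg] with z hz
  simpa using hz

/-- If the upper tail of `W` is controlled along a monotone function `V` by the tail of a shifted
exponential variable, then the expectation of `W` is dominated. -/
theorem lintegral_le_of_tail {S : Type*} [MeasurableSpace S] {Q : Measure S} [IsFiniteMeasure Q]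
    {W : S → ℝ} (hW : Measurable W) {V : ℝ → ℝ} (hV : Monotone V) {s : ℝ}
    (htail : ∀ a c : ℝ, 0 ≤ a → V 0 ≤ c → (∀ β, 0 ≤ β → β < a → V β ≤ c) →
      Q {x | c < W x} ≤ Q univ * ENNReal.ofReal (Real.exp (-(a - s) / 2))) :
    ∫⁻ x, ENNReal.ofReal (W x - V 0) ∂Q ≤
      Q univ * ∫⁻ β, ENNReal.ofReal (V β - V 0) ∂shiftedExp s (1 / 2) := by
  have e1 : ∫⁻ x, ENNReal.ofReal (W x - V 0) ∂Q =
      ∫⁻ c in Ioi 0, Q {x | c < max (W x - V 0) 0} := by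
    rw [← lintegral_eq_lintegral_meas_lt Q (f := fun x => max (W x - V 0) 0)
      (.of_forall fun x => le_max_right _ _) (by fun_prop)]
    simp
  have e2 : ∫⁻ β, ENNReal.ofReal (V β - V 0) ∂shiftedExp s (1 / 2) =
      ∫⁻ c in Ioi 0, shiftedExp s (1 / 2) {β | c < max (V β - V 0) 0} := by
    rw [← lintegral_eq_lintegral_meas_lt _ (f := fun β => max (V β - V 0) 0)
      (.of_forall fun x => le_max_right _ _) (by have := hV.measurable; fun_prop)]
    simp
  rw [e1, e2, ← lintegral_const_mul' _ _ (measure_ne_top _ _)]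
  refine setLIntegral_mono' measurableSet_Ioi fun c hc => ?_
  have hc : 0 < c := hc
  have s1 : {x | c < max (W x - V 0) 0} = {x | V 0 + c < W x} := by
    ext x
    simp only [mem_ofPred_eq, lt_max_iff, hc.not_gt, or_false]
    constructor <;> intro h <;> linarith
  have s2 : {β | c < max (V β - V 0) 0} = {β | V 0 + c < V β} := by
    ext x
    simp only [mem_ofPred_eq, lt_max_iff, hc.not_gt, or_false]
    constructor <;> intro h <;> linarith
  rw [s1, s2]
  -- By the layer-cake formula it suffices to compare tails at each level. The infimum of `A` is the
  -- parameter at which V crosses the level; if V never does, the hypothesis holds for all a ≥ 0 and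
  -- a → ∞ shows that W does not exceed it either, up to a null set.
  set A : Set ℝ := {β | 0 ≤ β ∧ V 0 + c < V β} with hA
  rcases A.eq_empty_or_nonempty with hAe | hAne
  · have hle : ∀ a : ℝ, 0 ≤ a → Q {x | V 0 + c < W x} ≤
        Q univ * ENNReal.ofReal (Real.exp (-(a - s) / 2)) := fun a ha =>
      htail a _ ha (by linarith) fun β hβ _ => by
        by_contra h
        exact (hAe ▸ (show β ∈ A from ⟨hβ, not_le.1 h⟩) : β ∈ (∅ : Set ℝ))
    have hlim : Tendsto (fun a : ℝ => Q univ * ENNReal.ofReal (Real.exp (-(a - s) / 2))) atTop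
        (𝓝 (Q univ * ENNReal.ofReal 0)) := by
      refine ENNReal.Tendsto.const_mul (ENNReal.tendsto_ofReal ?_) (.inr (measure_ne_top _ _))
      refine Real.tendsto_exp_atBot.comp ?_
      refine Tendsto.atBot_div_const (by norm_num) ?_
      exact tendsto_neg_atTop_atBot.comp (tendsto_atTop_add_const_right _ _ tendsto_id)
    rw [ENNReal.ofReal_zero, mul_zero] at hlim
    exact (ge_of_tendsto hlim ((eventually_ge_atTop 0).mono hle)).trans zero_le
  · have hbdd : BddBelow A := ⟨0, fun β hβ => hβ.1⟩
    have ha0 : 0 ≤ sInf A := Real.sInf_nonneg fun β hβ => hβ.1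
    have hQ := htail (sInf A) (V 0 + c) ha0 (by linarith) fun β hβ hlt => by
      by_contra h
      exact absurd (csInf_le hbdd (show β ∈ A from ⟨hβ, not_le.1 h⟩)) (not_le.2 hlt)
    have hsub : Ioi (sInf A) ⊆ {β | V 0 + c < V β} := fun β hβ => by
      obtain ⟨β', hβ', hlt⟩ := exists_lt_of_csInf_lt hAne (mem_Ioi.1 hβ)
      exact hβ'.2.trans_le (hV hlt.le)
    refine le_trans ?_ (mul_le_mul' le_rfl (measure_mono hsub))
    rw [shiftedExp_Ioi]
    rcases min_choice 1 (Real.exp (-(sInf A - s) / 2)) with h | h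
    · rw [h, ENNReal.ofReal_one, mul_one]
      exact measure_mono (subset_univ _)
    · rw [h]
      exact hQ

end ShiftedExp

-- Integrals against the unnormalized posterior.

section Posterior

variable {𝒳 : Type*} {Ω S : Type*} [MeasurableSpace Ω] [MeasurableSpace S]
  {μ : Measure S} [IsProbabilityMeasure μ] {k : 𝒳 → 𝒳 → ℝ} {f : 𝒳 → S → ℝ} {σ : ℝ} {t : ℕ}

theorem CenteredGP.postVar_nonneg (h : CenteredGP μ k f) (hσ : 0 < σ) (D : Fin t → 𝒳 × ℝ)
    (x : 𝒳) : 0 ≤ postVar k σ D x := by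
  let G : Measure (Fin t → ℝ) := Measure.pi fun _ => gaussianReal 0 (σ ^ 2).toNNReal
  have hm := h.measurable
  have hlaw : ∀ i : Fin t, (μ.prod G).map (fun p : S × (Fin t → ℝ) => p.2 i) =
      gaussianReal 0 (σ ^ 2).toNNReal := fun i => by
    have h1 : (μ.prod G).map Prod.snd = G := by simp
    have h2 : G.map (fun e => e i) = gaussianReal 0 (σ ^ 2).toNNReal :=
      (measurePreserving_eval (fun _ : Fin t => gaussianReal 0 (σ ^ 2).toNNReal) i).map_eq
    rw [← h2, ← h1, Measure.map_map (by fun_prop) measurable_snd, h1]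
    rfl
  refine ((h.comp_fst G).residual_law hσ D x (N := fun i p => p.2 i) (fun i => by fun_prop) hlaw
    ?_ ?_).1
  · refine (iIndepFun_iff_map_fun_eq_pi_map (fun i => by fun_prop)).2 ?_
    simp_rw [hlaw]
    change (μ.prod G).map Prod.snd = _
    simp [G]
  · exact indepFun_prod (μ := μ) (ν := G) (X := fun s x => f x s) (Y := fun e i => e i)
      (by fun_prop) (by fun_prop)

theorem CenteredGP.lintegral_post (h : CenteredGP μ k f) (hσ : 0 < σ) (D : Fin t → 𝒳 × ℝ)
    (x : 𝒳) {F : ℝ → ℝ≥0∞} (hF : Measurable F) :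
    ∫⁻ s, F (f x s) ∂post μ f σ D = post μ f σ D univ *
      ∫⁻ v, F v ∂gaussianReal (postMean k σ D x) (postVar k σ D x).toNNReal := by
  have h1 := h.posterior hσ D x
  rw [← lintegral_map hF (h.measurable x)]
  change ∫⁻ v, F v ∂Measure.map (f x) (μ.withDensity fun ω => lik σ D (f · ω)) = _
  rw [h1, lintegral_smul_measure, post, withDensity_apply _ MeasurableSet.univ,
    Measure.restrict_univ, smul_eq_mul]

/-- The reflection u ↦ 2m − u preserves a Gaussian law with mean m. In this form, centering can be
integrated over the data by Tonelli. -/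
theorem CenteredGP.lintegral_post_symm (h : CenteredGP μ k f) (hσ : 0 < σ)
    (D : Fin t → 𝒳 × ℝ) (x : 𝒳) :
    ∫⁻ s, ENNReal.ofReal (f x s - postMean k σ D x) ∂post μ f σ D =
      ∫⁻ s, ENNReal.ofReal (-(f x s - postMean k σ D x)) ∂post μ f σ D := by
  set m := postMean k σ D x with hm
  rw [h.lintegral_post hσ D x (F := fun v => ENNReal.ofReal (v - m)) (by fun_prop),
    h.lintegral_post hσ D x (F := fun v => ENNReal.ofReal (-(v - m))) (by fun_prop), ← hm]
  congr 1
  set v := (postVar k σ D x).toNNReal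
  have h1 : (gaussianReal m v).map (fun u => 2 * m - u) = gaussianReal m v := by
    have := gaussianReal_map_const_sub (μ := m) (v := v) (2 * m)
    rw [this]
    congr 1
    ring
  conv_lhs => rw [← h1]
  rw [lintegral_map (by fun_prop) (by fun_prop)]
  refine lintegral_congr fun u => ?_
  congr 1
  ring

/-- Jensen's inequality; it transfers integrability from f to the posterior mean. -/
theorem CenteredGP.lintegral_abs_postMean_le (h : CenteredGP μ k f) (hσ : 0 < σ)
    (D : Fin t → 𝒳 × ℝ) (x : 𝒳) :
    ∫⁻ _, ‖postMean k σ D x‖ₑ ∂post μ f σ D ≤ ∫⁻ s, ‖f x s‖ₑ ∂post μ f σ D := by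
  rw [h.lintegral_post hσ D x (F := fun v => ‖v‖ₑ) (by fun_prop), lintegral_const, mul_comm]
  gcongr
  have := enorm_integral_le_lintegral_enorm (μ := gaussianReal (postMean k σ D x)
    (postVar k σ D x).toNNReal) (fun v : ℝ => v)
  rwa [integral_id_gaussianReal] at this

end Posterior

-- Mean upper confidence bounds and the maximum of the objective.

section Model

variable {𝒳 Ω S : Type*} [MeasurableSpace 𝒳] [MeasurableSpace Ω] [MeasurableSpace S]

/-- A Gaussian process bandit problem on the whole space `𝒳` with jointly measurable, integrably
bounded objective `f`, Gaussian noise `ε` on a second probability space, and a selection rule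
maximizing the upper confidence bound. -/
structure IsBandit (μ : Measure S) (ν : Measure Ω) (k : 𝒳 → 𝒳 → ℝ) (σ : ℝ) (f : 𝒳 → S → ℝ)
    (ε : ℕ → Ω → ℝ) (sel : ∀ t : ℕ, (Fin t → 𝒳 × ℝ) → ℝ → 𝒳) (Φ : S → ℝ) : Prop where
  sigma_pos : 0 < σ
  gp : CenteredGP μ k f
  measurable_f : Measurable (Function.uncurry f)
  noise : IsGaussianNoise ν σ ε
  measurable_sel : ∀ t, Measurable (Function.uncurry (sel t))
  le_sel : ∀ (t : ℕ) (D : Fin t → 𝒳 × ℝ) (z : ℝ) (x : 𝒳),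
    ucb k σ D z x ≤ ucb k σ D z (sel t D z)
  kernel_le : ∀ x, k x x ≤ 1
  integrable_bound : Integrable Φ μ
  abs_le_bound : ∀ x s, |f x s| ≤ Φ s

/-- The maximal upper confidence bound. -/
def ucbMax (k : 𝒳 → 𝒳 → ℝ) (σ : ℝ) (sel : ∀ t : ℕ, (Fin t → 𝒳 × ℝ) → ℝ → 𝒳) (t : ℕ)
    (D : Fin t → 𝒳 × ℝ) (β : ℝ) : ℝ :=
  ucb k σ D β (sel t D β)

variable {μ : Measure S} [IsProbabilityMeasure μ] {ν : Measure Ω} [IsProbabilityMeasure ν]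
  {k : 𝒳 → 𝒳 → ℝ} {σ : ℝ} {f : 𝒳 → S → ℝ} {ε : ℕ → Ω → ℝ}
  {sel : ∀ t : ℕ, (Fin t → 𝒳 × ℝ) → ℝ → 𝒳} {Φ : S → ℝ} {t : ℕ}

namespace IsBandit

variable (h : IsBandit μ ν k σ f ε sel Φ)
include h

/-- Measurability of the kernel is not assumed but inherited from f through k(x, y) = E f(x) f(y).
-/
theorem measurable_kernel : Measurable (Function.uncurry k) := by
  have h1 : Function.uncurry k = fun q : 𝒳 × 𝒳 => ∫ s, f q.1 s * f q.2 s ∂μ := by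
    ext ⟨x, y⟩
    simp only [Function.uncurry]
    rw [← h.gp.cov_eq, covariance_eq_sub (h.gp.memLp x) (h.gp.memLp y), h.gp.mean_zero]
    simp
  rw [h1]
  have hm : Measurable fun q : (𝒳 × 𝒳) × S => f q.1.1 q.2 * f q.1.2 q.2 :=
    (h.measurable_f.comp (f := fun q : (𝒳 × 𝒳) × S => (q.1.1, q.2)) (by fun_prop)).mul
      (h.measurable_f.comp (f := fun q : (𝒳 × 𝒳) × S => (q.1.2, q.2)) (by fun_prop))
  exact (StronglyMeasurable.integral_prod_right hm.stronglyMeasurable).measurable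

theorem sqrt_postVar_le_one (D : Fin t → 𝒳 × ℝ) (x : 𝒳) : √(postVar k σ D x) ≤ 1 :=
  Real.sqrt_le_one.2 ((h.gp.postVar_le h.sigma_pos D x).trans (h.kernel_le x))

theorem ucb_le_ucbMax (D : Fin t → 𝒳 × ℝ) (β : ℝ) (x : 𝒳) :
    ucb k σ D β x ≤ ucbMax k σ sel t D β := h.le_sel t D β x

/-- The maximizer for β competes at β', and posterior deviations are at most 1. The one-sided form
yields both monotonicity in β and the Lipschitz bound in √β. -/
theorem ucbMax_sub_le (D : Fin t → 𝒳 × ℝ) (β β' : ℝ) :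
    ucbMax k σ sel t D β - ucbMax k σ sel t D β' ≤ max (√β - √β') 0 := by
  have h1 := h.ucb_le_ucbMax D β' (sel t D β)
  have h2 := h.sqrt_postVar_le_one D (sel t D β)
  have h3 := Real.sqrt_nonneg (postVar k σ D (sel t D β))
  rw [ucb] at h1
  have h4 : ucbMax k σ sel t D β = postMean k σ D (sel t D β) +
      √β * √(postVar k σ D (sel t D β)) := rfl
  have h5 : (√β - √β') * √(postVar k σ D (sel t D β)) ≤ max (√β - √β') 0 := by
    rcases le_total (√β - √β') 0 with hle | hle
    · exact (mul_nonpos_of_nonpos_of_nonneg hle h3).trans (le_max_right _ _)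
    · exact (mul_le_of_le_one_right hle h2).trans (le_max_left _ _)
  linarith

theorem ucbMax_zero_le (D : Fin t → 𝒳 × ℝ) (β : ℝ) :
    ucbMax k σ sel t D 0 ≤ ucbMax k σ sel t D β := by
  have := h.ucbMax_sub_le D 0 β
  rw [Real.sqrt_zero, zero_sub, max_eq_right (neg_nonpos.2 (Real.sqrt_nonneg β))] at this
  linarith

theorem ucbMax_mono (D : Fin t → 𝒳 × ℝ) : Monotone (ucbMax k σ sel t D) := fun β β' hβ => by
  have := h.ucbMax_sub_le D β β'
  rw [max_eq_right (sub_nonpos.2 (Real.sqrt_le_sqrt hβ))] at this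
  linarith

theorem abs_ucbMax_sub_le (D : Fin t → 𝒳 × ℝ) (β β' : ℝ) :
    |ucbMax k σ sel t D β - ucbMax k σ sel t D β'| ≤ |√β - √β'| := by
  have h1 := h.ucbMax_sub_le D β β'
  have h2 := h.ucbMax_sub_le D β' β
  refine abs_le.2 ⟨?_, h1.trans (max_le (le_abs_self _) (abs_nonneg _))⟩
  have : max (√β' - √β) 0 ≤ |√β - √β'| :=
    max_le (by rw [abs_sub_comm]; exact le_abs_self _) (abs_nonneg _)
  linarith

theorem measurable_ucbMax : Measurable fun q : (Fin t → 𝒳 × ℝ) × ℝ =>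
    ucbMax k σ sel t q.1 q.2 := by
  have hx : Measurable fun q : (Fin t → 𝒳 × ℝ) × ℝ => (q.1, sel t q.1 q.2) :=
    measurable_fst.prodMk (h.measurable_sel t)
  simp only [ucbMax, ucb]
  refine ((measurable_postMean h.measurable_kernel σ).comp hx).add
    (Measurable.mul (by fun_prop) ?_)
  exact Real.continuous_sqrt.measurable.comp
    ((measurable_postVar h.measurable_kernel σ).comp hx)

theorem measurable_dat (z : ℕ → ℝ) : Measurable (dat sel f ε z t) :=
  GPBandit.measurable_dat h.noise h.measurable_sel h.measurable_f z t

theorem integrable_bound_fst : Integrable (fun p : S × Ω => Φ p.1) (μ.prod ν) :=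
  h.integrable_bound.comp_fst ν

variable {ξ : (Fin t → 𝒳 × ℝ) → 𝒳}

theorem integrable_eval (hξ : Measurable ξ) (z : ℕ → ℝ) :
    Integrable (fun p => f (ξ (dat sel f ε z t p)) p.1) (μ.prod ν) := by
  refine h.integrable_bound_fst.mono' ?_ (.of_forall fun p => h.abs_le_bound _ _)
  exact (h.measurable_f.comp (f := fun p : S × Ω => (ξ (dat sel f ε z t p), p.1))
    ((hξ.comp (h.measurable_dat z)).prodMk measurable_fst)).aestronglyMeasurable

theorem integrable_postMean (hξ : Measurable ξ) (z : ℕ → ℝ) :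
    Integrable (fun p => postMean k σ (dat sel f ε z t p) (ξ (dat sel f ε z t p)))
      (μ.prod ν) := by
  have hm : Measurable fun D : Fin t → 𝒳 × ℝ => postMean k σ D (ξ D) :=
    (measurable_postMean h.measurable_kernel σ).comp (measurable_id.prodMk hξ)
  refine ⟨(hm.comp (h.measurable_dat z)).aestronglyMeasurable, ?_⟩
  have hm' : Measurable fun q : (Fin t → 𝒳 × ℝ) × S => f (ξ q.1) q.2 :=
    h.measurable_f.comp ((hξ.comp measurable_fst).prodMk measurable_snd)
  refine lt_of_le_of_lt (lintegral_dat_mono h.sigma_pos h.noise h.measurable_sel h.measurable_f z t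
    (Ψ := fun q => ‖postMean k σ q.1 (ξ q.1)‖ₑ) (Ψ' := fun q => ‖f (ξ q.1) q.2‖ₑ)
    (hm.comp measurable_fst).enorm hm'.enorm
    fun D => h.gp.lintegral_abs_postMean_le h.sigma_pos D (ξ D)) ?_
  exact (h.integrable_eval hξ z).2

/-- The input is a function of the data, hence fixed under each posterior, where f is symmetric
about the posterior mean. -/
theorem integral_eval (hξ : Measurable ξ) (z : ℕ → ℝ) :
    ∫ p, f (ξ (dat sel f ε z t p)) p.1 ∂(μ.prod ν) =
      ∫ p, postMean k σ (dat sel f ε z t p) (ξ (dat sel f ε z t p)) ∂(μ.prod ν) := by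
  have hm : Measurable fun q : (Fin t → 𝒳 × ℝ) × S =>
      f (ξ q.1) q.2 - postMean k σ q.1 (ξ q.1) :=
    (h.measurable_f.comp ((hξ.comp measurable_fst).prodMk measurable_snd)).sub
      (((measurable_postMean h.measurable_kernel σ).comp
        (measurable_id.prodMk hξ)).comp measurable_fst)
  rw [← sub_eq_zero, ← integral_sub (h.integrable_eval hξ z) (h.integrable_postMean hξ z)]
  refine (integral_eq_lintegral_pos_part_sub_lintegral_neg_part
    ((h.integrable_eval hξ z).sub (h.integrable_postMean hξ z))).trans ?_
  rw [sub_eq_zero]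
  congr 1
  have e1 := lintegral_dat h.sigma_pos h.noise (μ := μ) h.measurable_sel h.measurable_f z t
    (Ψ := fun q => ENNReal.ofReal (f (ξ q.1) q.2 - postMean k σ q.1 (ξ q.1))) hm.ennreal_ofReal
  have e2 := lintegral_dat h.sigma_pos h.noise (μ := μ) h.measurable_sel h.measurable_f z t
    (Ψ := fun q => ENNReal.ofReal (-(f (ξ q.1) q.2 - postMean k σ q.1 (ξ q.1))))
      hm.neg.ennreal_ofReal
  refine e1.trans (Eq.trans ?_ e2.symm)
  exact lintegral_congr fun D => h.gp.lintegral_post_symm h.sigma_pos D (ξ D)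

theorem integrable_ucbMax (z : ℕ → ℝ) (β : ℝ) :
    Integrable (fun p => ucbMax k σ sel t (dat sel f ε z t p) β) (μ.prod ν) := by
  have hξ : Measurable fun D : Fin t → 𝒳 × ℝ => sel t D β :=
    (h.measurable_sel t).comp (measurable_id.prodMk measurable_const)
  refine (h.integrable_postMean hξ z).add (Integrable.const_mul ?_ _)
  refine Integrable.of_bound ?_ 1 (.of_forall fun p => ?_)
  · exact (Real.continuous_sqrt.measurable.comp (((measurable_postVar h.measurable_kernel σ).comp
      (measurable_id.prodMk hξ)).comp (h.measurable_dat z))).aestronglyMeasurable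
  · rw [Real.norm_of_nonneg (Real.sqrt_nonneg _)]
    exact h.sqrt_postVar_le_one _ _

end IsBandit

/-- The expected maximal upper confidence bound in round `t`, as a function of the confidence
parameters of the previous rounds and of the current one. -/
def meanUcb (μ : Measure S) (ν : Measure Ω) (k : 𝒳 → 𝒳 → ℝ) (σ : ℝ) (f : 𝒳 → S → ℝ)
    (ε : ℕ → Ω → ℝ) (sel : ∀ t : ℕ, (Fin t → 𝒳 × ℝ) → ℝ → 𝒳) (t : ℕ) (z : ℕ → ℝ) (β : ℝ) : ℝ :=
  ∫ p, ucbMax k σ sel t (dat sel f ε z t p) β ∂(μ.prod ν)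

theorem meanUcb_congr {z z' : ℕ → ℝ} (hz : ∀ i < t, z i = z' i) (β : ℝ) :
    meanUcb μ ν k σ f ε sel t z β = meanUcb μ ν k σ f ε sel t z' β := by
  simp only [meanUcb, dat, dataset_congr _ (fun _ _ => rfl) hz]

namespace IsBandit

variable (h : IsBandit μ ν k σ f ε sel Φ)
include h

theorem measurable_meanUcb (t : ℕ) :
    Measurable (Function.uncurry (meanUcb μ ν k σ f ε sel t)) := by
  have hεm := h.noise.measurable
  have h1 : Measurable fun q : ((ℕ → ℝ) × ℝ) × (S × Ω) =>
      ucbMax k σ sel t (dat sel f ε q.1.1 t q.2) q.1.2 := by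
    refine h.measurable_ucbMax.comp (Measurable.prodMk ?_ (by fun_prop))
    exact (measurable_dataset h.measurable_f h.measurable_sel t).comp
      (f := fun q : ((ℕ → ℝ) × ℝ) × (S × Ω) => (q.2.1, fun i => ε i q.2.2, q.1.1)) (by fun_prop)
  exact (StronglyMeasurable.integral_prod_right (ν := μ.prod ν) h1.stronglyMeasurable).measurable

theorem meanUcb_mono (z : ℕ → ℝ) : Monotone (meanUcb μ ν k σ f ε sel t z) := fun β β' hβ =>
  integral_mono (h.integrable_ucbMax z β) (h.integrable_ucbMax z β') fun _ => h.ucbMax_mono _ hβ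

theorem abs_meanUcb_sub_le (z : ℕ → ℝ) (β β' : ℝ) :
    |meanUcb μ ν k σ f ε sel t z β - meanUcb μ ν k σ f ε sel t z β'| ≤ |√β - √β'| := by
  rw [meanUcb, meanUcb, ← integral_sub (h.integrable_ucbMax z β) (h.integrable_ucbMax z β')]
  refine (abs_integral_le_integral_abs).trans ?_
  refine (integral_mono_of_nonneg (.of_forall fun _ => abs_nonneg _) (integrable_const _)
    (.of_forall fun p => h.abs_ucbMax_sub_le _ β β')).trans ?_
  simp

/-- At the parameter actually used, the maximal bound is attained at the query, so posterior mean
there = maximal bound − √z_t σ(x_t). -/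
theorem integral_query (z : ℕ → ℝ) :
    ∫ p, f (sel t (dat sel f ε z t p) (z t)) p.1 ∂(μ.prod ν) =
      meanUcb μ ν k σ f ε sel t z (z t) - √(z t) * ∫ p, √(postVar k σ (dat sel f ε z t p)
        (sel t (dat sel f ε z t p) (z t))) ∂(μ.prod ν) := by
  have hξ : Measurable fun D : Fin t → 𝒳 × ℝ => sel t D (z t) :=
    (h.measurable_sel t).comp (measurable_id.prodMk measurable_const)
  rw [h.integral_eval hξ z, meanUcb, ← integral_const_mul, ← integral_sub (h.integrable_ucbMax z _)]
  · exact integral_congr_ae (.of_forall fun p => by simp [ucbMax, ucb])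
  · have := (h.integrable_ucbMax (t := t) z (z t)).sub (h.integrable_postMean hξ z)
    exact this.congr (.of_forall fun p => by simp [ucbMax, ucb])

theorem post_Ioi_le {D : Fin t → 𝒳 × ℝ} {a c : ℝ} (ha : 0 ≤ a)
    (hc0 : ucbMax k σ sel t D 0 ≤ c) (hc : ∀ β, 0 ≤ β → β < a → ucbMax k σ sel t D β ≤ c)
    (x : 𝒳) : post μ f σ D {s | c < f x s} ≤
      post μ f σ D univ * (ENNReal.ofReal (Real.exp (-a / 2)) * 2⁻¹) := by
  have h1 := h.gp.lintegral_post h.sigma_pos D x (F := (Ioi c).indicator 1)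
    (measurable_one.indicator measurableSet_Ioi)
  rw [lintegral_indicator_one measurableSet_Ioi] at h1
  have h2 : ∫⁻ s, (Ioi c).indicator 1 (f x s) ∂post μ f σ D = post μ f σ D {s | c < f x s} := by
    rw [← lintegral_indicator_one (measurableSet_lt measurable_const (h.gp.measurable x))]
    rfl
  rw [← h2, h1]
  gcongr
  refine gaussianReal_Ioi_ucb_le (h.gp.postVar_nonneg h.sigma_pos D x) ha ?_
  rcases ha.eq_or_lt with rfl | ha
  · refine le_trans ?_ hc0
    exact h.ucb_le_ucbMax D 0 x
  -- The level is controlled only for β < a; a left limit carries the bound to β = a.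
  · have hcont : ContinuousWithinAt (fun β => ucb k σ D β x) (Iio a) a := by
      unfold ucb
      fun_prop
    refine le_of_tendsto (x := 𝓝[<] a) hcont ?_
    filter_upwards [Ioo_mem_nhdsLT ha] with β hβ
    exact (h.ucb_le_ucbMax D β x).trans (hc β hβ.1.le hβ.2)

/-- Union bound: |ι| · exp(−a/2)/2 ≤ exp(−(a − s)/2), the form of tail required by
`lintegral_le_of_tail`. -/
theorem lintegral_post_max_le {ι : Type*} [Fintype ι] [Nonempty ι] (G : ι → 𝒳) {s : ℝ}
    (hcard : (Fintype.card ι : ℝ) ≤ 2 * Real.exp (s / 2)) (D : Fin t → 𝒳 × ℝ) :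
    ∫⁻ ω, ENNReal.ofReal ((⨆ i, f (G i) ω) - ucbMax k σ sel t D 0) ∂post μ f σ D ≤
      ∫⁻ _, ∫⁻ β, ENNReal.ofReal (ucbMax k σ sel t D β - ucbMax k σ sel t D 0)
        ∂shiftedExp s (1 / 2) ∂post μ f σ D := by
  rw [lintegral_const, mul_comm]
  refine lintegral_le_of_tail (.iSup fun i => h.gp.measurable _) (h.ucbMax_mono D)
    fun a c ha hc0 hc => ?_
  have hsub : {ω | c < ⨆ i, f (G i) ω} ⊆ ⋃ i, {ω | c < f (G i) ω} := fun ω hω => by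
    obtain ⟨i, hi⟩ := exists_lt_of_lt_ciSup (show c < ⨆ i, f (G i) ω from hω)
    exact mem_iUnion.2 ⟨i, hi⟩
  refine (measure_mono hsub).trans ((measure_iUnion_fintype_le _ _).trans ?_)
  refine (Finset.sum_le_sum fun i _ => h.post_Ioi_le ha hc0 hc (G i)).trans ?_
  rw [Finset.sum_const, Finset.card_univ, nsmul_eq_mul, mul_left_comm]
  gcongr
  rw [← ENNReal.ofReal_natCast, ← ENNReal.ofReal_ofNat 2,
    ← ENNReal.ofReal_inv_of_pos (by norm_num), ← ENNReal.ofReal_mul (by positivity),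
    ← ENNReal.ofReal_mul (by positivity)]
  refine ENNReal.ofReal_le_ofReal ?_
  have h1 : Real.exp (-(a - s) / 2) = Real.exp (s / 2) * Real.exp (-a / 2) := by
    rw [← Real.exp_add]; ring_nf
  rw [h1]
  nlinarith [Real.exp_pos (-a / 2)]

end IsBandit

theorem integrable_sqrt_shiftedExp (s : ℝ) :
    Integrable (fun β => √β) (shiftedExp s (1 / 2)) := by
  have h1 : Integrable (fun z : ℝ => Real.exp (1 / 2 * z / 2)) (expMeasure (1 / 2)) := by
    refine ⟨by fun_prop, ?_⟩
    have := lintegral_exp_expMeasure (θ := 1 / 2) (by norm_num)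
    refine lt_of_eq_of_lt (lintegral_congr fun z => ?_) (this ▸ ENNReal.ofReal_lt_top)
    rw [Real.enorm_eq_ofReal (Real.exp_nonneg _)]
  rw [shiftedExp, integrable_map_measure (by fun_prop) (by fun_prop)]
  refine ((h1.const_mul 4).add (integrable_const |s|)).mono' (by fun_prop) ?_
  filter_upwards [expMeasure_nonneg] with z hz
  simp only [Function.comp_apply]
  rw [Real.norm_of_nonneg (Real.sqrt_nonneg _), Real.sqrt_le_left]
  · have h2 := Real.add_one_le_exp (1 / 2 * z / 2)
    have h3 := le_abs_self s
    have h4 := abs_nonneg s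
    simp only [Pi.add_apply]
    nlinarith [mul_nonneg hz h4]
  · simp only [Pi.add_apply]
    positivity

namespace IsBandit

variable (h : IsBandit μ ν k σ f ε sel Φ)
include h

theorem integrable_meanUcb (z : ℕ → ℝ) (s : ℝ) :
    Integrable (meanUcb μ ν k σ f ε sel t z) (shiftedExp s (1 / 2)) := by
  refine ((integrable_sqrt_shiftedExp s).add
    (integrable_const |meanUcb μ ν k σ f ε sel t z 0|)).mono'
    (h.meanUcb_mono z).measurable.aestronglyMeasurable (.of_forall fun β => ?_)
  have h1 := h.abs_meanUcb_sub_le (t := t) z β 0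
  rw [Real.sqrt_zero, sub_zero, abs_of_nonneg (Real.sqrt_nonneg β)] at h1
  have h2 := abs_sub_abs_le_abs_sub (meanUcb μ ν k σ f ε sel t z β) (meanUcb μ ν k σ f ε sel t z 0)
  rw [Real.norm_eq_abs]
  simp only [Pi.add_apply]
  linarith

theorem integrable_max {ι : Type*} [Fintype ι] [Nonempty ι] (G : ι → 𝒳) :
    Integrable (fun ω => ⨆ i, f (G i) ω) μ := by
  have hWm : Measurable fun ω => ⨆ i, f (G i) ω := .iSup fun i => h.gp.measurable _
  refine h.integrable_bound.mono' hWm.aestronglyMeasurable (.of_forall fun ω => ?_)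
  rw [Real.norm_eq_abs, abs_le]
  obtain ⟨i⟩ := ‹Nonempty ι›
  refine ⟨?_, ciSup_le fun i => (le_abs_self _).trans (h.abs_le_bound _ _)⟩
  exact (neg_le_of_abs_le (h.abs_le_bound (G i) ω)).trans
    (le_ciSup (f := fun i => f (G i) ω) (Finite.bddAbove_range _) i)

/-- The posterior comparison, averaged over the data. Subtracting the maximal bound at β = 0 makes
the right integrand nonnegative by monotonicity, so data and β may be exchanged; on the left only
the positive part is controlled, which is enough. -/
theorem integral_max_le {ι : Type*} [Fintype ι] [Nonempty ι] (G : ι → 𝒳) {s : ℝ}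
    (hcard : (Fintype.card ι : ℝ) ≤ 2 * Real.exp (s / 2)) (z : ℕ → ℝ) :
    ∫ ω, (⨆ i, f (G i) ω) ∂μ ≤ ∫ β, meanUcb μ ν k σ f ε sel t z β ∂shiftedExp s (1 / 2) := by
  set U := meanUcb μ ν k σ f ε sel t z with hU
  have hWm : Measurable fun ω => ⨆ i, f (G i) ω := .iSup fun i => h.gp.measurable _
  have hW : Integrable (fun ω => ⨆ i, f (G i) ω) μ := h.integrable_max G
  have hW' : Integrable (fun p : S × Ω => ⨆ i, f (G i) p.1) (μ.prod ν) := hW.comp_fst ν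
  have hWe : ∫ p : S × Ω, (⨆ i, f (G i) p.1) ∂(μ.prod ν) = ∫ ω, (⨆ i, f (G i) ω) ∂μ := by
    simp [integral_fun_fst (μ := μ) (ν := ν) (fun ω => ⨆ i, f (G i) ω)]
  have hV := h.measurable_ucbMax (t := t)
  have hV0 : Measurable fun D : Fin t → 𝒳 × ℝ => ucbMax k σ sel t D 0 :=
    hV.comp (measurable_id.prodMk measurable_const)
  have hVm : Measurable fun q : (Fin t → 𝒳 × ℝ) × ℝ =>
      ENNReal.ofReal (ucbMax k σ sel t q.1 q.2 - ucbMax k σ sel t q.1 0) :=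
    (hV.sub (hV0.comp measurable_fst)).ennreal_ofReal
  have key := lintegral_dat_mono (μ := μ) h.sigma_pos h.noise h.measurable_sel h.measurable_f z t
    (Ψ := fun q => ENNReal.ofReal ((⨆ i, f (G i) q.2) - ucbMax k σ sel t q.1 0))
    (Ψ' := fun q => ∫⁻ β, ENNReal.ofReal (ucbMax k σ sel t q.1 β - ucbMax k σ sel t q.1 0)
      ∂shiftedExp s (1 / 2))
    ((hWm.comp measurable_snd).sub (hV0.comp measurable_fst)).ennreal_ofReal
    (hVm.lintegral_prod_right'.comp measurable_fst)
    fun D => h.lintegral_post_max_le G hcard D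
  rw [lintegral_lintegral_swap (μ := μ.prod ν) (ν := shiftedExp s (1 / 2))
    (f := fun p β => ENNReal.ofReal (ucbMax k σ sel t (dat sel f ε z t p) β -
      ucbMax k σ sel t (dat sel f ε z t p) 0))
    (hVm.comp (f := fun q : (S × Ω) × ℝ => (dat sel f ε z t q.1, q.2))
      (((h.measurable_dat z).comp measurable_fst).prodMk measurable_snd)).aemeasurable] at key
  have hβ : ∀ᵐ β ∂shiftedExp s (1 / 2), ∫⁻ p, ENNReal.ofReal (ucbMax k σ sel t
      (dat sel f ε z t p) β - ucbMax k σ sel t (dat sel f ε z t p) 0) ∂(μ.prod ν) =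
      ENNReal.ofReal (U β - U 0) := by
    refine .of_forall fun β => ?_
    refine (ofReal_integral_eq_lintegral_ofReal ((h.integrable_ucbMax z β).sub
      (h.integrable_ucbMax z 0)) (.of_forall fun p =>
        sub_nonneg.2 (h.ucbMax_zero_le _ β))).symm.trans ?_
    rw [hU, meanUcb, meanUcb, ← integral_sub (h.integrable_ucbMax z β) (h.integrable_ucbMax z 0)]
    rfl
  have hU0 : ∀ β, U 0 ≤ U β := fun β =>
    integral_mono (h.integrable_ucbMax z 0) (h.integrable_ucbMax z β) fun p =>
      h.ucbMax_zero_le _ β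
  have hUint := h.integrable_meanUcb (t := t) z s
  rw [lintegral_congr_ae hβ, ← ofReal_integral_eq_lintegral_ofReal
    (f := fun β => U β - U 0) (hUint.sub (integrable_const _))
    (.of_forall fun β => sub_nonneg.2 (hU0 β)), integral_sub hUint (integrable_const _)] at key
  have hint := hW'.sub (h.integrable_ucbMax (t := t) z 0)
  have h1 := integral_eq_lintegral_pos_part_sub_lintegral_neg_part hint
  have h2 : (∫⁻ p, ENNReal.ofReal (((fun p : S × Ω => ⨆ i, f (G i) p.1) -
      fun p => ucbMax k σ sel t (dat sel f ε z t p) 0) p) ∂(μ.prod ν)).toReal ≤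
      ∫ β, U β ∂shiftedExp s (1 / 2) - ∫ _, U 0 ∂shiftedExp s (1 / 2) := by
    refine ENNReal.toReal_le_of_le_ofReal ?_ key
    rw [← integral_sub hUint (integrable_const _)]
    exact integral_nonneg fun β => sub_nonneg.2 (hU0 β)
  have h3 := integral_sub hW' (h.integrable_ucbMax (t := t) z 0)
  rw [hWe] at h3
  have h4 : ∫ _, U 0 ∂shiftedExp s (1 / 2) = U 0 := by
    rw [integral_const, probReal_univ, one_smul]
  have h5 : U 0 = ∫ p, ucbMax k σ sel t (dat sel f ε z t p) 0 ∂(μ.prod ν) := rfl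
  have h6 := ENNReal.toReal_nonneg (a := ∫⁻ p, ENNReal.ofReal (-((fun p : S × Ω =>
    ⨆ i, f (G i) p.1) - fun p => ucbMax k σ sel t (dat sel f ε z t p) 0) p) ∂(μ.prod ν))
  simp only [Pi.sub_apply] at h1 h2 h6
  linarith

end IsBandit
end Model

-- Subgaussian bound for Lipschitz functions of √ζ.

section Mgf

theorem integrable_exp_expMeasure {θ : ℝ} (hθ : θ < 1) :
    Integrable (fun z => Real.exp (θ * z / 2)) (expMeasure (1 / 2)) := by
  refine ⟨by fun_prop, ?_⟩
  refine lt_of_eq_of_lt (lintegral_congr fun z => ?_)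
    (lintegral_exp_expMeasure hθ ▸ ENNReal.ofReal_lt_top)
  rw [Real.enorm_eq_ofReal (Real.exp_nonneg _)]

theorem integral_exp_expMeasure {θ : ℝ} (hθ : θ < 1) :
    ∫ z, Real.exp (θ * z / 2) ∂expMeasure (1 / 2) = 1 / (1 - θ) := by
  rw [integral_eq_lintegral_of_nonneg_ae (.of_forall fun z => Real.exp_nonneg _) (by fun_prop),
    lintegral_exp_expMeasure hθ, ENNReal.toReal_ofReal]
  exact one_div_nonneg.2 (by linarith)

theorem mul_sqrt_le (θ : ℝ) {z : ℝ} (hz : 0 ≤ z) : θ * √z ≤ 2 * θ ^ 2 + 1 / 4 * z / 2 := by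
  nlinarith [sq_nonneg (4 * θ - √z), Real.sq_sqrt hz]

theorem integrable_exp_mul_sqrt (θ : ℝ) :
    Integrable (fun z => Real.exp (θ * √z)) (expMeasure (1 / 2)) := by
  refine ((integrable_exp_expMeasure (θ := 1 / 4) (by norm_num)).const_mul
    (Real.exp (2 * θ ^ 2))).mono' (by fun_prop) ?_
  filter_upwards [expMeasure_nonneg] with z hz
  rw [Real.norm_of_nonneg (Real.exp_nonneg _), ← Real.exp_add]
  exact Real.exp_le_exp.2 (mul_sqrt_le θ hz)

theorem integrable_cosh_mul_sqrt (θ : ℝ) :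
    Integrable (fun z => Real.cosh (θ * √z)) (expMeasure (1 / 2)) := by
  have := ((integrable_exp_mul_sqrt θ).add (integrable_exp_mul_sqrt (-θ))).div_const 2
  refine this.congr (.of_forall fun z => ?_)
  simp [Real.cosh_eq]

/-- For θ² ≤ 1/2, cosh x ≤ exp(x²/2) leaves 1/(1 − θ²) ≤ 1 + 3θ². For θ² ≥ 1/2, θ√z ≤ 2θ² + z/8
leaves exp(2θ²) · 4/3, and 4/3 ≤ 1 + θ² ≤ exp(θ²). -/
theorem integral_cosh_mul_sqrt_le (θ : ℝ) :
    ∫ z, Real.cosh (θ * √z) ∂expMeasure (1 / 2) ≤ Real.exp (3 * θ ^ 2) := by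
  rcases le_total (θ ^ 2) (1 / 2) with h | h
  · have h1 : θ ^ 2 < 1 := by linarith
    refine (integral_mono_ae (integrable_cosh_mul_sqrt θ)
      (integrable_exp_expMeasure h1) ?_).trans ?_
    · filter_upwards [expMeasure_nonneg] with z hz
      refine (Real.cosh_le_exp_half_sq _).trans_eq ?_
      rw [mul_pow, Real.sq_sqrt hz]
    · rw [integral_exp_expMeasure h1, div_le_iff₀ (by linarith)]
      have h2 := Real.add_one_le_exp (3 * θ ^ 2)
      nlinarith [sq_nonneg θ]
  · have h1 := integrable_exp_expMeasure (θ := 1 / 4) (by norm_num)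
    refine (integral_mono_ae (integrable_cosh_mul_sqrt θ)
      (h1.const_mul (Real.exp (2 * θ ^ 2))) ?_).trans ?_
    · filter_upwards [expMeasure_nonneg] with z hz
      rw [← Real.exp_add, Real.cosh_eq]
      have h2 := Real.exp_le_exp.2 (mul_sqrt_le θ hz)
      have h3 := Real.exp_le_exp.2 (mul_sqrt_le (-θ) hz)
      rw [neg_sq, neg_mul] at h3
      linarith
    · rw [integral_const_mul, integral_exp_expMeasure (by norm_num)]
      have h2 := Real.add_one_le_exp (θ ^ 2)
      have h3 : Real.exp (3 * θ ^ 2) = Real.exp (2 * θ ^ 2) * Real.exp (θ ^ 2) := by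
        rw [← Real.exp_add]; ring_nf
      rw [h3]
      exact mul_le_mul_of_nonneg_left (by norm_num; linarith) (Real.exp_nonneg _)

theorem abs_sqrt_add_sub_le {s x y : ℝ} (hs : 0 ≤ s) (hx : 0 ≤ x) (hy : 0 ≤ y) :
    |√(s + x) - √(s + y)| ≤ max √x √y := by
  have key : ∀ {x y : ℝ}, 0 ≤ x → 0 ≤ y → √(s + x) - √(s + y) ≤ √x := by
    intro x y hx hy
    have h1 : √(s + x) ≤ √s + √x := by
      rw [Real.sqrt_le_left (by positivity), add_sq, Real.sq_sqrt hs, Real.sq_sqrt hx]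
      have := mul_nonneg (Real.sqrt_nonneg s) (Real.sqrt_nonneg x)
      linarith
    have h2 : √s ≤ √(s + y) := Real.sqrt_le_sqrt (by linarith)
    linarith
  refine abs_le.2 ⟨?_, (key hx hy).trans (le_max_left _ _)⟩
  linarith [key hy hx, le_max_right √x √y]

/-- Symmetrization. By Jensen the centering is replaced by an independent copy, so the quantity is
at most E cosh(θ(H − H')). As |H − H'| ≤ max(√Z, √Z') and cosh ≥ 1, this is at most 2A − 1 ≤ A² with
A = E cosh(θ√Z) ≤ exp(3θ²). Nonnegativity of `s` is used for |√(s+x) − √(s+y)| ≤ max(√x, √y). -/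
theorem integral_exp_centered_le {s : ℝ} (hs : 0 ≤ s) {h : ℝ → ℝ} (hm : Measurable h)
    (hlip : ∀ β β', |h β - h β'| ≤ |√β - √β'|) (θ : ℝ) :
    Integrable (fun β => Real.exp (θ * (∫ β', h β' ∂shiftedExp s (1 / 2) - h β)))
      (shiftedExp s (1 / 2)) ∧
    ∫ β, Real.exp (θ * (∫ β', h β' ∂shiftedExp s (1 / 2) - h β)) ∂shiftedExp s (1 / 2) ≤
      Real.exp (6 * θ ^ 2) := by
  set E := expMeasure (1 / 2) with hE
  set H : ℝ → ℝ := fun z => h (s + z) with hH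
  have hHm : Measurable H := hm.comp (measurable_const_add s)
  have hHlip : ∀ x y, 0 ≤ x → 0 ≤ y → |H x - H y| ≤ max √x √y := fun x y hx hy =>
    (hlip _ _).trans (abs_sqrt_add_sub_le hs hx hy)
  have hexp : ∀ η : ℝ, Integrable (fun z => Real.exp (η * H z)) E := by
    intro η
    refine ((integrable_exp_mul_sqrt |η|).const_mul (Real.exp (η * H 0))).mono'
      (by fun_prop) ?_
    filter_upwards [expMeasure_nonneg] with z hz
    rw [Real.norm_of_nonneg (Real.exp_nonneg _), ← Real.exp_add, Real.exp_le_exp]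
    have h1 := hHlip z 0 hz le_rfl
    rw [Real.sqrt_zero, max_eq_left (Real.sqrt_nonneg z)] at h1
    have h2 : η * (H z - H 0) ≤ |η| * √z := (le_abs_self _).trans (by
      rw [abs_mul]; exact mul_le_mul_of_nonneg_left h1 (abs_nonneg _))
    linarith
  have hint : Integrable H E := by
    refine ((integrable_exp_mul_sqrt 1).add (integrable_const |H 0|)).mono'
      hHm.aestronglyMeasurable ?_
    filter_upwards [expMeasure_nonneg] with z hz
    have h1 := hHlip z 0 hz le_rfl
    rw [Real.sqrt_zero, max_eq_left (Real.sqrt_nonneg z)] at h1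
    have h2 := abs_sub_abs_le_abs_sub (H z) (H 0)
    have h3 := Real.add_one_le_exp (1 * √z)
    rw [Real.norm_eq_abs]
    simp only [Pi.add_apply]
    linarith
  have hc : ∫ β', h β' ∂shiftedExp s (1 / 2) = ∫ z, H z ∂E := by
    rw [shiftedExp, integral_map (by fun_prop) hm.aestronglyMeasurable]
  rw [hc]
  set c := ∫ z, H z ∂E with hcdef
  have hrw : ∀ z, Real.exp (θ * (c - H z)) = Real.exp (θ * c) * Real.exp (-θ * H z) := fun z => by
    rw [← Real.exp_add]; ring_nf
  have hI : Integrable (fun z => Real.exp (θ * (c - H z))) E := by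
    simp_rw [hrw]
    exact (hexp (-θ)).const_mul _
  refine ⟨?_, ?_⟩
  · rw [shiftedExp, integrable_map_measure (by fun_prop) (by fun_prop)]
    exact hI
  rw [shiftedExp, integral_map (by fun_prop) (by fun_prop)]
  change ∫ z, Real.exp (θ * (c - H z)) ∂E ≤ _
  have hjen : Real.exp (θ * c) ≤ ∫ z, Real.exp (θ * H z) ∂E := by
    have := convexOn_exp.map_integral_le (μ := E) (f := fun z => θ * H z)
      Real.continuous_exp.continuousOn isClosed_univ (by simp) (hint.const_mul θ) (hexp θ)
    rwa [integral_const_mul] at this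
  have hprod : ∀ η : ℝ, (∫ z, Real.exp (η * H z) ∂E) * (∫ z, Real.exp (-η * H z) ∂E) =
      ∫ p, Real.exp (η * (H p.1 - H p.2)) ∂(E.prod E) := fun η => by
    rw [← integral_prod_mul]
    refine integral_congr_ae (.of_forall fun p => ?_)
    simp only
    rw [← Real.exp_add]
    ring_nf
  have hprodI : ∀ η : ℝ, Integrable (fun p : ℝ × ℝ => Real.exp (η * (H p.1 - H p.2)))
      (E.prod E) := fun η => by
    refine ((hexp η).mul_prod (hexp (-η))).congr (.of_forall fun p => ?_)
    simp only
    rw [← Real.exp_add]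
    ring_nf
  have hcosh : (∫ z, Real.exp (θ * H z) ∂E) * (∫ z, Real.exp (-θ * H z) ∂E) =
      ∫ p, Real.cosh (θ * (H p.1 - H p.2)) ∂(E.prod E) := by
    have h1 := hprod θ
    have h2 := hprod (-θ)
    rw [neg_neg, mul_comm] at h2
    simp_rw [Real.cosh_eq]
    rw [integral_div, integral_add (hprodI θ)]
    · have h3 : ∀ p : ℝ × ℝ, Real.exp (-(θ * (H p.1 - H p.2))) =
        Real.exp (-θ * (H p.1 - H p.2)) := fun p => by ring_nf
      simp_rw [h3]
      linarith
    · exact (hprodI (-θ)).congr (.of_forall fun p => by simp)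
  have hA := integral_cosh_mul_sqrt_le θ
  have hAI := integrable_cosh_mul_sqrt θ
  set A := ∫ z, Real.cosh (θ * √z) ∂E with hAdef
  have hnn2 : ∀ᵐ p ∂(E.prod E), 0 ≤ p.1 ∧ 0 ≤ p.2 :=
    (Measure.ae_prod_iff_ae_ae (measurableSet_Ici.prod measurableSet_Ici)).2
      (expMeasure_nonneg.mono fun x hx => expMeasure_nonneg.mono fun y hy => ⟨hx, hy⟩)
  have hbd : ∫ p, Real.cosh (θ * (H p.1 - H p.2)) ∂(E.prod E) ≤ 2 * A - 1 := by
    have hI1 : Integrable (fun p : ℝ × ℝ => Real.cosh (θ * √p.1)) (E.prod E) := hAI.comp_fst E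
    have hI2 : Integrable (fun p : ℝ × ℝ => Real.cosh (θ * √p.2)) (E.prod E) := hAI.comp_snd E
    have hle : ∫ p, Real.cosh (θ * (H p.1 - H p.2)) ∂(E.prod E) ≤
        ∫ p : ℝ × ℝ, (Real.cosh (θ * √p.1) + Real.cosh (θ * √p.2) - 1) ∂(E.prod E) := by
      refine integral_mono_of_nonneg (.of_forall fun p => (Real.cosh_pos _).le)
        ((hI1.add hI2).sub (integrable_const _)) ?_
      filter_upwards [hnn2] with p hp
      have h1 := hHlip p.1 p.2 hp.1 hp.2
      have h2 := Real.one_le_cosh (θ * √p.1)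
      have h3 := Real.one_le_cosh (θ * √p.2)
      have hmono : ∀ y : ℝ, |H p.1 - H p.2| ≤ √y →
          Real.cosh (θ * (H p.1 - H p.2)) ≤ Real.cosh (θ * √y) := fun y hy => by
        rw [Real.cosh_le_cosh, abs_mul, abs_mul, abs_of_nonneg (Real.sqrt_nonneg y)]
        exact mul_le_mul_of_nonneg_left hy (abs_nonneg _)
      rcases le_max_iff.1 h1 with h4 | h4
      · linarith [hmono _ h4]
      · linarith [hmono _ h4]
    refine hle.trans_eq ?_
    have hI3 : Integrable (fun p : ℝ × ℝ => Real.cosh (θ * √p.1) + Real.cosh (θ * √p.2))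
      (E.prod E) := hI1.add hI2
    rw [integral_sub hI3 (integrable_const _), integral_add hI1 hI2,
      integral_fun_fst (μ := E) (ν := E) fun z => Real.cosh (θ * √z),
      integral_fun_snd (μ := E) (ν := E) fun z => Real.cosh (θ * √z)]
    simp only [integral_const, probReal_univ, one_smul, ← hAdef]
    ring
  simp_rw [hrw]
  rw [integral_const_mul]
  have hnn : 0 ≤ ∫ z, Real.exp (-θ * H z) ∂E := integral_nonneg fun z => Real.exp_nonneg _
  have h6 : Real.exp (6 * θ ^ 2) = Real.exp (3 * θ ^ 2) ^ 2 := by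
    rw [← Real.exp_nat_mul]; push_cast; ring_nf
  have := mul_le_mul_of_nonneg_right hjen hnn
  nlinarith [sq_nonneg (Real.exp (3 * θ ^ 2) - 1)]

end Mgf

-- Concentration of the martingale in the confidence parameters.

section Martingale

variable {Ω : Type*} [MeasurableSpace Ω] {P : Measure Ω} [IsProbabilityMeasure P]
  {ζ : ℕ → Ω → ℝ} {s : ℕ → ℝ} {m : ℕ}

theorem IsShiftedExpSeq.lintegral_past (hζ : IsShiftedExpSeq P s (1 / 2) ζ) (t : ℕ)
    {F : (ℕ → ℝ) × ℝ → ℝ≥0∞} (hF : Measurable F)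
    (hdep : ∀ (z z' : ℕ → ℝ) β, (∀ i < t, z i = z' i) → F (z, β) = F (z', β)) :
    ∫⁻ ω, F (fun i => ζ i ω, ζ t ω) ∂P =
      ∫⁻ ω, ∫⁻ β, F (fun i => ζ i ω, β) ∂shiftedExp (s (t + 1)) (1 / 2) ∂P := by
  classical
  let tr : (ℕ → ℝ) → ℕ → ℝ := fun z i => if i < t then z i else 0
  have htr : Measurable tr := measurable_pi_iff.2 fun i => by
    simp only [tr]
    split_ifs
    · fun_prop
    · exact measurable_const
  have hζm := hζ.measurable
  have hpast : Measurable fun ω => tr fun i => ζ i ω := htr.comp (by fun_prop)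
  have htreq : ∀ z β, F (z, β) = F (tr z, β) := fun z β =>
    hdep _ _ _ fun i hi => by simp [tr, hi]
  have hind : IndepFun (fun ω => tr fun i => ζ i ω) (ζ t) P :=
    indepFun_of_past hζ.measurable hζ.indep htr fun z z' hz => by
      ext i
      by_cases hi : i < t
      · simp [tr, hi, hz i hi]
      · simp [tr, hi]
  simp_rw [fun ω β => htreq (fun i => ζ i ω) β]
  have h1 := lintegral_map (μ := P) hF (hpast.prodMk (hζm t))
  rw [(indepFun_iff_map_prod_eq_prod_map_map hpast.aemeasurable
    (hζm t).aemeasurable).1 hind, lintegral_prod _ hF.aemeasurable, hζ.law,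
    lintegral_map hF.lintegral_prod_right' hpast] at h1
  exact h1.symm

variable {u : ℕ → (ℕ → ℝ) → ℝ → ℝ}

/-- Given the past, the newest increment is a centered Lipschitz function of √ζ_T; integrating it
out first costs a factor exp(6θ²). -/
theorem IsShiftedExpSeq.lintegral_exp_martingale (hζ : IsShiftedExpSeq P s (1 / 2) ζ)
    (hs : ∀ t, m ≤ t → 0 ≤ s (t + 1)) (hu : ∀ t, Measurable (Function.uncurry (u t)))
    (hdep : ∀ (t : ℕ) (z z' : ℕ → ℝ) β, (∀ i < t, z i = z' i) → u t z β = u t z' β)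
    (hlip : ∀ t z β β', |u t z β - u t z β'| ≤ |√β - √β'|) (θ : ℝ) (T : ℕ) :
    ∫⁻ ω, ENNReal.ofReal (Real.exp (θ * ∑ t ∈ Finset.Ico m T,
      (∫ β, u t (fun i => ζ i ω) β ∂shiftedExp (s (t + 1)) (1 / 2) -
        u t (fun i => ζ i ω) (ζ t ω)))) ∂P ≤ ENNReal.ofReal (Real.exp (6 * θ ^ 2 * T)) := by
  set c : ℕ → (ℕ → ℝ) → ℝ := fun t z => ∫ β, u t z β ∂shiftedExp (s (t + 1)) (1 / 2) with hc
  have hcm : ∀ t, Measurable (c t) := fun t =>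
    (StronglyMeasurable.integral_prod_right (hu t).stronglyMeasurable).measurable
  have hcdep : ∀ (t : ℕ) (z z' : ℕ → ℝ), (∀ i < t, z i = z' i) → c t z = c t z' :=
    fun t z z' hz => by simp only [hc, hdep t z z' _ hz]
  have hu' : ∀ t i, Measurable fun q : (ℕ → ℝ) × ℝ => u t q.1 (q.1 i) := fun t i =>
    (hu t).comp (f := fun q : (ℕ → ℝ) × ℝ => (q.1, q.1 i)) (by fun_prop)
  induction T with
  | zero => simp
  | succ T ih =>
    rcases lt_or_ge T m with hT | hT
    · rw [Finset.Ico_eq_empty (by omega)]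
      simp only [Finset.sum_empty, mul_zero, Real.exp_zero, ENNReal.ofReal_one, lintegral_const,
        measure_univ, mul_one]
      exact ENNReal.one_le_ofReal.2 (Real.one_le_exp (by positivity))
    · let N : (ℕ → ℝ) → ℝ := fun z => ∑ t ∈ Finset.Ico m T, (c t z - u t z (z t))
      let F : (ℕ → ℝ) × ℝ → ℝ≥0∞ := fun q => ENNReal.ofReal (Real.exp (θ * N q.1)) *
        ENNReal.ofReal (Real.exp (θ * (c T q.1 - u T q.1 q.2)))
      have hN : Measurable fun q : (ℕ → ℝ) × ℝ => N q.1 :=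
        Finset.measurable_fun_sum _ fun t _ => ((hcm t).comp measurable_fst).sub (hu' t t)
      have hF : Measurable F := by
        refine Measurable.mul (Real.measurable_exp.comp (hN.const_mul θ)).ennreal_ofReal
          (Real.measurable_exp.comp (Measurable.const_mul ?_ θ)).ennreal_ofReal
        exact ((hcm T).comp measurable_fst).sub (hu T)
      have hFdep : ∀ (z z' : ℕ → ℝ) β, (∀ i < T, z i = z' i) → F (z, β) = F (z', β) := by
        intro z z' β hz
        have h1 : N z = N z' := Finset.sum_congr rfl fun t ht => by
          have ht := (Finset.mem_Ico.1 ht).2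
          have hz' : ∀ i < t, z i = z' i := fun i hi => hz i (hi.trans ht)
          rw [hcdep t z z' hz', hz t ht, hdep t z z' _ hz']
        simp only [F, h1, hcdep T z z' hz, hdep T z z' β hz]
      have e1 : ∀ ω, ENNReal.ofReal (Real.exp (θ * ∑ t ∈ Finset.Ico m (T + 1),
          (c t (fun i => ζ i ω) - u t (fun i => ζ i ω) (ζ t ω)))) =
          F (fun i => ζ i ω, ζ T ω) := fun ω => by
        rw [Finset.sum_Ico_succ_top hT, mul_add, Real.exp_add,
          ENNReal.ofReal_mul (Real.exp_nonneg _)]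
      simp only [hc] at e1 ih ⊢
      simp_rw [e1]
      rw [hζ.lintegral_past T hF hFdep]
      calc _ ≤ ∫⁻ ω, ENNReal.ofReal (Real.exp (θ * N fun i => ζ i ω)) *
            ENNReal.ofReal (Real.exp (6 * θ ^ 2)) ∂P := by
            refine lintegral_mono fun ω => ?_
            simp only [F]
            rw [lintegral_const_mul' _ _ ENNReal.ofReal_ne_top]
            gcongr
            have h1 := integral_exp_centered_le (hs T hT) (h := u T fun i => ζ i ω)
              ((hu T).comp measurable_prodMk_left) (hlip T _) θ
            rw [← ofReal_integral_eq_lintegral_ofReal h1.1 (.of_forall fun _ => Real.exp_nonneg _)]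
            exact ENNReal.ofReal_le_ofReal h1.2
        _ ≤ ENNReal.ofReal (Real.exp (6 * θ ^ 2 * T)) * ENNReal.ofReal (Real.exp (6 * θ ^ 2)) := by
            rw [lintegral_mul_const' _ _ ENNReal.ofReal_ne_top]
            gcongr
        _ = _ := by
            rw [← ENNReal.ofReal_mul (Real.exp_nonneg _), ← Real.exp_add]
            push_cast
            ring_nf

theorem measure_lt_le_of_lintegral_exp {X : Ω → ℝ} (hX : Measurable X) {θ C a : ℝ} (hθ : 0 ≤ θ)
    (h : ∫⁻ ω, ENNReal.ofReal (Real.exp (θ * X ω)) ∂P ≤ ENNReal.ofReal (Real.exp C)) :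
    P {ω | a < X ω} ≤ ENNReal.ofReal (Real.exp (C - θ * a)) := by
  have h1 : P {ω | a < X ω} ≤
      P {ω | ENNReal.ofReal (Real.exp (θ * a)) ≤ ENNReal.ofReal (Real.exp (θ * X ω))} :=
    measure_mono fun ω hω => ENNReal.ofReal_le_ofReal (Real.exp_le_exp.2
      (mul_le_mul_of_nonneg_left (le_of_lt hω) hθ))
  have h2 := mul_meas_ge_le_lintegral (μ := P)
    (f := fun ω => ENNReal.ofReal (Real.exp (θ * X ω))) (by fun_prop)
    (ENNReal.ofReal (Real.exp (θ * a)))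
  rw [Real.exp_sub, ENNReal.ofReal_div_of_pos (Real.exp_pos _)]
  refine h1.trans ((ENNReal.le_div_iff_mul_le (.inl ?_) (.inl ENNReal.ofReal_ne_top)).2 ?_)
  · exact (ENNReal.ofReal_pos.2 (Real.exp_pos _)).ne'
  · rw [mul_comm]
    exact h2.trans h

theorem IsShiftedExpSeq.martingale_tail (hζ : IsShiftedExpSeq P s (1 / 2) ζ)
    (hs : ∀ t, m ≤ t → 0 ≤ s (t + 1)) (hu : ∀ t, Measurable (Function.uncurry (u t)))
    (hdep : ∀ (t : ℕ) (z z' : ℕ → ℝ) β, (∀ i < t, z i = z' i) → u t z β = u t z' β)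
    (hlip : ∀ t z β β', |u t z β - u t z β'| ≤ |√β - √β'|) {T : ℕ} (hT : 0 < T) {l : ℝ}
    (hl : 0 ≤ l) :
    P {ω | 5 * √(T * l) < ∑ t ∈ Finset.Ico m T,
      (∫ β, u t (fun i => ζ i ω) β ∂shiftedExp (s (t + 1)) (1 / 2) -
        u t (fun i => ζ i ω) (ζ t ω))} ≤ ENNReal.ofReal (Real.exp (-l)) := by
  have hζm := hζ.measurable
  have hT' : (0 : ℝ) < T := by exact_mod_cast hT
  -- With this choice 6θ²T − 5θ√(Tl) = 3l/2 − 5l/2 = −l.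
  set θ := √(l / T) / 2 with hθ
  refine (measure_lt_le_of_lintegral_exp (θ := θ) ?_ (by positivity)
    (hζ.lintegral_exp_martingale hs hu hdep hlip θ T)).trans_eq ?_
  · refine Finset.measurable_fun_sum _ fun t _ => Measurable.sub ?_ ?_
    · exact (StronglyMeasurable.integral_prod_right (hu t).stronglyMeasurable).measurable.comp
        (f := fun ω i => ζ i ω) (by fun_prop)
    · exact (hu t).comp (f := fun ω => (fun i => ζ i ω, ζ t ω)) (by fun_prop)
  · congr 2
    have h1 : √(l / T) * √(T * l) = l := by
      rw [← Real.sqrt_mul (by positivity), show l / T * (T * l) = l ^ 2 by field_simp,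
        Real.sqrt_sq hl]
    have h2 : √(l / T) ^ 2 * T = l := by
      rw [Real.sq_sqrt (by positivity)]
      field_simp
    have h3 : 6 * θ ^ 2 * T - θ * (5 * √(T * l)) =
      3 / 2 * (√(l / T) ^ 2 * T) - 5 / 2 * (√(l / T) * √(T * l)) := by rw [hθ]; ring
    rw [h3, h1, h2]
    ring

end Martingale

-- Upper tail of the sum of the confidence parameters.

section ExponentialSum

theorem two_exp_neg_half_ge : 1.213 ≤ 2 * Real.exp (-(1 / 2)) := by
  have h1 : Real.exp (-(1 / 2)) * Real.exp (-(1 / 2)) * Real.exp 1 = 1 := by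
    rw [← Real.exp_add, ← Real.exp_add]; norm_num
  have h2 := Real.exp_one_lt_d9
  have h3 := Real.exp_pos (-(1 / 2) : ℝ)
  by_contra h
  push Not at h
  have h4 : Real.exp (-(1 / 2)) < 0.6065 := by linarith
  have h5 : Real.exp (-(1 / 2)) * Real.exp (-(1 / 2)) < 0.6065 * 0.6065 :=
    mul_lt_mul'' h4 h4 h3.le h3.le
  nlinarith [Real.exp_pos (1 : ℝ)]

/-- The inequality left over by the Chernoff bound in `IsShiftedExpSeq.sum_tail`. It is checked at c
= log 2 by a cubic Taylor polynomial; from there on the right side grows at least as fast in c as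
the left. -/
theorem quadratic_le_exp {v c : ℝ} (hv : 0 ≤ v) (hc : Real.log 2 ≤ c) :
    v ^ 2 + v + 1 / 2 + c ≤ Real.exp (v + c - 1 / 2) := by
  have h1 : 1 + v + v ^ 2 / 2 + v ^ 3 / 6 ≤ Real.exp v := by
    have := Real.sum_le_exp_of_nonneg hv 4
    simp only [Finset.sum_range_succ, Finset.range_zero, Finset.sum_empty] at this
    norm_num [Nat.factorial] at this
    linarith
  have h2 := two_exp_neg_half_ge
  have h3 := Real.log_two_lt_d9
  have h4 : Real.exp (v + Real.log 2 - 1 / 2) = 2 * Real.exp (-(1 / 2)) * Real.exp v := by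
    rw [show v + Real.log 2 - 1 / 2 = Real.log 2 + -(1 / 2) + v by ring, Real.exp_add,
      Real.exp_add, Real.exp_log (by norm_num)]
  have h5 : v ^ 2 + v + 1 / 2 + Real.log 2 ≤ Real.exp (v + Real.log 2 - 1 / 2) := by
    rw [h4]
    have h6 : 1.213 * (1 + v + v ^ 2 / 2 + v ^ 3 / 6) ≤ 2 * Real.exp (-(1 / 2)) * Real.exp v :=
      mul_le_mul h2 h1 (by positivity) (by positivity)
    -- The difference is a positive constant plus v times a quadratic whose minimum lies near 0.973.
    nlinarith [mul_nonneg hv (sq_nonneg (v - 0.973))]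
  have h7 : Real.exp (v + c - 1 / 2) =
      Real.exp (v + Real.log 2 - 1 / 2) * Real.exp (c - Real.log 2) := by
    rw [← Real.exp_add]; ring_nf
  rw [h7]
  have h8 := Real.add_one_le_exp (c - Real.log 2)
  have h9 : 1 ≤ Real.exp (v + Real.log 2 - 1 / 2) :=
    Real.one_le_exp (by have := Real.log_two_gt_d9; linarith)
  have h10 : 0 ≤ c - Real.log 2 := by linarith
  nlinarith [mul_le_mul h9 h8 (by linarith) (by linarith)]

variable {Ω : Type*} [MeasurableSpace Ω] {P : Measure Ω} [IsProbabilityMeasure P]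
  {ζ : ℕ → Ω → ℝ} {s : ℕ → ℝ}

theorem IsShiftedExpSeq.lintegral_exp_sum (hζ : IsShiftedExpSeq P s (1 / 2) ζ) {θ : ℝ}
    (hθ : θ < 1) (I : Finset ℕ) :
    ∫⁻ ω, ENNReal.ofReal (Real.exp (θ / 2 * ∑ t ∈ I, (ζ t ω - s (t + 1)))) ∂P =
      ENNReal.ofReal (1 / (1 - θ)) ^ I.card := by
  have hm := hζ.measurable
  have h1 : ∀ ω, ENNReal.ofReal (Real.exp (θ / 2 * ∑ t ∈ I, (ζ t ω - s (t + 1)))) =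
      ∏ t ∈ I, ENNReal.ofReal (Real.exp (θ / 2 * (ζ t ω - s (t + 1)))) := fun ω => by
    rw [Finset.mul_sum, Real.exp_sum, ENNReal.ofReal_prod_of_nonneg fun _ _ => Real.exp_nonneg _]
  simp_rw [h1]
  have hind : iIndepFun (fun t ω => ENNReal.ofReal (Real.exp (θ / 2 * (ζ t ω - s (t + 1))))) P :=
    hζ.indep.comp (fun t x => ENNReal.ofReal (Real.exp (θ / 2 * (x - s (t + 1)))))
      fun t => by fun_prop
  rw [lintegral_prod_eq_prod_lintegral_of_indepFun I _ hind fun t => by fun_prop,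
    ← Finset.prod_const]
  refine Finset.prod_congr rfl fun t _ => ?_
  have h4 := lintegral_map (μ := P) (f := fun x => ENNReal.ofReal (Real.exp (θ / 2 *
    (x - s (t + 1))))) (by fun_prop) (hm t)
  rw [← h4, hζ.law, lintegral_shiftedExp _ (by fun_prop), ← lintegral_exp_expMeasure hθ]
  refine lintegral_congr fun z => ?_
  ring_nf

/-- The mean of the sum is 2n with n = |I|; the threshold starts at n, and the slack 4 log 2 (n − 1)
makes up for it when n ≥ 2. For n = 1 there is no slack, but the exact exponential tail at 2l is
already exp(−l). -/
theorem IsShiftedExpSeq.sum_tail (hζ : IsShiftedExpSeq P s (1 / 2) ζ) (I : Finset ℕ)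
    (hI : 1 ≤ I.card) {l : ℝ} (hl : 0 ≤ l) :
    P {ω | I.card + 2 * √(I.card * l) + 2 * l + 4 * Real.log 2 * (I.card - 1) <
      ∑ t ∈ I, (ζ t ω - s (t + 1))} ≤ ENNReal.ofReal (Real.exp (-l)) := by
  have hm := hζ.measurable
  rcases hI.eq_or_lt with h1 | h2
  · obtain ⟨t, rfl⟩ := Finset.card_eq_one.1 h1.symm
    have h3 : {ω | ((({t} : Finset ℕ).card : ℕ) : ℝ) + 2 * √((({t} : Finset ℕ).card : ℕ) * l) +
        2 * l + 4 * Real.log 2 * ((({t} : Finset ℕ).card : ℕ) - 1) <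
        ∑ t ∈ {t}, (ζ t ω - s (t + 1))} ⊆ ζ t ⁻¹' Ioi (s (t + 1) + 2 * l) := fun ω hω => by
      simp only [Finset.card_singleton, Finset.sum_singleton, Nat.cast_one, mem_ofPred_eq] at hω
      have := Real.sqrt_nonneg (1 * l)
      simp only [mem_preimage, mem_Ioi]
      linarith
    refine (measure_mono h3).trans ?_
    rw [← Measure.map_apply (hm t) measurableSet_Ioi, hζ.law, shiftedExp_Ioi]
    refine ENNReal.ofReal_le_ofReal ((min_le_right _ _).trans_eq ?_)
    ring_nf
  · set n : ℝ := (I.card : ℝ) with hn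
    have hn2 : 2 ≤ n := by rw [hn]; exact_mod_cast h2
    have hn0 : 0 < n := by linarith
    set v := √(l / n) with hv
    -- The slack equals 2nc, and n ≥ 2 gives c ≥ log 2. With v = √(l/n) the threshold becomes 2n(v²
    -- + v + 1/2 + c).
    set c := 2 * (n - 1) * Real.log 2 / n with hcdef
    have hlog := Real.log_two_gt_d9
    have hc : Real.log 2 ≤ c := by
      rw [hcdef, le_div_iff₀ hn0]
      nlinarith
    have hv0 : 0 ≤ v := Real.sqrt_nonneg _
    set w := v + c - 1 / 2 with hw
    have hw0 : 0 < w := by linarith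
    -- This makes the moment generating function of the sum exp(nw). The Chernoff exponent is then
    -- at most −l exactly when v² + v + 1/2 + c ≤ exp w.
    set θ := 1 - Real.exp (-w) with hθ
    have hθ1 : θ < 1 := by have := Real.exp_pos (-w); linarith
    have hθ0 : 0 ≤ θ := by
      have := Real.exp_le_one_iff.2 (show -w ≤ 0 by linarith); linarith
    have hmgf := hζ.lintegral_exp_sum hθ1 I
    have h3 : 1 / (1 - θ) = Real.exp w := by
      rw [hθ, sub_sub_cancel, Real.exp_neg, one_div, inv_inv]
    rw [h3, ← ENNReal.ofReal_pow (Real.exp_nonneg _), ← Real.exp_nat_mul, ← hn] at hmgf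
    refine (measure_lt_le_of_lintegral_exp (by fun_prop) (by linarith) hmgf.le).trans ?_
    refine ENNReal.ofReal_le_ofReal (Real.exp_le_exp.2 ?_)
    have h4 : n * v ^ 2 = l := by
      rw [hv, Real.sq_sqrt (by positivity)]; field_simp
    have h5 : √(n * l) = n * v := by
      rw [← h4, show n * (n * v ^ 2) = (n * v) ^ 2 by ring, Real.sqrt_sq (by positivity)]
    have h6 : 4 * Real.log 2 * (n - 1) = 2 * n * c := by rw [hcdef]; field_simp; ring
    rw [h5, h6, ← h4]
    have h7 := quadratic_le_exp hv0 hc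
    have h8 : (v ^ 2 + v + 1 / 2 + c) * Real.exp (-w) ≤ 1 := by
      have := mul_le_mul_of_nonneg_right h7 (Real.exp_nonneg (-w))
      rwa [← Real.exp_add, add_neg_cancel, Real.exp_zero] at this
    have h9 := mul_le_mul_of_nonneg_left h8 hn0.le
    rw [hθ]
    nlinarith

/-- Raising the horizon from t to t + 1 adds s(t+1) + t(s(t+1) − s(t)) to t s(t), and the second
part is at least 4 log 2. -/
theorem sum_shift_slack {m : ℕ} (hs : ∀ t, m ≤ t → 0 ≤ s (t + 1))
    (hstep : ∀ t : ℕ, 1 ≤ t → 4 * Real.log 2 ≤ t * (s (t + 1) - s t)) (n : ℕ) :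
    ∑ t ∈ Finset.Ico m (m + 1 + n), s (t + 1) + 4 * Real.log 2 * n ≤
      (m + 1 + n : ℕ) * s (m + 1 + n) := by
  induction n with
  | zero =>
    have := mul_nonneg (Nat.cast_nonneg (α := ℝ) m) (hs m le_rfl)
    simp
    linarith
  | succ n ih =>
    rw [← add_assoc, Finset.sum_Ico_succ_top (by omega)]
    have := hstep (m + 1 + n) (by omega)
    push_cast at this ih ⊢
    linarith

theorem IsShiftedExpSeq.sum_tail_shift {m : ℕ} (hζ : IsShiftedExpSeq P s (1 / 2) ζ)
    (hs : ∀ t, m ≤ t → 0 ≤ s (t + 1))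
    (hstep : ∀ t : ℕ, 1 ≤ t → 4 * Real.log 2 ≤ t * (s (t + 1) - s t)) {T : ℕ} (hT : m < T)
    {l : ℝ} (hl : 0 ≤ l) :
    P {ω | T * s T + T + 2 * √(T * l) + 2 * l < ∑ t ∈ Finset.Ico m T, ζ t ω} ≤
      ENNReal.ofReal (Real.exp (-l)) := by
  obtain ⟨n, rfl⟩ : ∃ n, T = m + 1 + n := ⟨T - (m + 1), by omega⟩
  have hcard : (Finset.Ico m (m + 1 + n)).card = n + 1 := by simp; omega
  refine (measure_mono fun ω hω => ?_).trans
    (hζ.sum_tail (Finset.Ico m (m + 1 + n)) (by omega) hl)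
  have h1 := sum_shift_slack hs hstep n
  rw [mem_ofPred_eq] at hω
  have h2 : √(((n : ℝ) + 1) * l) ≤ √((m + 1 + n : ℕ) * l) := by
    refine Real.sqrt_le_sqrt (mul_le_mul_of_nonneg_right ?_ hl)
    push_cast
    linarith [Nat.cast_nonneg (α := ℝ) m]
  simp only [mem_ofPred_eq, hcard, Finset.sum_sub_distrib]
  push_cast at *
  linarith [Nat.cast_nonneg (α := ℝ) m]

end ExponentialSum

-- The Gaussian predictive density.

section Convolution

/-- Both sides are densities of the same convolution, so they agree almost everywhere, and
everywhere by continuity. -/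
theorem lintegral_gaussianPDF_gaussianReal (m : ℝ) (s : ℝ≥0) {τ : ℝ≥0} (hτ : τ ≠ 0) (w : ℝ) :
    ∫⁻ v, gaussianPDF v τ w ∂gaussianReal m s = gaussianPDF m (s + τ) w := by
  have hsτ : s + τ ≠ 0 := by
    have := pos_iff_ne_zero.2 hτ
    positivity
  set g : ℝ → ℝ≥0∞ := fun w => ∫⁻ v, gaussianPDF v τ w ∂gaussianReal m s with hg
  have hgc : Continuous g := continuous_lintegral_of_bounded _ ENNReal.ofReal_ne_top
    (fun w => (continuous_gaussianPDF τ).measurable.comp (f := fun v => (v, w)) (by fun_prop))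
    (fun w v => gaussianPDF_le v τ w)
    (fun v => (continuous_gaussianPDF τ).comp (f := fun w => (v, w)) (by fun_prop))
  have hpc : Continuous (gaussianPDF m (s + τ)) :=
    (continuous_gaussianPDF (s + τ)).comp (f := fun w => (m, w)) (by fun_prop)
  have hpm : Measurable fun p : ℝ × ℝ => gaussianPDF p.1 τ p.2 :=
    (continuous_gaussianPDF τ).measurable
  have hmeas : (volume : Measure ℝ).withDensity (gaussianPDF m (s + τ)) =
      volume.withDensity g := by
    have h1 := gaussianReal_conv_gaussianReal (m₁ := m) (m₂ := 0) (v₁ := s) (v₂ := τ)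
    rw [add_zero, gaussianReal_of_var_ne_zero m hsτ] at h1
    rw [← h1]
    refine Measure.ext_of_lintegral _ fun ψ hψ => ?_
    rw [Measure.lintegral_conv hψ, lintegral_withDensity_eq_lintegral_mul _ hgc.measurable hψ]
    have h2 : ∀ v, ∫⁻ e, ψ (v + e) ∂gaussianReal 0 τ = ∫⁻ w, gaussianPDF v τ w * ψ w := by
      intro v
      rw [← lintegral_map (g := fun e => v + e) hψ (by fun_prop), gaussianReal_map_const_add,
        zero_add, gaussianReal_of_var_ne_zero v hτ,
        lintegral_withDensity_eq_lintegral_mul _ (measurable_gaussianPDF _ _) hψ]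
      rfl
    simp_rw [h2]
    rw [lintegral_lintegral_swap (hpm.mul (hψ.comp measurable_snd)).aemeasurable]
    refine lintegral_congr fun w => ?_
    have hq : Measurable fun v => gaussianPDF v τ w :=
      hpm.comp (f := fun v => (v, w)) (by fun_prop)
    simp only [Pi.mul_apply, hg]
    exact lintegral_mul_const _ hq
  have hae := (withDensity_eq_iff (measurable_gaussianPDF _ _).aemeasurable
    hgc.measurable.aemeasurable (by rw [lintegral_gaussianPDF_eq_one m hsτ]; simp)).1 hmeas
  exact (congrFun ((Continuous.ae_eq_iff_eq volume hpc hgc).1 hae) w).symm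

end Convolution

-- The evidence as a product of predictive densities.

section Evidence

variable {𝒳 Ω : Type*} [MeasurableSpace Ω] {P : Measure Ω} [IsProbabilityMeasure P]
  {k : 𝒳 → 𝒳 → ℝ} {f : 𝒳 → Ω → ℝ} {σ : ℝ}

/-- The data set of the first `t` terms of a sequence of inputs and a sequence of values. -/
def seqData (A : ℕ → 𝒳) (y : ℕ → ℝ) (t : ℕ) : Fin t → 𝒳 × ℝ := fun i => (A i, y i)

theorem seqData_succ (A : ℕ → 𝒳) (y : ℕ → ℝ) (t : ℕ) :
    seqData A y (t + 1) = Fin.snoc (α := fun _ => 𝒳 × ℝ) (seqData A y t) (A t, y t) := by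
  ext i : 1
  induction i using Fin.lastCases with
  | last => simp [seqData]
  | cast i => simp [seqData]

/-- The posterior variance at the `t`-th of a sequence of inputs. -/
def seqVar (k : 𝒳 → 𝒳 → ℝ) (σ : ℝ) (A : ℕ → 𝒳) (t : ℕ) : ℝ :=
  postVar k σ (seqData A 0 t) (A t)

theorem postVar_congr {t : ℕ} {D D' : Fin t → 𝒳 × ℝ} (h : ∀ i, (D i).1 = (D' i).1) (x : 𝒳) :
    postVar k σ D x = postVar k σ D' x := by
  have h1 : kvec k D x = kvec k D' x := by ext i; simp [kvec, h]
  have h2 : gram k D = gram k D' := by ext i j; simp [gram, h]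
  rw [postVar, postVar, h1, h2]

theorem postVar_seqData (A : ℕ → 𝒳) (y : ℕ → ℝ) (t : ℕ) :
    postVar k σ (seqData A y t) (A t) = seqVar k σ A t :=
  postVar_congr (fun _ => rfl) _

/-- Chain rule: integrating the last likelihood factor against the Gaussian posterior adds the noise
variance to the posterior variance. -/
theorem CenteredGP.lintegral_lik_seqData (h : CenteredGP P k f) (hσ : 0 < σ) (A : ℕ → 𝒳)
    (y : ℕ → ℝ) (t : ℕ) :
    ∫⁻ ω, lik σ (seqData A y t) (f · ω) ∂P = ∏ i ∈ Finset.range t,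
      gaussianPDF (postMean k σ (seqData A y i) (A i))
        ((seqVar k σ A i).toNNReal + (σ ^ 2).toNNReal) (y i) := by
  have hv : (σ ^ 2).toNNReal ≠ 0 := (Real.toNNReal_pos.2 (by positivity)).ne'
  induction t with
  | zero => simp [lik_def]
  | succ t ih =>
    rw [Finset.prod_range_succ, ← ih]
    have h1 : ∀ ω, lik σ (seqData A y (t + 1)) (f · ω) = lik σ (seqData A y t) (f · ω) *
        gaussianPDF (f (A t) ω) (σ ^ 2).toNNReal (y t) := fun ω => by
      simp only [lik_def, Fin.prod_univ_castSucc]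
      rfl
    simp_rw [h1]
    have hpm : Measurable fun v => gaussianPDF v (σ ^ 2).toNNReal (y t) :=
      (continuous_gaussianPDF _).measurable.comp (f := fun v => (v, y t)) (by fun_prop)
    have h2 := h.lintegral_post hσ (seqData A y t) (A t) hpm
    rw [post, lintegral_withDensity_eq_lintegral_mul _
      (f := fun ω => lik σ (seqData A y t) (f · ω)) (h.measurable_lik _)
      (g := fun ω => gaussianPDF (f (A t) ω) (σ ^ 2).toNNReal (y t))
      (hpm.comp (h.measurable (A t))), withDensity_apply _ MeasurableSet.univ,
      Measure.restrict_univ, lintegral_gaussianPDF_gaussianReal _ _ hv, postVar_seqData] at h2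
    exact h2

end Evidence

-- Information gain and the sum of posterior variances.

section Information

variable {𝒳 Ω : Type*} [MeasurableSpace Ω] {P : Measure Ω} [IsProbabilityMeasure P]
  {k : 𝒳 → 𝒳 → ℝ} {f : 𝒳 → Ω → ℝ} {σ : ℝ} {ε : ℕ → Ω → ℝ}

theorem log_gaussianPDFReal (m : ℝ) {v : ℝ≥0} (hv : v ≠ 0) (x : ℝ) :
    Real.log (gaussianPDFReal m v x) =
      -(Real.log (2 * Real.pi * v) / 2) - (x - m) ^ 2 / (2 * v) := by
  have hv' : (0 : ℝ) < v := by exact_mod_cast pos_iff_ne_zero.2 hv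
  rw [gaussianPDFReal, Real.log_mul (by positivity) (Real.exp_ne_zero _), Real.log_exp,
    Real.log_inv, Real.log_sqrt (by positivity)]
  ring

theorem integral_sq_gaussian {X : Ω → ℝ} (hX : Measurable X) {v : ℝ≥0}
    (hlaw : P.map X = gaussianReal 0 v) : ∫ ω, X ω ^ 2 ∂P = v := by
  have h1 : ∫ ω, X ω ^ 2 ∂P = ∫ x, x ^ 2 ∂gaussianReal 0 v := by
    rw [← hlaw, integral_map hX.aemeasurable (by fun_prop)]
  have h2 := variance_id_gaussianReal (μ := 0) (v := v)
  rw [variance_eq_integral measurable_id.aemeasurable] at h2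
  simp only [id, integral_id_gaussianReal, sub_zero] at h2
  rw [h1, h2]

variable (h : CenteredGP P k f) (hσ : 0 < σ) (hε : IsGaussianNoise P σ ε)
  (hfε : IndepFun (fun ω x => f x ω) (fun ω i => ε i ω) P) (A : ℕ → 𝒳)

/-- The noisy observations of `f` at the inputs `A`. -/
def obs (f : 𝒳 → Ω → ℝ) (ε : ℕ → Ω → ℝ) (A : ℕ → 𝒳) (ω : Ω) (i : ℕ) : ℝ := f (A i) ω + ε i ω

include h hσ hε hfε in
-- The innovation is the prediction residual plus fresh noise, and the two are uncorrelated.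
theorem CenteredGP.integral_innovation (t : ℕ) :
    Integrable (fun ω => (obs f ε A ω t -
      postMean k σ (seqData A (obs f ε A ω) t) (A t)) ^ 2) P ∧
    ∫ ω, (obs f ε A ω t - postMean k σ (seqData A (obs f ε A ω) t) (A t)) ^ 2 ∂P =
      seqVar k σ A t + σ ^ 2 := by
  have hεm := hε.measurable
  have hm := h.measurable
  let N : Fin t → Ω → ℝ := fun i => ε i
  have hNind : iIndepFun N P := hε.indep.precomp Fin.val_injective
  have hfN : IndepFun (fun ω x => f x ω) (fun ω i => N i ω) P := by
    have := hfε.comp (φ := fun g : 𝒳 → ℝ => g) (ψ := fun (e : ℕ → ℝ) (i : Fin t) => e i)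
      measurable_id (by fun_prop)
    exact this
  set D := seqData A 0 t with hD
  obtain ⟨h0, hlaw, -⟩ := h.residual_law hσ D (A t) (N := N) (fun i => hεm i)
    (fun i => hε.law i) hNind hfN
  set R := residual k σ D (A t) f N with hR
  have hRm : Measurable R := by
    rw [hR]; unfold residual; fun_prop
  have hεg : ∀ i, HasGaussianLaw (ε i) P := fun i => ⟨by rw [hε.law]; infer_instance⟩
  have hεL : ∀ i, MemLp (ε i) 2 P := fun i => (hεg i).memLp_two
  have hRL : MemLp R 2 P := by
    have : HasGaussianLaw R P := ⟨by rw [hlaw]; infer_instance⟩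
    exact this.memLp_two
  have heq : ∀ ω, obs f ε A ω t - postMean k σ (seqData A (obs f ε A ω) t) (A t) =
      R ω + ε t ω := fun ω => by
    rw [h.postMean_eq hσ, hR, residual, obs]
    have : ∀ i : Fin t, postWeight k σ (seqData A (obs f ε A ω) t) (A t) i =
        postWeight k σ D (A t) i := fun i => rfl
    simp only [this, seqData, obs, hD, N]
    ring
  have hfε' : ∀ x i, covariance (f x) (ε i) P = 0 := fun x i =>
    (hfε.comp (measurable_pi_apply x) (measurable_pi_apply i)).covariance_eq_zero
      (h.memLp x) (hεL i)
  have hcov : covariance R (ε t) P = 0 := by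
    have hYL : ∀ i : Fin t, MemLp (fun ω => f (D i).1 ω + N i ω) 2 P :=
      fun i => (h.memLp _).add (hεL i)
    change covariance (fun ω => f (A t) ω - ∑ i, postWeight k σ D (A t) i *
      (f (D i).1 ω + N i ω)) (ε t) P = 0
    rw [covariance_fun_sub_left (h.memLp _)
      (memLp_finsetSum _ fun i _ => (hYL i).const_mul _) (hεL t), hfε',
      covariance_fun_sum_left (fun i => (hYL i).const_mul _) (hεL t), zero_sub, neg_eq_zero]
    refine Finset.sum_eq_zero fun i _ => ?_
    rw [covariance_const_mul_left,
      show (fun ω => f (D i).1 ω + N i ω) = f (D i).1 + ε i from rfl,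
      covariance_add_left (h.memLp _) (hεL i) (hεL t), hfε',
      (hε.indep.indepFun (i := i) (j := t) (by omega)).covariance_eq_zero (hεL i) (hεL t)]
    simp
  have hmean : ∀ {X : Ω → ℝ} {v : ℝ≥0}, Measurable X → P.map X = gaussianReal 0 v →
      ∫ ω, X ω ∂P = 0 := fun hX hl => by
    have := integral_map (μ := P) (f := fun x : ℝ => x) hX.aemeasurable (by fun_prop)
    rw [hl, integral_id_gaussianReal] at this
    exact this.symm
  have hcross : ∫ ω, R ω * ε t ω ∂P = 0 := by
    rw [covariance_eq_sub hRL (hεL t), hmean hRm hlaw] at hcov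
    simpa using hcov
  have hI1 := hRL.integrable_sq
  have hI2 := (hεL t).integrable_sq
  have hI3 : Integrable (fun ω => R ω * ε t ω) P := hRL.integrable_mul (hεL t)
  have hexp : ∀ ω, (obs f ε A ω t - postMean k σ (seqData A (obs f ε A ω) t) (A t)) ^ 2 =
      R ω ^ 2 + 2 * (R ω * ε t ω) + ε t ω ^ 2 := fun ω => by rw [heq]; ring
  simp_rw [hexp]
  have hI12 : Integrable (fun ω => R ω ^ 2 + 2 * (R ω * ε t ω)) P := hI1.add (hI3.const_mul 2)
  refine ⟨hI12.add hI2, ?_⟩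
  rw [integral_add hI12 hI2, integral_add hI1 (hI3.const_mul 2), integral_const_mul, hcross,
    integral_sq_gaussian hRm hlaw, integral_sq_gaussian (hεm t) (hε.law t)]
  rw [Real.coe_toNNReal _ h0, Real.coe_toNNReal _ (sq_nonneg σ), seqVar]
  ring

theorem map_add_pi_gaussianReal {ι : Type*} [Fintype ι] (c : ι → ℝ) {v : ℝ≥0} (hv : v ≠ 0) :
    (Measure.pi fun _ : ι => gaussianReal 0 v).map (fun e i => c i + e i) =
      volume.withDensity (fun y => ∏ i, gaussianPDF (c i) v (y i)) := by
  rw [withDensity_prod_gaussianPDF _ hv]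
  have := Measure.pi_map_pi (μ := fun _ : ι => gaussianReal 0 v)
    (f := fun i y => c i + y) (fun i => (measurable_const_add _).aemeasurable)
  rw [this]
  simp [gaussianReal_map_const_add]

/-- Extension of a finite tuple by zero. -/
def zeroExt {T : ℕ} (y : Fin T → ℝ) (i : ℕ) : ℝ := if h : i < T then y ⟨i, h⟩ else 0

theorem zeroExt_val {T : ℕ} (y : Fin T → ℝ) (i : Fin T) : zeroExt y i = y i := by
  simp [zeroExt]

theorem measurable_zeroExt {T : ℕ} (i : ℕ) : Measurable fun y : Fin T → ℝ => zeroExt y i := by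
  simp only [zeroExt]
  split_ifs
  · fun_prop
  · exact measurable_const

theorem seqData_congr {y y' : ℕ → ℝ} {t : ℕ} (hy : ∀ i < t, y i = y' i) :
    seqData A y t = seqData A y' t := by
  ext i : 1
  simp [seqData, hy i i.2]

include h hσ in
theorem CenteredGP.measurable_postMean_seqData {T : ℕ} (t : ℕ) :
    Measurable fun y : Fin T → ℝ => postMean k σ (seqData A (zeroExt y) t) (A t) := by
  simp only [h.postMean_eq hσ]
  refine Finset.measurable_fun_sum _ fun i _ => ?_
  exact (measurable_zeroExt (i : ℕ)).const_mul (postWeight k σ (seqData A 0 t) (A t) i)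

include h hσ hε hfε in
theorem CenteredGP.lintegral_obs {T : ℕ} {Ψ : (Fin T → ℝ) × (Fin T → ℝ) → ℝ≥0∞}
    (hΨ : Measurable Ψ) :
    ∫⁻ ω, Ψ (fun i => obs f ε A ω i, fun i => f (A i) ω) ∂P =
      ∫⁻ v, ∫⁻ y, (∏ i, gaussianPDF (v i) (σ ^ 2).toNNReal (y i)) * Ψ (y, v) ∂volume
        ∂P.map (fun ω (i : Fin T) => f (A i) ω) := by
  have hv : (σ ^ 2).toNNReal ≠ 0 := (Real.toNNReal_pos.2 (by positivity)).ne'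
  have hεm := hε.measurable
  have hm := h.measurable
  have hF : Measurable fun ω (i : Fin T) => f (A i) ω := by fun_prop
  have hE : Measurable fun ω (i : Fin T) => ε i ω := by fun_prop
  have hind : IndepFun (fun ω (i : Fin T) => f (A i) ω) (fun ω (i : Fin T) => ε i ω) P := by
    have hφ : Measurable fun (g : 𝒳 → ℝ) (i : Fin T) => g (A i) := by fun_prop
    have hψ : Measurable fun (e : ℕ → ℝ) (i : Fin T) => e i := by fun_prop
    have := hfε.comp hφ hψ
    exact this
  have hlaw : P.map (fun ω (i : Fin T) => ε i ω) =
      Measure.pi fun _ => gaussianReal 0 (σ ^ 2).toNNReal := by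
    have := (iIndepFun_iff_map_fun_eq_pi_map (fun i : Fin T => (hεm i).aemeasurable)).1
      (hε.indep.precomp Fin.val_injective)
    simp only [hε.law] at this
    exact this
  have hΨ' : Measurable fun p : (Fin T → ℝ) × (Fin T → ℝ) => Ψ (fun i => p.1 i + p.2 i, p.1) :=
    hΨ.comp (by fun_prop)
  have h1 := lintegral_map (μ := P) hΨ' (hF.prodMk hE)
  rw [(indepFun_iff_map_prod_eq_prod_map_map hF.aemeasurable hE.aemeasurable).1 hind,
    lintegral_prod _ hΨ'.aemeasurable, hlaw] at h1
  dsimp only at h1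
  refine h1.symm.trans (lintegral_congr fun v => ?_)
  have h2 := map_add_pi_gaussianReal v hv
  have hΨv : Measurable fun y => Ψ (y, v) := hΨ.comp measurable_prodMk_right
  have hLv : Measurable fun y : Fin T → ℝ => ∏ i, gaussianPDF (v i) (σ ^ 2).toNNReal (y i) :=
    Finset.measurable_fun_prod _ fun i _ =>
      (measurable_gaussianPDF _ _).comp (f := fun y : Fin T → ℝ => y i) (measurable_pi_apply i)
  have hadd : Measurable fun (e : Fin T → ℝ) i => v i + e i := by fun_prop
  have h3 := lintegral_map (μ := Measure.pi fun _ : Fin T => gaussianReal 0 (σ ^ 2).toNNReal)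
    hΨv hadd
  rw [h2] at h3
  rw [← h3, lintegral_withDensity_eq_lintegral_mul _ hLv hΨv]
  rfl

include h hσ hε hfε in
-- The joint law has density likelihood over evidence, L/Z, relative to the product of marginals.
-- Its logarithm is the stated sum, minus the noise squares and plus the innovation squares, each
-- divided by twice its variance; in expectation these two corrections cancel.
theorem CenteredGP.mutualInfo_eq (T : ℕ) :
    mutualInfo P (fun ω (i : Fin T) => f (A i) ω + ε i ω) (fun ω (i : Fin T) => f (A i) ω) =
      ENNReal.ofReal (∑ i ∈ Finset.range T, 1 / 2 * Real.log (1 + seqVar k σ A i / σ ^ 2)) := by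
  set V := (σ ^ 2).toNNReal with hVdef
  have hv : V ≠ 0 := (Real.toNNReal_pos.2 (by positivity)).ne'
  have hVpos : 0 < V := pos_iff_ne_zero.2 hv
  have hVr : (V : ℝ) = σ ^ 2 := Real.coe_toNNReal _ (sq_nonneg σ)
  have hεm := hε.measurable
  have hm := h.measurable
  set F : Ω → Fin T → ℝ := fun ω i => f (A i) ω with hFdef
  set Y : Ω → Fin T → ℝ := fun ω i => obs f ε A ω i with hYdef
  have hF : Measurable F := by fun_prop
  have hY : Measurable Y := by simp only [hYdef, obs]; fun_prop
  let τ : ℕ → ℝ≥0 := fun i => (seqVar k σ A i).toNNReal + V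
  have hs0 : ∀ i, 0 ≤ seqVar k σ A i := fun i => h.postVar_nonneg hσ _ _
  have hτ : ∀ i, τ i ≠ 0 := fun i => (add_pos_of_nonneg_of_pos zero_le hVpos).ne'
  have hτr : ∀ i, (τ i : ℝ) = seqVar k σ A i + σ ^ 2 := fun i => by
    simp only [τ, NNReal.coe_add, hVr, Real.coe_toNNReal _ (hs0 i)]
  let m : Fin T → (Fin T → ℝ) → ℝ := fun i y => postMean k σ (seqData A (zeroExt y) i) (A i)
  have hmm : ∀ i, Measurable (m i) := fun i => h.measurable_postMean_seqData hσ A i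
  let L : (Fin T → ℝ) × (Fin T → ℝ) → ℝ≥0∞ := fun q => ∏ i, gaussianPDF (q.2 i) V (q.1 i)
  let Z : (Fin T → ℝ) → ℝ≥0∞ := fun y => ∏ i, gaussianPDF (m i y) (τ i) (y i)
  have hL : Measurable L := Finset.measurable_fun_prod _ fun i _ =>
    (continuous_gaussianPDF V).measurable.comp
      (f := fun q : (Fin T → ℝ) × (Fin T → ℝ) => (q.2 i, q.1 i)) (by fun_prop)
  have hZ : Measurable Z := Finset.measurable_fun_prod _ fun i _ =>
    (continuous_gaussianPDF (τ i)).measurable.comp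
      (f := fun y : Fin T → ℝ => (m i y, y i)) ((hmm i).prodMk (by fun_prop))
  have hZtop : ∀ y, Z y ≠ ∞ := fun y => ENNReal.prod_ne_top fun i _ => ENNReal.ofReal_ne_top
  have hZ0 : ∀ y, Z y ≠ 0 := fun y => Finset.prod_ne_zero_iff.2 fun i _ =>
    (gaussianPDF_pos _ (hτ i) _).ne'
  have hLZ : ∀ y, ∫⁻ v, L (y, v) ∂P.map F = Z y := fun y => by
    rw [lintegral_map (f := fun v => L (y, v)) (hL.comp measurable_prodMk_left) hF]
    have h1 := h.lintegral_lik_seqData hσ A (zeroExt y) T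
    rw [Finset.prod_range] at h1
    simp only [zeroExt_val] at h1
    refine Eq.trans (lintegral_congr fun ω => ?_) h1
    rw [lik_def]
    simp only [seqData, zeroExt_val]
    rfl
  have hobs : ∀ {Ψ : (Fin T → ℝ) × (Fin T → ℝ) → ℝ≥0∞}, Measurable Ψ →
      ∫⁻ ω, Ψ (Y ω, F ω) ∂P = ∫⁻ v, ∫⁻ y, L (y, v) * Ψ (y, v) ∂volume ∂P.map F :=
    fun hΨ => h.lintegral_obs hσ hε hfε A hΨ
  have : IsProbabilityMeasure (P.map F) := Measure.isProbabilityMeasure_map hF.aemeasurable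
  have : IsProbabilityMeasure (P.map Y) := Measure.isProbabilityMeasure_map hY.aemeasurable
  have hPY : P.map Y = volume.withDensity Z := by
    refine Measure.ext_of_lintegral _ fun ψ hψ => ?_
    rw [lintegral_map hψ hY, hobs (Ψ := fun q => ψ q.1) (hψ.comp measurable_fst),
      lintegral_withDensity_eq_lintegral_mul _ hZ hψ, lintegral_lintegral_swap]
    · refine lintegral_congr fun y => ?_
      change ∫⁻ v, L (y, v) * ψ y ∂P.map F = Z y * ψ y
      rw [lintegral_mul_const _ (f := fun v => L (y, v)) (hL.comp measurable_prodMk_left), hLZ]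
    · exact ((hL.mul (hψ.comp measurable_fst)).comp measurable_swap).aemeasurable
  set J := P.map fun ω => (Y ω, F ω) with hJ
  set Q := (P.map Y).prod (P.map F) with hQ
  have : IsProbabilityMeasure J := Measure.isProbabilityMeasure_map (hY.prodMk hF).aemeasurable
  have hZf : Measurable fun q : (Fin T → ℝ) × (Fin T → ℝ) => Z q.1 := hZ.comp measurable_fst
  have hR : Measurable fun q : (Fin T → ℝ) × (Fin T → ℝ) => L q / Z q.1 :=
    hL.div hZf
  have hJQ : J = Q.withDensity fun q => L q / Z q.1 := by
    have h1 : Q = (volume.prod (P.map F)).withDensity fun q => Z q.1 := by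
      rw [hQ, hPY, prod_withDensity_left hZ]
    rw [h1, ← withDensity_mul _ hZf hR]
    refine Measure.ext_of_lintegral _ fun Ψ hΨ => ?_
    rw [hJ, lintegral_map hΨ (hY.prodMk hF), hobs hΨ,
      lintegral_withDensity_eq_lintegral_mul _ (hZf.mul hR) hΨ,
      lintegral_prod_symm _ (((hZf.mul hR).mul hΨ).aemeasurable)]
    refine lintegral_congr fun v => lintegral_congr fun y => ?_
    simp only [Pi.mul_apply]
    rw [ENNReal.mul_div_cancel (hZ0 y) (hZtop y)]
  have hac : J ≪ Q := hJQ ▸ withDensity_absolutelyContinuous _ _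
  let ell : (Fin T → ℝ) × (Fin T → ℝ) → ℝ := fun q => ∑ i : Fin T,
    (1 / 2 * Real.log (1 + seqVar k σ A i / σ ^ 2) - (q.1 i - q.2 i) ^ 2 / (2 * V) +
      (q.1 i - m i q.1) ^ 2 / (2 * τ i))
  have hell : Measurable ell := Finset.measurable_fun_sum _ fun i _ => by
    have := hmm i
    fun_prop
  have hpdf : ∀ (a : ℝ) (w : ℝ≥0) (x : ℝ), (gaussianPDF a w x).toReal = gaussianPDFReal a w x :=
    fun a w x => ENNReal.toReal_ofReal (gaussianPDFReal_nonneg _ _ _)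
  have hlog : ∀ q, Real.log (L q / Z q.1).toReal = ell q := fun q => by
    have p1 : ∀ i : Fin T, gaussianPDFReal (q.2 i) V (q.1 i) ≠ 0 := fun i =>
      (gaussianPDFReal_pos _ _ _ hv).ne'
    have p2 : ∀ i : Fin T, gaussianPDFReal (m i q.1) (τ i) (q.1 i) ≠ 0 := fun i =>
      (gaussianPDFReal_pos _ _ _ (hτ i)).ne'
    simp only [L, Z]
    rw [ENNReal.toReal_div, ENNReal.toReal_prod, ENNReal.toReal_prod]
    simp only [hpdf]
    rw [Real.log_div (Finset.prod_ne_zero_iff.2 fun i _ => p1 i)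
      (Finset.prod_ne_zero_iff.2 fun i _ => p2 i), Real.log_prod fun i _ => p1 i,
      Real.log_prod fun i _ => p2 i, ← Finset.sum_sub_distrib]
    refine Finset.sum_congr rfl fun i _ => ?_
    have hVp : (0 : ℝ) < V := hVpos
    have hτp : (0 : ℝ) < τ i := by exact_mod_cast pos_iff_ne_zero.2 (hτ i)
    have e1 : 1 + seqVar k σ A i / σ ^ 2 = (2 * Real.pi * τ i) / (2 * Real.pi * V) := by
      rw [hτr, hVr]
      field_simp
      ring
    rw [log_gaussianPDFReal _ hv, log_gaussianPDFReal _ (hτ i), e1,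
      Real.log_div (by positivity) (by positivity)]
    ring
  have hllr : llr J Q =ᵐ[J] ell := by
    have h1 : J.rnDeriv Q =ᵐ[Q] fun q => L q / Z q.1 := by
      rw [hJQ]
      exact Measure.rnDeriv_withDensity Q hR
    filter_upwards [hac.ae_le h1] with q hq
    rw [llr, hq, hlog]
  have hmY : ∀ (i : Fin T) ω, m i (Y ω) = postMean k σ (seqData A (obs f ε A ω) i) (A i) :=
    fun i ω => by
      simp only [m]
      rw [seqData_congr A (y := zeroExt (Y ω)) (y' := obs f ε A ω) fun j hj => ?_]
      exact zeroExt_val (Y ω) ⟨j, hj.trans i.2⟩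
  have hellω : ∀ ω, ell (Y ω, F ω) = ∑ i : Fin T,
      (1 / 2 * Real.log (1 + seqVar k σ A i / σ ^ 2) - ε i ω ^ 2 / (2 * V) +
        (obs f ε A ω i - postMean k σ (seqData A (obs f ε A ω) i) (A i)) ^ 2 / (2 * τ i)) :=
    fun ω => Finset.sum_congr rfl fun i _ => by
      simp only [hmY]
      simp [hYdef, hFdef, obs]
  have hεI : ∀ i, Integrable (fun ω => ε i ω ^ 2) P := fun i => by
    have : HasGaussianLaw (ε i) P := ⟨by rw [hε.law]; infer_instance⟩
    exact this.memLp_two.integrable_sq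
  have hI1 : ∀ i : Fin T, Integrable (fun ω => 1 / 2 * Real.log (1 + seqVar k σ A i / σ ^ 2) -
      ε i ω ^ 2 / (2 * V)) P := fun i => (integrable_const _).sub ((hεI i).div_const _)
  have hI2 : ∀ i : Fin T, Integrable (fun ω => (obs f ε A ω i -
      postMean k σ (seqData A (obs f ε A ω) i) (A i)) ^ 2 / (2 * τ i)) P := fun i =>
    (h.integral_innovation hσ hε hfε A i).1.div_const _
  have hI12 : ∀ i : Fin T, Integrable (fun ω => 1 / 2 * Real.log (1 + seqVar k σ A i / σ ^ 2) -
      ε i ω ^ 2 / (2 * V) + (obs f ε A ω i - postMean k σ (seqData A (obs f ε A ω) i) (A i)) ^ 2 /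
        (2 * τ i)) P := fun i => (hI1 i).add (hI2 i)
  have hellI : Integrable (fun ω => ell (Y ω, F ω)) P := by
    simp_rw [hellω]
    exact integrable_finsetSum _ fun i _ => hI12 i
  have hellint : ∫ ω, ell (Y ω, F ω) ∂P =
      ∑ i : Fin T, 1 / 2 * Real.log (1 + seqVar k σ A i / σ ^ 2) := by
    simp_rw [hellω]
    rw [integral_finsetSum _ fun i _ => hI12 i]
    refine Finset.sum_congr rfl fun i _ => ?_
    have hVp : (0 : ℝ) < V := hVpos
    have hτp : (0 : ℝ) < τ i := by exact_mod_cast pos_iff_ne_zero.2 (hτ i)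
    rw [integral_add (hI1 i) (hI2 i), integral_sub (integrable_const _) ((hεI i).div_const _),
      integral_div, integral_div, (h.integral_innovation hσ hε hfε A i).2,
      integral_sq_gaussian (hεm i) (hε.law i), ← hτr, integral_const, probReal_univ, one_smul]
    field_simp
    ring
  have hJint : Integrable (llr J Q) J := by
    rw [integrable_congr hllr, hJ, integrable_map_measure hell.aestronglyMeasurable
      (hY.prodMk hF).aemeasurable]
    exact hellI
  change klDiv J Q = _
  rw [klDiv_of_ac_of_integrable hac hJint, integral_congr_ae hllr, hJ,
    integral_map (hY.prodMk hF).aemeasurable hell.aestronglyMeasurable, hellint,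
    Finset.sum_range, ← hJ]
  simp

/-- Bernoulli's inequality (1 + σ⁻²)^v ≤ 1 + vσ⁻² for 0 ≤ v ≤ 1, after taking logarithms. -/
theorem le_log_ratio {v : ℝ} (hσ : 0 < σ) (h0 : 0 ≤ v) (h1 : v ≤ 1) :
    v ≤ C₁ σ * (1 / 2 * Real.log (1 + v / σ ^ 2)) := by
  have ha : 0 < (σ ^ 2)⁻¹ := by positivity
  have hlog : 0 < Real.log (1 + (σ ^ 2)⁻¹) := Real.log_pos (by linarith)
  have h2 := rpow_one_add_le_one_add_mul_self (s := (σ ^ 2)⁻¹) (by linarith) h0 h1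
  have h3 := Real.log_le_log (by positivity) h2
  rw [Real.log_rpow (by linarith), ← div_eq_mul_inv] at h3
  rw [C₁, show 2 / Real.log (1 + (σ ^ 2)⁻¹) * (1 / 2 * Real.log (1 + v / σ ^ 2)) =
    Real.log (1 + v / σ ^ 2) / Real.log (1 + (σ ^ 2)⁻¹) by ring, le_div_iff₀ hlog]
  exact h3

include h hσ hε hfε in
theorem CenteredGP.sum_seqVar_le (hk : ∀ x, k x x ≤ 1) (T : ℕ) :
    ∑ t ∈ Finset.range T, seqVar k σ A t ≤ C₁ σ * (⨆ B : Fin T → 𝒳, mutualInfo P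
      (fun ω i => f (B i) ω + ε i ω) (fun ω i => f (B i) ω)).toReal := by
  have hs0 : ∀ (A : ℕ → 𝒳) i, 0 ≤ seqVar k σ A i := fun A i => h.postVar_nonneg hσ _ _
  have hs1 : ∀ (A : ℕ → 𝒳) i, seqVar k σ A i ≤ 1 := fun A i =>
    (h.postVar_le hσ _ _).trans (hk _)
  have hC : 0 ≤ C₁ σ := div_nonneg zero_le_two (Real.log_nonneg (by
    have : 0 < (σ ^ 2)⁻¹ := by positivity
    linarith))
  have hnn : ∀ (A : ℕ → 𝒳) i, 0 ≤ 1 / 2 * Real.log (1 + seqVar k σ A i / σ ^ 2) := fun A i =>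
    mul_nonneg (by norm_num) (Real.log_nonneg (by
      have := div_nonneg (hs0 A i) (sq_nonneg σ); linarith))
  have hle : ∑ t ∈ Finset.range T, 1 / 2 * Real.log (1 + seqVar k σ A t / σ ^ 2) ≤
      (⨆ B : Fin T → 𝒳, mutualInfo P
        (fun ω i => f (B i) ω + ε i ω) (fun ω i => f (B i) ω)).toReal := by
    refine (ENNReal.ofReal_le_iff_le_toReal ?_).1 ?_
    -- The supremum must be finite, since `toReal` would send ∞ to 0; variances at most 1 give a
    -- bound uniform in the inputs.
    · refine ne_top_of_le_ne_top (ENNReal.ofReal_ne_top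
        (r := ∑ t ∈ Finset.range T, 1 / 2 * Real.log (1 + 1 / σ ^ 2))) (iSup_le fun B => ?_)
      let B' : ℕ → 𝒳 := fun i => if hi : i < T then B ⟨i, hi⟩ else A i
      have hB : ∀ i : Fin T, B' i = B i := fun i => by simp [B']
      have := h.mutualInfo_eq hσ hε hfε B' T
      simp only [hB] at this
      rw [this]
      refine ENNReal.ofReal_le_ofReal (Finset.sum_le_sum fun i _ => ?_)
      have h1 := div_nonneg (hs0 B' i) (sq_nonneg σ)
      have h2 := hs1 B' i
      gcongr
    · rw [← h.mutualInfo_eq hσ hε hfε A T]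
      exact le_iSup (fun B : Fin T → 𝒳 => mutualInfo P (fun ω i => f (B i) ω + ε i ω)
        (fun ω i => f (B i) ω)) fun i => A i
  refine le_trans ?_ (mul_le_mul_of_nonneg_left hle hC)
  rw [Finset.mul_sum]
  exact Finset.sum_le_sum fun t _ => le_log_ratio hσ (hs0 A t) (hs1 A t)

end Information

-- Mean regret for frozen confidence parameters.

section MeanRegret

/-- On each outcome the queries form a plain sequence of inputs, and posterior variances ignore the
observed values. Bounds for fixed designs therefore hold on every trajectory. -/
theorem dataset_eq_seqData {𝒳 : Type*} (sel : ∀ t : ℕ, (Fin t → 𝒳 × ℝ) → ℝ → 𝒳) (g : 𝒳 → ℝ)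
    (e z : ℕ → ℝ) (t : ℕ) : dataset sel g e z t =
      seqData (query sel g e z) (fun i => g (query sel g e z i) + e i) t := by
  induction t with
  | zero => exact Subsingleton.elim _ _
  | succ t ih => rw [seqData_succ, ← ih]; rfl

variable {𝒳 Ω S : Type*} [MeasurableSpace 𝒳] [MeasurableSpace Ω] [MeasurableSpace S]

/-- The regret in round `t`. -/
def roundRegret (f : 𝒳 → S → ℝ) (ε : ℕ → Ω → ℝ) (sel : ∀ t : ℕ, (Fin t → 𝒳 × ℝ) → ℝ → 𝒳)
    (z : ℕ → ℝ) (t : ℕ) (p : S × Ω) : ℝ :=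
  (⨆ x, f x p.1) - f (sel t (dat sel f ε z t p) (z t)) p.1

variable {μ : Measure S} [IsProbabilityMeasure μ] {ν : Measure Ω} [IsProbabilityMeasure ν]
  {k : 𝒳 → 𝒳 → ℝ} {σ : ℝ} {f : 𝒳 → S → ℝ} {ε : ℕ → Ω → ℝ}
  {sel : ∀ t : ℕ, (Fin t → 𝒳 × ℝ) → ℝ → 𝒳} {Φ : S → ℝ}

namespace IsBandit

variable (h : IsBandit μ ν k σ f ε sel Φ) [Nonempty 𝒳] (hsup : Measurable fun s => ⨆ x, f x s)
include h

theorem bddAbove (s : S) : BddAbove (range fun x => f x s) :=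
  ⟨Φ s, by rintro _ ⟨x, rfl⟩; exact (le_abs_self _).trans (h.abs_le_bound x s)⟩

include hsup in
theorem integrable_sup : Integrable (fun s => ⨆ x, f x s) μ := by
  refine h.integrable_bound.mono' hsup.aestronglyMeasurable (.of_forall fun s => ?_)
  rw [Real.norm_eq_abs, abs_le]
  obtain ⟨x⟩ := ‹Nonempty 𝒳›
  exact ⟨(neg_le_of_abs_le (h.abs_le_bound x s)).trans (le_ciSup (h.bddAbove s) x),
    ciSup_le fun x => (le_abs_self _).trans (h.abs_le_bound _ _)⟩

include hsup in
theorem integrable_roundRegret (z : ℕ → ℝ) (t : ℕ) :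
    Integrable (roundRegret f ε sel z t) (μ.prod ν) := by
  have hξ : Measurable fun D : Fin t → 𝒳 × ℝ => sel t D (z t) :=
    (h.measurable_sel t).comp (measurable_id.prodMk measurable_const)
  exact ((h.integrable_sup hsup).comp_fst ν).sub (h.integrable_eval hξ z)

include hsup in
theorem integral_roundRegret (z : ℕ → ℝ) (t : ℕ) :
    ∫ p, roundRegret f ε sel z t p ∂(μ.prod ν) = ∫ s, (⨆ x, f x s) ∂μ -
      ∫ p, f (sel t (dat sel f ε z t p) (z t)) p.1 ∂(μ.prod ν) := by
  have hξ : Measurable fun D : Fin t → 𝒳 × ℝ => sel t D (z t) :=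
    (h.measurable_sel t).comp (measurable_id.prodMk measurable_const)
  have h1 := integral_sub ((h.integrable_sup hsup).comp_fst ν) (h.integrable_eval hξ z)
  rw [integral_fun_fst (μ := μ) (ν := ν) fun s => ⨆ x, f x s] at h1
  simpa [roundRegret] using h1

theorem integrable_sqrt_postVar (z : ℕ → ℝ) (t : ℕ) :
    Integrable (fun p => √(postVar k σ (dat sel f ε z t p)
      (sel t (dat sel f ε z t p) (z t)))) (μ.prod ν) := by
  have hξ : Measurable fun D : Fin t → 𝒳 × ℝ => sel t D (z t) :=
    (h.measurable_sel t).comp (measurable_id.prodMk measurable_const)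
  refine Integrable.of_bound ?_ 1 (.of_forall fun p => ?_)
  · exact (Real.continuous_sqrt.measurable.comp (((measurable_postVar h.measurable_kernel σ).comp
      (measurable_id.prodMk hξ)).comp (h.measurable_dat z))).aestronglyMeasurable
  · rw [Real.norm_of_nonneg (Real.sqrt_nonneg _)]
    exact h.sqrt_postVar_le_one _ _

/-- Cauchy–Schwarz is applied on each trajectory before integrating, where the variance sum is at
most `Γ`. -/
theorem sum_sqrt_postVar_le {T : ℕ} {Γ : ℝ}
    (hΓ : ∀ A : ℕ → 𝒳, ∑ t ∈ Finset.range T, seqVar k σ A t ≤ Γ) (z : ℕ → ℝ) (m : ℕ)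
    (hz : ∀ t, m ≤ t → 0 ≤ z t) :
    ∑ t ∈ Finset.Ico m T, √(z t) * ∫ p, √(postVar k σ (dat sel f ε z t p)
      (sel t (dat sel f ε z t p) (z t))) ∂(μ.prod ν) ≤ √(Γ * ∑ t ∈ Finset.Ico m T, z t) := by
  have hI := h.integrable_sqrt_postVar z
  simp_rw [← integral_const_mul]
  rw [← integral_finsetSum _ fun t _ => (hI t).const_mul _]
  have hpt : ∀ p : S × Ω, ∑ t ∈ Finset.Ico m T, √(z t) * √(postVar k σ (dat sel f ε z t p)
      (sel t (dat sel f ε z t p) (z t))) ≤ √(Γ * ∑ t ∈ Finset.Ico m T, z t) := by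
    intro p
    set A : ℕ → 𝒳 := query sel (f · p.1) (fun i => ε i p.2) z with hA
    have hV : ∀ t, postVar k σ (dat sel f ε z t p) (sel t (dat sel f ε z t p) (z t)) =
        seqVar k σ A t := fun t => by
      rw [← postVar_seqData A (fun i => f (A i) p.1 + ε i p.2), ← dataset_eq_seqData]
      rfl
    simp only [hV]
    have hV0 : ∀ t, 0 ≤ seqVar k σ A t := fun t => h.gp.postVar_nonneg h.sigma_pos _ _
    have hsumz : 0 ≤ ∑ t ∈ Finset.Ico m T, z t :=
      Finset.sum_nonneg fun t ht => hz t (Finset.mem_Ico.1 ht).1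
    have h1 : ∑ t ∈ Finset.Ico m T, seqVar k σ A t ≤ Γ :=
      (Finset.sum_le_sum_of_subset_of_nonneg (fun t ht => Finset.mem_range.2
        (Finset.mem_Ico.1 ht).2) fun t _ _ => hV0 t).trans (hΓ A)
    -- Truncation at 0 supplies nonnegativity at all indices, including those below `m` where z may
    -- be negative.
    have hz' : ∀ t ∈ Finset.Ico m T, √(z t) * √(seqVar k σ A t) =
        √(max (z t) 0) * √(seqVar k σ A t) := fun t ht => by
      rw [max_eq_left (hz t (Finset.mem_Ico.1 ht).1)]
    rw [Finset.sum_congr rfl hz']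
    refine (Real.sum_sqrt_mul_sqrt_le _ (fun t => le_max_right _ _) hV0).trans ?_
    rw [← Real.sqrt_mul (Finset.sum_nonneg fun t _ => le_max_right _ _), mul_comm]
    refine Real.sqrt_le_sqrt ?_
    rw [Finset.sum_congr rfl fun t ht => max_eq_left (hz t (Finset.mem_Ico.1 ht).1)]
    exact mul_le_mul_of_nonneg_right h1 hsumz
  refine (integral_mono (integrable_finsetSum _ fun t _ => (hI t).const_mul _)
    (integrable_const _) hpt).trans ?_
  simp

include hsup in
-- Rounds before `m` are charged the mean oscillation; from `m` on, the grid maximum is compared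
-- with the mean maximal bound and `integral_query` gives the rest.
theorem integral_sum_roundRegret_le {T : ℕ} {Γ : ℝ}
    (hΓ : ∀ A : ℕ → 𝒳, ∑ t ∈ Finset.range T, seqVar k σ A t ≤ Γ) {m : ℕ} {b₀ : ℝ}
    {osc : S → ℝ} (hosc : Integrable osc μ) (hosc_le : ∀ x y s, f x s - f y s ≤ osc s)
    (hb₀ : ∫ s, osc s ∂μ ≤ b₀) {s : ℕ → ℝ}
    (hgrid : ∀ t, m ≤ t → ∃ (ι : Type) (_ : Fintype ι) (_ : Nonempty ι) (G : ι → 𝒳),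
      (Fintype.card ι : ℝ) ≤ 2 * Real.exp (s (t + 1) / 2) ∧
      ∫ ω, (⨆ x, f x ω) ∂μ ≤ ∫ ω, (⨆ i, f (G i) ω) ∂μ + 1 / ((t : ℝ) + 1) ^ 2)
    {z : ℕ → ℝ} (hz : ∀ t, m ≤ t → 0 ≤ z t) :
    ∫ p, ∑ t ∈ Finset.range T, roundRegret f ε sel z t p ∂(μ.prod ν) ≤
      (min m T : ℕ) * b₀ + ∑ t ∈ Finset.Ico m T, 1 / ((t : ℝ) + 1) ^ 2 +
      ∑ t ∈ Finset.Ico m T, (∫ β, meanUcb μ ν k σ f ε sel t z β ∂shiftedExp (s (t + 1)) (1 / 2) -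
        meanUcb μ ν k σ f ε sel t z (z t)) + √(Γ * ∑ t ∈ Finset.Ico m T, z t) := by
  rw [integral_finsetSum _ fun t _ => h.integrable_roundRegret hsup z t,
    ← Finset.sum_range_add_sum_Ico _ (min_le_right m T)]
  have hIco : Finset.Ico (min m T) T = Finset.Ico m T := by
    rcases le_total m T with hm | hm
    · rw [min_eq_left hm]
    · rw [min_eq_right hm, Finset.Ico_self, Finset.Ico_eq_empty (by omega)]
  rw [hIco]
  have hbad : ∑ t ∈ Finset.range (min m T), ∫ p, roundRegret f ε sel z t p ∂(μ.prod ν) ≤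
      (min m T : ℕ) * b₀ := by
    rw [← nsmul_eq_mul]
    refine (Finset.sum_le_card_nsmul _ _ b₀ fun t _ => ?_).trans_eq (by rw [Finset.card_range])
    refine (integral_mono (h.integrable_roundRegret hsup z t) (hosc.comp_fst ν) fun p => ?_).trans
      ((integral_fun_fst (μ := μ) (ν := ν) osc).trans_le (by simpa using hb₀))
    rw [roundRegret, sub_le_iff_le_add]
    exact ciSup_le fun x => by
      have := hosc_le x (sel t (dat sel f ε z t p) (z t)) p.1
      linarith
  have hgood : ∑ t ∈ Finset.Ico m T, ∫ p, roundRegret f ε sel z t p ∂(μ.prod ν) ≤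
      ∑ t ∈ Finset.Ico m T, (1 / ((t : ℝ) + 1) ^ 2 +
        (∫ β, meanUcb μ ν k σ f ε sel t z β ∂shiftedExp (s (t + 1)) (1 / 2) -
          meanUcb μ ν k σ f ε sel t z (z t)) + √(z t) * ∫ p, √(postVar k σ (dat sel f ε z t p)
      (sel t (dat sel f ε z t p) (z t))) ∂(μ.prod ν)) := by
    refine Finset.sum_le_sum fun t ht => ?_
    obtain ⟨ι, _, _, G, hcard, hG⟩ := hgrid t (Finset.mem_Ico.1 ht).1
    have h1 := h.integral_max_le (t := t) G hcard z
    rw [h.integral_roundRegret hsup, h.integral_query]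
    linarith
  rw [Finset.sum_add_distrib, Finset.sum_add_distrib] at hgood
  have := h.sum_sqrt_postVar_le hΓ z m hz
  linarith

end IsBandit
end MeanRegret

-- Conditional expectation by freezing an independent variable.

section CondExp

theorem condExp_comap_of_indepFun {Ω α β : Type*} [MeasurableSpace Ω] [MeasurableSpace α]
    [MeasurableSpace β] {P : Measure Ω} [IsProbabilityMeasure P] {U : Ω → α} {Z : Ω → β}
    (hU : Measurable U) (hZ : Measurable Z) (hUZ : IndepFun U Z P) {R : α × β → ℝ}
    (hR : Measurable R) (hRI : Integrable (fun ω => R (U ω, Z ω)) P) :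
    P[fun ω => R (U ω, Z ω) | MeasurableSpace.comap Z inferInstance] =ᵐ[P]
      fun ω => ∫ u, R (u, Z ω) ∂P.map U := by
  have : IsProbabilityMeasure (P.map U) := Measure.isProbabilityMeasure_map hU.aemeasurable
  have : IsProbabilityMeasure (P.map Z) := Measure.isProbabilityMeasure_map hZ.aemeasurable
  have hprod := (indepFun_iff_map_prod_eq_prod_map_map hU.aemeasurable hZ.aemeasurable).1 hUZ
  have hRI' : Integrable R ((P.map U).prod (P.map Z)) := by
    rw [← hprod, integrable_map_measure hR.aestronglyMeasurable (hU.prodMk hZ).aemeasurable]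
    exact hRI
  have hrm : StronglyMeasurable fun z => ∫ u, R (u, z) ∂P.map U :=
    StronglyMeasurable.integral_prod_left' hR.stronglyMeasurable
  have hrI : Integrable (fun z => ∫ u, R (u, z) ∂P.map U) (P.map Z) := hRI'.integral_prod_right
  have hrI' : Integrable (fun ω => ∫ u, R (u, Z ω) ∂P.map U) P :=
    (integrable_map_measure hrm.aestronglyMeasurable hZ.aemeasurable).1 hrI
  refine (ae_eq_condExp_of_forall_setIntegral_eq hZ.comap_le hRI
    (fun s _ _ => hrI'.integrableOn) ?_ ?_).symm
  · rintro _ ⟨B, hB, rfl⟩ -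
    have hB' : MeasurableSet (Z ⁻¹' B) := hZ hB
    rw [← integral_indicator hB', ← integral_indicator hB']
    have e1 : ∫ ω, (Z ⁻¹' B).indicator (fun ω => R (U ω, Z ω)) ω ∂P =
        ∫ q, (Prod.snd ⁻¹' B).indicator R q ∂(P.map U).prod (P.map Z) := by
      rw [← hprod, integral_map (hU.prodMk hZ).aemeasurable
        (hR.indicator (measurable_snd hB)).aestronglyMeasurable]
      rfl
    have e2 : ∫ ω, (Z ⁻¹' B).indicator (fun ω => ∫ u, R (u, Z ω) ∂P.map U) ω ∂P =
        ∫ z, B.indicator (fun z => ∫ u, R (u, z) ∂P.map U) z ∂P.map Z := by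
      rw [integral_map hZ.aemeasurable (hrm.indicator hB).aestronglyMeasurable]
      rfl
    rw [e1, e2, integral_prod_symm _ (hRI'.indicator (measurable_snd hB))]
    refine integral_congr_ae (.of_forall fun z => ?_)
    by_cases hz : z ∈ B
    · simp [hz, indicator]
    · simp [hz, indicator]
  · exact (hrm.comp_measurable (comap_measurable Z)).aestronglyMeasurable

end CondExp

-- The space of Lipschitz paths.

section LipPath

/-- Lipschitz paths on a metric space. -/
abbrev LipPath (E : Type*) [PseudoMetricSpace E] := {g : E → ℝ // ∃ K, LipschitzWith K g}

variable {E : Type*} [MetricSpace E] [SecondCountableTopology E] [Nonempty E]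

/-- The least Lipschitz constant of a path. -/
def lipConst (g : LipPath E) : ℝ :=
  ⨆ p : ℕ × ℕ, |g.1 (denseSeq E p.1) - g.1 (denseSeq E p.2)| /
    dist (denseSeq E p.1) (denseSeq E p.2)

theorem measurable_eval_path (x : E) : Measurable fun g : LipPath E => g.1 x :=
  (measurable_pi_apply x).comp measurable_subtype_coe

theorem measurable_lipConst : Measurable (lipConst : LipPath E → ℝ) := by
  unfold lipConst
  refine Measurable.iSup fun p => ?_
  have h1 := measurable_eval_path (denseSeq E p.1)
  have h2 := measurable_eval_path (denseSeq E p.2)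
  exact (continuous_abs.measurable.comp (h1.sub h2)).div_const _

theorem quotient_le {g : LipPath E} {C : ℝ} (hC : 0 ≤ C)
    (h : ∀ x y, |g.1 x - g.1 y| ≤ C * dist x y) (x y : E) :
    |g.1 x - g.1 y| / dist x y ≤ C := by
  rcases eq_or_ne (dist x y) 0 with h0 | h0
  · simp [h0, hC]
  · rw [div_le_iff₀ (lt_of_le_of_ne dist_nonneg h0.symm)]
    exact h x y

theorem lipConst_le {g : LipPath E} {C : ℝ} (hC : 0 ≤ C)
    (h : ∀ x y, |g.1 x - g.1 y| ≤ C * dist x y) : lipConst g ≤ C :=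
  ciSup_le fun _ => quotient_le hC h _ _

theorem lipConst_nonneg (g : LipPath E) : 0 ≤ lipConst g :=
  Real.iSup_nonneg fun _ => div_nonneg (abs_nonneg _) dist_nonneg

theorem LipPath.continuous (g : LipPath E) : Continuous g.1 :=
  g.2.choose_spec.continuous

/-- On the dense sequence this is the definition, the supremum being bounded because some Lipschitz
constant exists; the inequality is closed in (x, y). -/
theorem abs_sub_le_lipConst (g : LipPath E) (x y : E) :
    |g.1 x - g.1 y| ≤ lipConst g * dist x y := by
  obtain ⟨K, hK⟩ := g.2
  have hbdd : BddAbove (range fun p : ℕ × ℕ => |g.1 (denseSeq E p.1) - g.1 (denseSeq E p.2)| /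
      dist (denseSeq E p.1) (denseSeq E p.2)) := by
    refine ⟨K, ?_⟩
    rintro _ ⟨p, rfl⟩
    exact quotient_le K.2 (fun x y => by simpa [Real.dist_eq] using hK.dist_le_mul x y) _ _
  have hclosed : IsClosed {p : E × E | |g.1 p.1 - g.1 p.2| ≤ lipConst g * dist p.1 p.2} := by
    have hg := g.continuous
    refine isClosed_le ?_ ?_
    · exact continuous_abs.comp ((hg.comp continuous_fst).sub (hg.comp continuous_snd))
    · fun_prop
  have hdense : DenseRange (Prod.map (denseSeq E) (denseSeq E)) :=
    (denseRange_denseSeq E).prodMap (denseRange_denseSeq E)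
  refine hdense.induction_on (p := fun q : E × E =>
    |g.1 q.1 - g.1 q.2| ≤ lipConst g * dist q.1 q.2) (x, y) hclosed fun p => ?_
  simp only [Prod.map]
  rcases eq_or_ne (dist (denseSeq E p.1) (denseSeq E p.2)) 0 with h0 | h0
  · rw [dist_eq_zero.1 h0]
    simp
  · rw [← div_le_iff₀ (lt_of_le_of_ne dist_nonneg h0.symm)]
    exact le_ciSup hbdd p

theorem bddAbove_path [CompactSpace E] (g : LipPath E) : BddAbove (range g.1) :=
  (isCompact_range g.continuous).bddAbove

theorem measurable_iSup_path [CompactSpace E] : Measurable fun g : LipPath E => ⨆ x, g.1 x := by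
  have h1 : (fun g : LipPath E => ⨆ x, g.1 x) = fun g => ⨆ n, g.1 (denseSeq E n) := by
    ext g
    have hb : BddAbove (range fun n => g.1 (denseSeq E n)) :=
      (bddAbove_path g).mono (range_comp_subset_range _ g.1)
    refine le_antisymm (ciSup_le fun x => ?_) (ciSup_le fun n => le_ciSup (bddAbove_path g) _)
    exact (denseRange_denseSeq E).induction_on (p := fun x => g.1 x ≤ ⨆ n, g.1 (denseSeq E n)) x
      (isClosed_le g.continuous continuous_const) fun n => le_ciSup hb n
  rw [h1]
  exact .iSup fun n => measurable_eval_path _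

theorem measurable_uncurry_path [MeasurableSpace E] [BorelSpace E] :
    Measurable (Function.uncurry fun (x : E) (g : LipPath E) => g.1 x) :=
  measurable_uncurry_of_continuous_of_measurable (fun g => LipPath.continuous g)
    measurable_eval_path

end LipPath

theorem CenteredGP.map {𝒳 Ω S : Type*} [MeasurableSpace Ω] [MeasurableSpace S] {P : Measure Ω}
    {k : 𝒳 → 𝒳 → ℝ} {f : 𝒳 → Ω → ℝ} (h : CenteredGP P k f) {Ψ : Ω → S} (hΨ : Measurable Ψ)
    {f' : 𝒳 → S → ℝ} (hf' : ∀ x, Measurable (f' x)) (hae : ∀ x, (fun ω => f' x (Ψ ω)) =ᵐ[P] f x) :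
    CenteredGP (P.map Ψ) k f' := by
  refine ⟨hf', ⟨fun I => ⟨?_⟩⟩, fun x => ?_, fun x y => ?_⟩
  · have := (h.isGaussian.hasGaussianLaw I).isGaussian_map
    rw [Measure.map_map (by fun_prop) hΨ]
    refine (congrArg IsGaussian (Measure.map_congr ?_)).mpr this
    filter_upwards [ae_all_iff.2 fun i : I => hae i] with ω hω
    ext i
    exact hω i
  · rw [integral_map hΨ.aemeasurable (hf' x).aestronglyMeasurable, ← h.mean_zero x]
    exact integral_congr_ae (hae x)
  · rw [covariance_map_fun (hf' x).aestronglyMeasurable (hf' y).aestronglyMeasurable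
      hΨ.aemeasurable, ← h.cov_eq x y]
    simp only [covariance, integral_congr_ae (hae x), integral_congr_ae (hae y)]
    refine integral_congr_ae ?_
    filter_upwards [hae x, hae y] with ω h1 h2
    rw [h1, h2]

-- Expectation from a Gaussian tail.

section TailIntegral

/-- At the lower limit L₀ the integrand is at most 1, and (u + L₀)² ≥ u² + L₀² reduces the rest to a
half Gaussian integral. -/
theorem lintegral_gaussian_shift_le {A b : ℝ} (hA : 0 < A) (hb : 0 < b) :
    ∫⁻ L in Ioi (b * √(Real.log A)), ENNReal.ofReal (A * Real.exp (-(L / b) ^ 2)) ≤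
      ENNReal.ofReal (b * (√Real.pi / 2)) := by
  set L₀ := b * √(Real.log A) with hL₀
  have hL0 : 0 ≤ L₀ := by positivity
  rw [← lintegral_indicator measurableSet_Ioi, ← lintegral_add_right_eq_self _ L₀]
  have hpt : ∀ u, (Ioi L₀).indicator (fun L => ENNReal.ofReal (A * Real.exp (-(L / b) ^ 2)))
      (u + L₀) ≤ (Ioi 0).indicator
        (fun u => ENNReal.ofReal (Real.exp (-(1 / b ^ 2) * u ^ 2))) u := by
    intro u
    by_cases hu : 0 < u
    · rw [indicator_of_mem (by simpa using hu), indicator_of_mem (by simpa using hu)]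
      refine ENNReal.ofReal_le_ofReal ?_
      have h1 : A ≤ Real.exp ((L₀ / b) ^ 2) := by
        rw [hL₀, mul_div_cancel_left₀ _ hb.ne']
        rcases le_total 0 (Real.log A) with h | h
        · rw [Real.sq_sqrt h, Real.exp_log hA]
        -- For A ≤ 1 the square root is 0, hence L₀ = 0, and A ≤ 1 is what is needed.
        · rw [Real.sqrt_eq_zero_of_nonpos h]
          simpa using (Real.log_nonpos_iff hA.le).1 h
      refine (mul_le_mul_of_nonneg_right h1 (Real.exp_nonneg _)).trans ?_
      rw [← Real.exp_add, Real.exp_le_exp]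
      have h2 : (L₀ / b) ^ 2 + -((u + L₀) / b) ^ 2 =
        -(1 / b ^ 2) * u ^ 2 - 2 * (u * L₀) / b ^ 2 := by field_simp; ring
      rw [h2]
      have : 0 ≤ 2 * (u * L₀) / b ^ 2 := by positivity
      linarith
    · rw [indicator_of_notMem (by simpa using hu)]
      exact zero_le
  refine (lintegral_mono hpt).trans ?_
  rw [lintegral_indicator measurableSet_Ioi, ← ofReal_integral_eq_lintegral_ofReal
    (integrable_exp_neg_mul_sq (by positivity)).integrableOn (.of_forall fun _ => Real.exp_nonneg _),
    integral_gaussian_Ioi]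
  refine ENNReal.ofReal_le_ofReal (le_of_eq ?_)
  rw [div_div_eq_mul_div, div_one, Real.sqrt_mul Real.pi_pos.le, Real.sqrt_sq hb.le]
  ring

theorem integral_le_of_gaussian_tail {Ω : Type*} [MeasurableSpace Ω] {P : Measure Ω}
    [IsProbabilityMeasure P] {Y : Ω → ℝ} (hY : Measurable Y) (h0 : ∀ ω, 0 ≤ Y ω) {A b : ℝ}
    (hA : 0 < A) (hb : 0 < b)
    (h : ∀ L, 0 < L → P {ω | L < Y ω} ≤ ENNReal.ofReal (A * Real.exp (-(L / b) ^ 2))) :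
    Integrable Y P ∧ ∫ ω, Y ω ∂P ≤ b * (√(Real.log A) + √Real.pi / 2) := by
  set L₀ := b * √(Real.log A) with hL₀
  have hL0 : 0 ≤ L₀ := by positivity
  have key : ∫⁻ ω, ENNReal.ofReal (Y ω) ∂P ≤
      ENNReal.ofReal (b * (√(Real.log A) + √Real.pi / 2)) := by
    rw [lintegral_eq_lintegral_meas_lt P (.of_forall h0) hY.aemeasurable,
      ← Ioc_union_Ioi_eq_Ioi hL0, lintegral_union measurableSet_Ioi Ioc_disjoint_Ioi_same, mul_add,
      ENNReal.ofReal_add hL0 (by positivity)]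
    refine add_le_add ?_ (le_trans (setLIntegral_mono' measurableSet_Ioi fun L hL =>
      h L (hL0.trans_lt hL)) (lintegral_gaussian_shift_le hA hb))
    calc ∫⁻ L in Ioc 0 L₀, P {ω | L < Y ω} ≤ ∫⁻ _ in Ioc 0 L₀, 1 :=
          lintegral_mono fun _ => prob_le_one
      _ = ENNReal.ofReal L₀ := by simp
  refine ⟨⟨hY.aestronglyMeasurable, ?_⟩, ?_⟩
  · refine lt_of_le_of_lt (le_of_eq (lintegral_congr fun ω => ?_)) (key.trans_lt
      ENNReal.ofReal_lt_top)
    rw [Real.enorm_eq_ofReal (h0 ω)]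
  · rw [integral_eq_lintegral_of_nonneg_ae (.of_forall h0) hY.aestronglyMeasurable]
    exact ENNReal.toReal_le_of_le_ofReal (by positivity) key

end TailIntegral

-- Gradients and grids in Euclidean space.

section Euclidean

variable {d : ℕ} {X : Set (EuclideanSpace ℝ (Fin d))}

theorem norm_le_sqrt_mul {v : EuclideanSpace ℝ (Fin d)} {C : ℝ} (hC : 0 ≤ C)
    (h : ∀ j, |v j| ≤ C) : ‖v‖ ≤ √d * C := by
  rw [EuclideanSpace.norm_eq]
  refine (Real.sqrt_le_sqrt (Finset.sum_le_sum fun j _ =>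
    pow_le_pow_left₀ (norm_nonneg _) (h j) 2)).trans ?_
  rw [Finset.sum_const, Finset.card_univ, Fintype.card_fin, nsmul_eq_mul,
    Real.sqrt_mul (Nat.cast_nonneg d), Real.sqrt_sq hC]

theorem abs_sub_le_of_gradient (hX : Convex ℝ X) {g : EuclideanSpace ℝ (Fin d) → ℝ}
    {G : EuclideanSpace ℝ (Fin d) → EuclideanSpace ℝ (Fin d)}
    (hG : ∀ x ∈ X, HasGradientWithinAt g (G x) X x) {C : ℝ} (hC : 0 ≤ C)
    (hGC : ∀ x ∈ X, ∀ j, |G x j| ≤ C) (x y : X) :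
    |g x - g y| ≤ √d * C * dist x y := by
  have := hX.norm_image_sub_le_of_norm_hasFDerivWithin_le (f := g) (C := √d * C)
    (fun z hz => (hG z hz).hasFDerivWithinAt)
    (fun z hz => by
      rw [LinearIsometryEquiv.norm_map]
      exact norm_le_sqrt_mul hC (hGC z hz)) y.2 x.2
  rwa [← dist_eq_norm (x : EuclideanSpace ℝ (Fin d))] at this

theorem exists_grid_index {r x : ℝ} (hr : 0 < r) (hx : x ∈ Icc 0 r) {n : ℕ} (hn : 0 < n) :
    ∃ i : Fin n, |x - ((i : ℝ) + 1 / 2) * r / n| ≤ r / (2 * n) := by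
  have hn' : (0 : ℝ) < n := by exact_mod_cast hn
  have key : ∀ i : ℕ, |x * n / r - (i + 1 / 2)| ≤ 1 / 2 →
      |x - ((i : ℝ) + 1 / 2) * r / n| ≤ r / (2 * n) := by
    intro i hi
    have h1 : x - ((i : ℝ) + 1 / 2) * r / n = (x * n / r - (i + 1 / 2)) * (r / n) := by
      field_simp
    rw [h1, abs_mul, abs_of_pos (div_pos hr hn')]
    calc _ ≤ 1 / 2 * (r / n) := mul_le_mul_of_nonneg_right hi (by positivity)
      _ = _ := by field_simp
  have hy0 : 0 ≤ x * n / r := div_nonneg (mul_nonneg hx.1 hn'.le) hr.le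
  have hyn : x * n / r ≤ n := by
    rw [div_le_iff₀ hr, mul_comm]
    exact mul_le_mul_of_nonneg_left hx.2 hn'.le
  have hf1 := Nat.floor_le hy0
  have hf2 := Nat.lt_floor_add_one (x * n / r)
  rcases lt_or_ge ⌊x * n / r⌋₊ n with h | h
  · exact ⟨⟨_, h⟩, key _ (abs_le.2 ⟨by linarith, by linarith⟩)⟩
  -- The right endpoint x = r has floor n and is assigned to the last cell.
  · refine ⟨⟨n - 1, by omega⟩, key _ ?_⟩
    have h2 : (n : ℝ) ≤ ⌊x * n / r⌋₊ := by exact_mod_cast h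
    rw [Nat.cast_sub hn, Nat.cast_one]
    exact abs_le.2 ⟨by linarith, by linarith⟩

/-- Cell midpoints may lie outside `X`. Projecting them onto the convex set brings them no farther
from any point of `X`, by the obtuse angle criterion. -/
theorem exists_grid {r : ℝ} (hr : 0 < r) (hXne : X.Nonempty) (hXc : IsCompact X)
    (hX : Convex ℝ X) (hbox : ∀ x ∈ X, ∀ j, x j ∈ Icc 0 r) {n : ℕ} (hn : 0 < n) :
    ∃ G : (Fin d → Fin n) → X, ∀ x : X, ∃ i, dist x (G i) ≤ √d * (r / (2 * n)) := by
  have hn' : (0 : ℝ) < n := by exact_mod_cast hn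
  let c : (Fin d → Fin n) → EuclideanSpace ℝ (Fin d) := fun i =>
    WithLp.toLp 2 fun j => ((i j : ℝ) + 1 / 2) * r / n
  choose p hp hpmin using fun i =>
    exists_norm_eq_iInf_of_complete_convex hXne hXc.isComplete hX (c i)
  refine ⟨fun i => ⟨p i, hp i⟩, fun x => ?_⟩
  choose i hi using fun j => exists_grid_index hr (hbox x x.2 j) hn
  refine ⟨i, ?_⟩
  have h1 := (norm_eq_iInf_iff_real_inner_le_zero hX (hp i)).1 (hpmin i) x x.2
  have h2 : ‖(x : EuclideanSpace ℝ (Fin d)) - c i‖ ≤ √d * (r / (2 * n)) :=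
    norm_le_sqrt_mul (by positivity) hi
  refine le_trans ?_ h2
  rw [Subtype.dist_eq, dist_eq_norm]
  refine le_of_sq_le_sq ?_ (norm_nonneg _)
  have h3 : (x : EuclideanSpace ℝ (Fin d)) - c i = (x - p i) - (c i - p i) := by abel
  rw [real_inner_comm] at h1
  change ‖(x : EuclideanSpace ℝ (Fin d)) - p i‖ ^ 2 ≤ _
  rw [h3, norm_sub_sq_real ((x : EuclideanSpace ℝ (Fin d)) - p i) (c i - p i)]
  nlinarith [sq_nonneg ‖c i - p i‖]

end Euclidean

-- The objective as a random Lipschitz path.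

section Path

variable {Ω : Type*} [MeasurableSpace Ω] {P : Measure Ω} [IsProbabilityMeasure P] {d : ℕ}
  {X : Set (EuclideanSpace ℝ (Fin d))} {k : EuclideanSpace ℝ (Fin d) → EuclideanSpace ℝ (Fin d) → ℝ}
  {f : EuclideanSpace ℝ (Fin d) → Ω → ℝ} {a b : ℝ}

theorem ae_bounded_of_tail {G : EuclideanSpace ℝ (Fin d) → Ω → EuclideanSpace ℝ (Fin d)}
    (hb : 0 < b) (hG : ∀ (j : Fin d) (L : ℝ), 0 < L →
      P {ω | ∃ x ∈ X, L < |G x ω j|} ≤ ENNReal.ofReal (a * Real.exp (-(L / b) ^ 2))) :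
    ∀ᵐ ω ∂P, ∃ n : ℕ, ∀ x ∈ X, ∀ j, |G x ω j| ≤ n + 1 := by
  have hj : ∀ j, ∀ᵐ ω ∂P, ∃ n : ℕ, ∀ x ∈ X, |G x ω j| ≤ n + 1 := by
    intro j
    rw [ae_iff]
    have hlim : Tendsto (fun n : ℕ => ENNReal.ofReal (a * Real.exp (-(((n : ℝ) + 1) / b) ^ 2)))
        atTop (𝓝 (ENNReal.ofReal (a * 0))) := by
      refine ENNReal.tendsto_ofReal (Tendsto.const_mul a (Real.tendsto_exp_atBot.comp ?_))
      refine tendsto_neg_atTop_atBot.comp ((tendsto_pow_atTop two_ne_zero).comp ?_)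
      exact (tendsto_atTop_add_const_right _ _ tendsto_natCast_atTop_atTop).atTop_div_const hb
    rw [mul_zero, ENNReal.ofReal_zero] at hlim
    refine le_antisymm (ge_of_tendsto' hlim fun n => ?_) zero_le
    refine (measure_mono fun ω hω => ?_).trans (hG j (n + 1) (by positivity))
    rw [mem_ofPred_eq] at hω ⊢
    push Not at hω
    exact hω n
  filter_upwards [ae_all_iff.2 hj] with ω hω
  choose n hn using hω
  refine ⟨∑ j, n j, fun x hx j => (hn j x hx).trans ?_⟩
  have : n j ≤ ∑ j, n j := Finset.single_le_sum (fun _ _ => Nat.zero_le _) (Finset.mem_univ j)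
  have : (n j : ℝ) ≤ (∑ j, n j : ℕ) := by exact_mod_cast this
  linarith

/-- Almost surely the gradient is bounded, so the path is Lipschitz on the convex set; elsewhere it
is set to 0. The norm of the gradient is at most √d times its largest coordinate, and a union over
coordinates produces the factor d. -/
theorem exists_path [Nonempty X] (hf : IsCenteredGP P X k f) (hX : Convex ℝ X) (hb : 0 < b)
    (hderiv : HasDerivTail P X f a b) :
    ∃ Ψ : Ω → LipPath X, Measurable Ψ ∧ (∀ᵐ ω ∂P, ∀ x : X, (Ψ ω).1 x = f x ω) ∧
      ∀ L, 0 < L → P {ω | L < lipConst (Ψ ω) / √d} ≤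
        ENNReal.ofReal (a * d * Real.exp (-(L / b) ^ 2)) := by
  classical
  obtain ⟨G, hG, htail⟩ := hderiv
  have hbdd := ae_bounded_of_tail hb htail
  let bad : Set Ω := {ω | ¬ ((∀ x ∈ X, HasGradientWithinAt (fun y => f y ω) (G x ω) X x) ∧
    ∃ n : ℕ, ∀ x ∈ X, ∀ j, |G x ω j| ≤ n + 1)}
  have hbad : P bad = 0 := ae_iff.1 (hG.and hbdd)
  -- The bad set need not be measurable; a measurable null superset keeps the modified evaluations
  -- measurable.
  let N := toMeasurable P bad
  have hN : P N = 0 := by rw [measure_toMeasurable, hbad]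
  have hNm : MeasurableSet N := measurableSet_toMeasurable _ _
  have hgood : ∀ ω, ω ∉ N → ((∀ x ∈ X, HasGradientWithinAt (fun y => f y ω) (G x ω) X x) ∧
      ∃ n : ℕ, ∀ x ∈ X, ∀ j, |G x ω j| ≤ n + 1) := fun ω hω => by
    by_contra hcon
    exact hω (subset_toMeasurable P bad hcon)
  have hlip : ∀ ω, ∃ K, LipschitzWith K fun x : X => if ω ∈ N then 0 else f x ω := by
    intro ω
    by_cases hω : ω ∈ N
    · simp only [hω, if_true]
      exact ⟨0, LipschitzWith.const 0⟩
    · simp only [hω, if_false]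
      obtain ⟨h1, n, h2⟩ := hgood ω hω
      refine ⟨⟨√d * (n + 1), by positivity⟩, LipschitzWith.of_dist_le_mul fun x y => ?_⟩
      exact abs_sub_le_of_gradient hX h1 (by positivity) h2 x y
  let Ψ : Ω → LipPath X := fun ω => ⟨fun x => if ω ∈ N then 0 else f x ω, hlip ω⟩
  have hΨeq : ∀ ω, ω ∉ N → ∀ x : X, (Ψ ω).1 x = f x ω := fun ω hω x => by simp [Ψ, hω]
  refine ⟨Ψ, ?_, ?_, fun L hL => ?_⟩
  · refine Measurable.subtype_mk (measurable_pi_iff.2 fun x => ?_)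
    exact Measurable.ite hNm measurable_const (hf.measurable x x.2)
  · filter_upwards [measure_eq_zero_iff_ae_notMem.1 hN] with ω hω using hΨeq ω hω
  · have hsub : {ω | L < lipConst (Ψ ω) / √d} ⊆
        N ∪ ⋃ j, {ω | ∃ x ∈ X, L < |G x ω j|} := by
      intro ω hω
      by_cases hωN : ω ∈ N
      · exact .inl hωN
      · refine .inr ?_
        by_contra hcon
        simp only [mem_iUnion, mem_ofPred_eq, not_exists, not_and, not_lt] at hcon
        have h1 : lipConst (Ψ ω) ≤ √d * L := by
          refine lipConst_le (by positivity) fun x y => ?_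
          rw [hΨeq ω hωN, hΨeq ω hωN]
          exact abs_sub_le_of_gradient hX (hgood ω hωN).1 hL.le (fun x hx j => hcon j x hx) x y
        rw [mem_ofPred_eq] at hω
        rcases (Real.sqrt_nonneg (d : ℝ)).eq_or_lt with h0 | h0
        · rw [← h0, div_zero] at hω
          linarith
        · rw [lt_div_iff₀ h0, mul_comm] at hω
          linarith
    refine (measure_mono hsub).trans ((measure_union_le _ _).trans ?_)
    rw [hN, zero_add]
    refine (measure_iUnion_fintype_le _ _).trans ((Finset.sum_le_sum fun j _ =>
      htail j L hL).trans_eq ?_)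
    rw [Finset.sum_const, Finset.card_univ, Fintype.card_fin, nsmul_eq_mul,
      ← ENNReal.ofReal_natCast, ← ENNReal.ofReal_mul (Nat.cast_nonneg d)]
    congr 1
    ring

end Path

-- Numerical constants.

section Constants

theorem sum_inv_sq_le (N : ℕ) :
    ∑ t ∈ Finset.range N, 1 / ((t : ℝ) + 1) ^ 2 ≤ Real.pi ^ 2 / 6 := by
  have h := sum_le_hasSum (Finset.range (N + 1)) (fun n _ => by positivity) hasSum_zeta_two
  rw [Finset.sum_range_succ'] at h
  simpa using h

/-- For m ≥ 1 the early rounds cost at most mκ ≤ κm² < 2, while the sum of inverse squares loses its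
first term 1; the net excess over π²/6 is at most 1. -/
theorem discretization_sum_le {κ : ℝ} (hκ : 0 < κ) {m : ℕ}
    (hm : ∀ t < m, κ * ((t : ℝ) + 1) ^ 2 < 2) (T : ℕ) :
    (min m T : ℕ) * κ + ∑ t ∈ Finset.Ico m T, 1 / ((t : ℝ) + 1) ^ 2 ≤ Real.pi ^ 2 / 6 + 1 := by
  rcases Nat.eq_zero_or_pos m with rfl | hm0
  · have := sum_inv_sq_le T
    simp only [Nat.zero_min, Nat.cast_zero, zero_mul, zero_add, ← Finset.range_eq_Ico]
    linarith
  · have h1 := hm (m - 1) (by omega)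
    have hm1 : (1 : ℝ) ≤ m := by exact_mod_cast hm0
    rw [Nat.cast_sub hm0, Nat.cast_one, sub_add_cancel] at h1
    have h2 : ((min m T : ℕ) : ℝ) ≤ m := by exact_mod_cast min_le_left m T
    have h3 : ((min m T : ℕ) : ℝ) * κ ≤ 2 := by
      have : (m : ℝ) * κ ≤ κ * (m : ℝ) ^ 2 := by
        nlinarith [mul_nonneg (mul_nonneg hκ.le (zero_le_one.trans hm1)) (sub_nonneg.2 hm1)]
      nlinarith
    have h4 : ∑ t ∈ Finset.Ico m T, 1 / ((t : ℝ) + 1) ^ 2 ≤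
        ∑ t ∈ Finset.Ico 1 (T + 1), 1 / ((t : ℝ) + 1) ^ 2 :=
      Finset.sum_le_sum_of_subset_of_nonneg (Finset.Ico_subset_Ico hm0 (Nat.le_succ T))
        fun t _ _ => by positivity
    have h5 := sum_inv_sq_le (T + 1)
    rw [Finset.range_eq_Ico, ← Finset.sum_Ioo_add_eq_sum_Ico (Nat.succ_pos T)] at h5
    have h6 : Finset.Ioo 0 (T + 1) = Finset.Ico 1 (T + 1) := by
      ext; simp [Nat.one_le_iff_ne_zero, Nat.pos_iff_ne_zero]
    rw [h6] at h5
    norm_num at h5 h4 h3 ⊢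
    linarith

variable {d : ℕ} {a b r : ℝ}

/-- The coefficient of `t²` in the argument of the logarithm in `shift`. -/
def shiftCoeff (d : ℕ) (a b r : ℝ) : ℝ :=
  b * d * r * (√(Real.log (a * d)) + √Real.pi / 2)

theorem shiftCoeff_pos (hd : 0 < d) (hb : 0 < b) (hr : 0 < r) : 0 < shiftCoeff d a b r := by
  have hd' : (0 : ℝ) < d := by exact_mod_cast hd
  have : 0 < √Real.pi := Real.sqrt_pos.2 Real.pi_pos
  unfold shiftCoeff
  positivity

theorem shift_eq (t : ℕ) : shift d a b r t =
    2 * d * Real.log (shiftCoeff d a b r * (t : ℝ) ^ 2) - 2 * Real.log 2 := by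
  rw [shift, shiftCoeff]
  ring_nf

theorem shift_nonneg (hd : 0 < d) {t : ℕ} (h : 2 ≤ shiftCoeff d a b r * (t : ℝ) ^ 2) :
    0 ≤ shift d a b r t := by
  have hd' : (1 : ℝ) ≤ d := by exact_mod_cast hd
  have h1 := Real.log_le_log (by norm_num) h
  have h2 := Real.log_nonneg (show (1 : ℝ) ≤ 2 by norm_num)
  rw [shift_eq]
  nlinarith

/-- This is the number of grid points that the union bound affords in round t. -/
theorem two_mul_exp_shift (hd : 0 < d) (hb : 0 < b) (hr : 0 < r) {t : ℕ} (ht : 0 < t) :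
    2 * Real.exp (shift d a b r t / 2) = (shiftCoeff d a b r * (t : ℝ) ^ 2) ^ d := by
  have hκ := shiftCoeff_pos (a := a) hd hb hr
  have ht' : (0 : ℝ) < t := by exact_mod_cast ht
  have hτ : 0 < shiftCoeff d a b r * (t : ℝ) ^ 2 := by positivity
  rw [shift_eq, show (2 * d * Real.log (shiftCoeff d a b r * (t : ℝ) ^ 2) - 2 * Real.log 2) / 2 =
    d * Real.log (shiftCoeff d a b r * (t : ℝ) ^ 2) - Real.log 2 by ring, Real.exp_sub,
    Real.exp_nat_mul, Real.exp_log hτ, Real.exp_log (by norm_num)]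
  ring

/-- The increment of the shift is 4d log(1 + 1/t), and (1 + 1/t)^t ≥ 2. -/
theorem shift_step (hd : 0 < d) (hb : 0 < b) (hr : 0 < r) {t : ℕ} (ht : 1 ≤ t) :
    4 * Real.log 2 ≤ t * (shift d a b r (t + 1) - shift d a b r t) := by
  have hκ := shiftCoeff_pos (a := a) hd hb hr
  have ht' : (0 : ℝ) < t := by exact_mod_cast ht
  have hd' : (1 : ℝ) ≤ d := by exact_mod_cast hd
  rw [shift_eq, shift_eq, Real.log_mul hκ.ne' (by positivity),
    Real.log_mul hκ.ne' (by positivity), Real.log_pow, Real.log_pow]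
  push_cast
  have h1 : Real.log 2 ≤ t * (Real.log (t + 1) - Real.log t) := by
    rw [← Real.log_div (by positivity) ht'.ne', ← Real.log_pow]
    refine Real.log_le_log (by norm_num) ?_
    have h2 := one_add_mul_le_pow (a := (1 : ℝ) / t) (by
      have : 0 < 1 / (t : ℝ) := by positivity
      linarith) t
    rw [mul_one_div_cancel ht'.ne'] at h2
    rw [add_div, div_self ht'.ne']
    linarith
  have h3 := Real.log_nonneg (show (1 : ℝ) ≤ 2 by norm_num)
  nlinarith

theorem exists_first_round (hd : 0 < d) (hb : 0 < b) (hr : 0 < r) :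
    ∃ m : ℕ, (∀ t < m, shiftCoeff d a b r * ((t : ℝ) + 1) ^ 2 < 2) ∧
      ∀ t, m ≤ t → 2 ≤ shiftCoeff d a b r * ((t : ℝ) + 1) ^ 2 := by
  classical
  have hκ := shiftCoeff_pos (a := a) hd hb hr
  have hex : ∃ t : ℕ, 2 ≤ shiftCoeff d a b r * ((t : ℝ) + 1) ^ 2 := by
    obtain ⟨n, hn⟩ := exists_nat_gt (2 / shiftCoeff d a b r)
    rw [div_lt_iff₀ hκ] at hn
    refine ⟨n, ?_⟩
    have : (0 : ℝ) ≤ n := Nat.cast_nonneg n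
    nlinarith
  refine ⟨Nat.find hex, fun t ht => not_le.1 (Nat.find_min hex ht), fun t ht => ?_⟩
  refine (Nat.find_spec hex).trans (mul_le_mul_of_nonneg_left ?_ hκ.le)
  have : (Nat.find hex : ℝ) ≤ t := by exact_mod_cast ht
  gcongr

variable {δ : ℝ} {T : ℕ}

theorem one_le_logTerm (hδ : 0 < δ) (hδ1 : δ < 1) (hT : 1 ≤ T) : 1 ≤ logTerm T δ := by
  have hT' : (1 : ℝ) ≤ T := by exact_mod_cast hT
  rw [logTerm, Real.le_log_iff_exp_le (by positivity), le_div_iff₀ (by positivity)]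
  have h1 := Real.exp_one_lt_d9
  have h2 := Real.pi_gt_d2
  have h3 : (3.14 : ℝ) ^ 2 ≤ Real.pi ^ 2 := by gcongr
  have h4 : 1 ≤ (T : ℝ) ^ 2 := one_le_pow₀ hT'
  have h5 := Real.exp_pos (1 : ℝ)
  nlinarith [mul_le_mul h3 h4 zero_le_one (by positivity)]

theorem exp_neg_logTerm (hδ : 0 < δ) (hT : 1 ≤ T) :
    Real.exp (-logTerm T δ) = 3 * δ / (Real.pi ^ 2 * (T : ℝ) ^ 2) := by
  have hT' : (0 : ℝ) < T := by exact_mod_cast hT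
  rw [logTerm, Real.exp_neg, Real.exp_log (by positivity), inv_div]

/-- Two events per horizon, each of probability at most 3δ/(π²T²), together with Σ 1/T² = π²/6. -/
theorem tsum_failure (hδ : 0 < δ) :
    ∑' n : ℕ, (ENNReal.ofReal (Real.exp (-logTerm (n + 1) δ)) +
      ENNReal.ofReal (Real.exp (-logTerm (n + 1) δ))) = ENNReal.ofReal δ := by
  have h1 : ∀ n : ℕ, ENNReal.ofReal (Real.exp (-logTerm (n + 1) δ)) +
      ENNReal.ofReal (Real.exp (-logTerm (n + 1) δ)) =
      ENNReal.ofReal (6 * δ / Real.pi ^ 2 * (1 / ((n + 1 : ℕ) : ℝ) ^ 2)) := fun n => by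
    rw [← ENNReal.ofReal_add (Real.exp_nonneg _) (Real.exp_nonneg _),
      exp_neg_logTerm hδ (by omega)]
    congr 1
    field_simp
    norm_num
  have h2 : HasSum (fun n : ℕ => 1 / ((n + 1 : ℕ) : ℝ) ^ 2) (Real.pi ^ 2 / 6) := by
    have := (hasSum_nat_add_iff' (f := fun n : ℕ => 1 / (n : ℝ) ^ 2) 1).2 hasSum_zeta_two
    simpa using this
  have h3 := h2.mul_left (6 * δ / Real.pi ^ 2)
  simp_rw [h1]
  rw [← ENNReal.ofReal_tsum_of_nonneg (fun n => by positivity) h3.summable, h3.tsum_eq]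
  congr 1
  have := Real.pi_pos
  field_simp

end Constants

-- The algorithm restricted to the domain.

section Restriction

variable {E : Type*} {X : Set E}

/-- Regard a data set on a subset as a data set on the whole space. -/
def liftData {t : ℕ} (D : Fin t → X × ℝ) : Fin t → E × ℝ := fun i => ((D i).1, (D i).2)

variable [MeasurableSpace E] {k : E → E → ℝ} {σ : ℝ}
  {sel : ∀ t : ℕ, (Fin t → E × ℝ) → ℝ → E}

/-- The selection rule, restricted to data sets whose inputs lie in `X`. -/
def restrictSel (h : IsArgmaxRule X k σ sel) (t : ℕ) (D : Fin t → X × ℝ) (z : ℝ) : X :=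
  ⟨sel t (liftData D) z, h.mem t _ z fun i => (D i).1.2⟩

theorem dataset_restrictSel (h : IsArgmaxRule X k σ sel) {g : E → ℝ} {g' : X → ℝ}
    (hg : ∀ x, g' x = g x) (e z : ℕ → ℝ) (t : ℕ) :
    dataset sel g e z t = liftData (dataset (restrictSel h) g' e z t) := by
  induction t with
  | zero => exact Subsingleton.elim _ _
  | succ t ih =>
    rw [dataset, dataset]
    ext i : 1
    induction i using Fin.lastCases with
    | last => simp [liftData, restrictSel, hg, ih]
    | cast i => simp [liftData, ih]

theorem query_restrictSel (h : IsArgmaxRule X k σ sel) {g : E → ℝ} {g' : X → ℝ}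
    (hg : ∀ x, g' x = g x) (e z : ℕ → ℝ) (t : ℕ) :
    query sel g e z t = query (restrictSel h) g' e z t := by
  rw [query, dataset_restrictSel h hg]
  rfl

theorem measurable_restrictSel (h : IsArgmaxRule X k σ sel) (t : ℕ) :
    Measurable (Function.uncurry (restrictSel h t)) := by
  refine Measurable.subtype_mk ((h.measurable t).comp
    (f := fun q : (Fin t → X × ℝ) × ℝ => (liftData q.1, q.2)) ?_)
  unfold liftData
  fun_prop

end Restriction

-- Transfer of independence.

section Independence

theorem indepFun_prodMk_assoc {Ω α β γ : Type*} [MeasurableSpace Ω] [MeasurableSpace α]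
    [MeasurableSpace β] [MeasurableSpace γ] {P : Measure Ω} [IsProbabilityMeasure P]
    {U : Ω → α} {V : Ω → β} {W : Ω → γ} (hU : Measurable U) (hV : Measurable V)
    (hW : Measurable W) (h1 : IndepFun U (fun ω => (V ω, W ω)) P) (h2 : IndepFun V W P) :
    IndepFun (fun ω => (U ω, V ω)) W P := by
  have : IsProbabilityMeasure (P.map U) := Measure.isProbabilityMeasure_map hU.aemeasurable
  have : IsProbabilityMeasure (P.map V) := Measure.isProbabilityMeasure_map hV.aemeasurable
  have : IsProbabilityMeasure (P.map W) := Measure.isProbabilityMeasure_map hW.aemeasurable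
  have hUV : IndepFun U V P := h1.comp measurable_id measurable_fst
  rw [indepFun_iff_map_prod_eq_prod_map_map hU.aemeasurable
    (hV.prodMk hW).aemeasurable, (indepFun_iff_map_prod_eq_prod_map_map hV.aemeasurable
      hW.aemeasurable).1 h2] at h1
  rw [indepFun_iff_map_prod_eq_prod_map_map (hU.prodMk hV).aemeasurable hW.aemeasurable,
    (indepFun_iff_map_prod_eq_prod_map_map hU.aemeasurable hV.aemeasurable).1 hUV]
  have h3 := (measurePreserving_prodAssoc (P.map U) (P.map V) (P.map W)).symm.map_eq
  rw [← h3, ← h1, Measure.map_map (MeasurableEquiv.measurable _) (by fun_prop)]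
  rfl

/-- The σ-algebra on paths is generated by evaluations, so Ψ generates no more than its underlying
function. -/
theorem indepFun_path {Ω E γ : Type*} [MeasurableSpace Ω] [MeasurableSpace γ]
    [PseudoMetricSpace E] {P : Measure Ω} {F : Ω → E → ℝ} {W : Ω → γ} {Ψ : Ω → LipPath E}
    (h : IndepFun F W P) (hΨ : ∀ᵐ ω ∂P, ∀ x, (Ψ ω).1 x = F ω x) : IndepFun Ψ W P := by
  have h1 : IndepFun (fun ω => (Ψ ω).1) W P :=
    h.congr (by filter_upwards [hΨ] with ω hω using (funext hω).symm) .rfl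
  rw [IndepFun_iff_Indep] at h1 ⊢
  convert h1 using 1
  exact MeasurableSpace.comap_comp

end Independence

-- The bandit problem on path space.

section Assembly

variable {Ω : Type*} [MeasurableSpace Ω] {P : Measure Ω} [IsProbabilityMeasure P] {d : ℕ}
  {r : ℝ} {X : Set (EuclideanSpace ℝ (Fin d))}
  {k : EuclideanSpace ℝ (Fin d) → EuclideanSpace ℝ (Fin d) → ℝ}
  {f : EuclideanSpace ℝ (Fin d) → Ω → ℝ} {a b σ : ℝ} {ε ζ : ℕ → Ω → ℝ}
  {sel : ∀ t : ℕ, (Fin t → EuclideanSpace ℝ (Fin d) × ℝ) → ℝ → EuclideanSpace ℝ (Fin d)}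
  {Ψ : Ω → LipPath X}

theorem IsCenteredGP.centeredGP (hf : IsCenteredGP P X k f) :
    CenteredGP P (fun x y : X => k x y) (fun x : X => f x) :=
  ⟨fun x => hf.measurable x x.2, hf.isGaussian, fun x => hf.mean_zero x x.2,
    fun x y => hf.cov_eq x x.2 y y.2⟩

theorem dist_le_of_box (hr : 0 < r) (hbox : ∀ x ∈ X, ∀ j, x j ∈ Icc 0 r) (x y : X) :
    dist x y ≤ √d * r := by
  rw [Subtype.dist_eq, dist_eq_norm]
  refine norm_le_sqrt_mul hr.le fun j => ?_
  have h1 := hbox x x.2 j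
  have h2 := hbox y y.2 j
  exact abs_le.2 ⟨by simp; linarith [h1.1, h2.2], by simp; linarith [h1.2, h2.1]⟩

/-- The bound `|g x₀| + lipConst g · diam X` of a Lipschitz path. -/
def pathBound (x₀ : X) (r : ℝ) (g : LipPath X) : ℝ :=
  have : Nonempty X := ⟨x₀⟩
  |g.1 x₀| + lipConst g * (√d * r)

/-- The regret of the first `T` rounds as a function of path, noise and confidence parameters. -/
def pathRegret (selX : ∀ t : ℕ, (Fin t → X × ℝ) → ℝ → X) (T : ℕ)
    (q : (LipPath X × (ℕ → ℝ)) × (ℕ → ℝ)) : ℝ :=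
  ∑ t ∈ Finset.range T, ((⨆ x, q.1.1.1 x) - q.1.1.1 (query selX q.1.1.1 q.1.2 q.2 t))

section

variable [Nonempty X]

theorem path_sub_le (hr : 0 < r) (hbox : ∀ x ∈ X, ∀ j, x j ∈ Icc 0 r) (g : LipPath X) (x y : X) :
    g.1 x - g.1 y ≤ lipConst g * (√d * r) :=
  (le_abs_self _).trans ((abs_sub_le_lipConst g x y).trans
    (mul_le_mul_of_nonneg_left (dist_le_of_box hr hbox x y) (lipConst_nonneg g)))

theorem integral_lipConst (hd : 0 < d) (ha : 0 < a) (hb : 0 < b) (hΨ : Measurable Ψ)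
    (htail : ∀ L, 0 < L → P {ω | L < lipConst (Ψ ω) / √d} ≤
        ENNReal.ofReal (a * d * Real.exp (-(L / b) ^ 2))) :
    Integrable lipConst (P.map Ψ) ∧
      ∫ g, lipConst g ∂P.map Ψ ≤ √d * (b * (√(Real.log (a * d)) + √Real.pi / 2)) := by
  have hd' : (0 : ℝ) < d := by exact_mod_cast hd
  have hsd : 0 < √(d : ℝ) := Real.sqrt_pos.2 hd'
  have hm : Measurable fun ω => lipConst (Ψ ω) := measurable_lipConst.comp hΨ
  obtain ⟨h1, h2⟩ := integral_le_of_gaussian_tail (Y := fun ω => lipConst (Ψ ω) / √d)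
    (hm.div_const _) (fun ω => div_nonneg (lipConst_nonneg _) hsd.le) (mul_pos ha hd') hb htail
  constructor
  · rw [integrable_map_measure measurable_lipConst.aestronglyMeasurable hΨ.aemeasurable]
    refine (h1.mul_const (√d)).congr (.of_forall fun ω => ?_)
    simp [div_mul_cancel₀ _ hsd.ne']
  · rw [integral_map hΨ.aemeasurable measurable_lipConst.aestronglyMeasurable]
    rw [integral_div, div_le_iff₀ hsd] at h2
    linarith

/-- The path lives on its own law and the noise stays on `P`; the product of the two measures
encodes their independence. -/
theorem isBandit_path (hr : 0 < r) (hbox : ∀ x ∈ X, ∀ j, x j ∈ Icc 0 r) (x₀ : X)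
    (hk : ∀ x ∈ X, k x x ≤ 1) (hf : IsCenteredGP P X k f) (hσ : 0 < σ)
    (hε : IsGaussianNoise P σ ε) (hsel : IsArgmaxRule X k σ sel) (hΨ : Measurable Ψ)
    (hΨf : ∀ᵐ ω ∂P, ∀ x : X, (Ψ ω).1 x = f x ω) (hlip : Integrable lipConst (P.map Ψ)) :
    IsBandit (P.map Ψ) P (fun x y : X => k x y) σ (fun (x : X) (g : LipPath X) => g.1 x) ε
      (restrictSel hsel) (pathBound x₀ r) where
  sigma_pos := hσ
  gp := hf.centeredGP.map hΨ measurable_eval_path fun x => hΨf.mono fun ω hω => hω x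
  measurable_f := measurable_uncurry_path
  noise := hε
  measurable_sel := measurable_restrictSel hsel
  le_sel t D z x := isMaxOn_iff.1 (hsel.isMaxOn t (liftData D) z fun i => (D i).1.2) x x.2
  kernel_le x := hk x x.2
  integrable_bound := by
    refine Integrable.add ?_ (hlip.mul_const _)
    have h1 : Integrable (fun g : LipPath X => g.1 x₀) (P.map Ψ) := by
      rw [integrable_map_measure (measurable_eval_path x₀).aestronglyMeasurable hΨ.aemeasurable]
      refine ((hf.centeredGP.memLp x₀).integrable one_le_two).congr ?_
      filter_upwards [hΨf] with ω hω using (hω x₀).symm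
    exact h1.abs
  abs_le_bound x g := by
    have h1 := abs_sub_le_lipConst g x x₀
    have h2 := mul_le_mul_of_nonneg_left (dist_le_of_box hr hbox x x₀) (lipConst_nonneg g)
    have h3 := abs_sub_abs_le_abs_sub (g.1 x) (g.1 x₀)
    rw [pathBound]
    linarith

/-- With n cells per axis the mean error is at most κ/(2n), the two factors √d (norm of the
gradient, radius of a cell) making up the d in κ = `shiftCoeff`. -/
theorem exists_grid_max (hd : 0 < d) (hr : 0 < r) (hb : 0 < b) (hXc : IsCompact X)
    (hX : Convex ℝ X) (hbox : ∀ x ∈ X, ∀ j, x j ∈ Icc 0 r) {μ : Measure (LipPath X)}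
    (hlip : Integrable lipConst μ)
    (hlip_le : ∫ g, lipConst g ∂μ ≤ √d * (b * (√(Real.log (a * d)) + √Real.pi / 2)))
    (hmax : ∀ {ι : Type} [Fintype ι] [Nonempty ι] (G : ι → X),
      Integrable (fun g : LipPath X => ⨆ i, g.1 (G i)) μ)
    (hsup : Integrable (fun g : LipPath X => ⨆ x, g.1 x) μ) (t : ℕ)
    (ht : 2 ≤ shiftCoeff d a b r * ((t : ℝ) + 1) ^ 2) :
    ∃ (ι : Type) (_ : Fintype ι) (_ : Nonempty ι) (G : ι → X),
      (Fintype.card ι : ℝ) ≤ 2 * Real.exp (shift d a b r (t + 1) / 2) ∧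
      ∫ g : LipPath X, (⨆ x, g.1 x) ∂μ ≤ ∫ g : LipPath X, (⨆ i, g.1 (G i)) ∂μ +
        1 / ((t : ℝ) + 1) ^ 2 := by
  have hd' : (0 : ℝ) < d := by exact_mod_cast hd
  set τ := shiftCoeff d a b r * ((t : ℝ) + 1) ^ 2 with hτ
  -- Rounding down keeps n^d within the budget τ^d, and τ < n + 1 ≤ 2n gives κ/(2n) ≤ 1/(t+1)².
  set n := ⌊τ⌋₊ with hn
  have hn1 : 1 ≤ n := Nat.le_floor (by push_cast; linarith)
  have hnτ : (n : ℝ) ≤ τ := Nat.floor_le (by linarith)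
  have hτn : τ < n + 1 := Nat.lt_floor_add_one τ
  have hn1' : (1 : ℝ) ≤ n := by exact_mod_cast hn1
  have : Nonempty (Fin n) := ⟨⟨0, hn1⟩⟩
  obtain ⟨G, hG⟩ := exists_grid hr (nonempty_coe_sort.1 ‹_›) hXc hX hbox hn1
  refine ⟨Fin d → Fin n, inferInstance, inferInstance, G, ?_, ?_⟩
  · rw [two_mul_exp_shift hd hb hr (Nat.succ_pos t)]
    simp only [Fintype.card_pi, Fintype.card_fin, Finset.prod_const, Finset.card_univ]
    push_cast
    exact pow_le_pow_left₀ (Nat.cast_nonneg n) hnτ d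
  · have hpt : ∀ g : LipPath X, (⨆ x, g.1 x) ≤
        (⨆ i, g.1 (G i)) + lipConst g * (√d * (r / (2 * n))) := fun g => by
      refine ciSup_le fun x => ?_
      obtain ⟨i, hi⟩ := hG x
      have h1 := (le_abs_self _).trans (abs_sub_le_lipConst g x (G i))
      have h2 := mul_le_mul_of_nonneg_left hi (lipConst_nonneg g)
      have h3 := le_ciSup (f := fun i => g.1 (G i)) (Finite.bddAbove_range _) i
      linarith
    have hI := (hmax G).add (hlip.mul_const (√d * (r / (2 * n))))
    refine (integral_mono hsup hI hpt).trans ?_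
    refine (integral_add (hmax G) (hlip.mul_const _)).trans_le ?_
    rw [integral_mul_const]
    gcongr
    refine (mul_le_mul_of_nonneg_right hlip_le (by positivity)).trans ?_
    have h4 : √(d : ℝ) * √(d : ℝ) = d := Real.mul_self_sqrt hd'.le
    have h5 : √d * (b * (√(Real.log (a * d)) + √Real.pi / 2)) * (√d * (r / (2 * n))) =
        shiftCoeff d a b r / (2 * n) := by
      calc _ = √(d : ℝ) * √(d : ℝ) * (b * r * (√(Real.log (a * d)) + √Real.pi / 2)) /
              (2 * n) := by ring
        _ = _ := by
          rw [h4, shiftCoeff]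
          ring
    rw [h5, div_le_div_iff₀ (by positivity) (by positivity), ← hτ]
    linarith

theorem measurable_pathRegret [CompactSpace X] {selX : ∀ t : ℕ, (Fin t → X × ℝ) → ℝ → X}
    (hm : ∀ t, Measurable (Function.uncurry (selX t))) (T : ℕ) :
    Measurable (pathRegret selX T) := by
  unfold pathRegret
  refine Finset.measurable_fun_sum _ fun t _ => ?_
  have h1 : Measurable fun q : (LipPath X × (ℕ → ℝ)) × (ℕ → ℝ) => q.1.1 := by fun_prop
  refine (measurable_iSup_path.comp h1).sub ?_
  have h2 : Measurable fun q : (LipPath X × (ℕ → ℝ)) × (ℕ → ℝ) =>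
      dataset selX q.1.1.1 q.1.2 q.2 t :=
    (measurable_dataset (f := fun (x : X) (g : LipPath X) => g.1 x) measurable_uncurry_path hm
      t).comp (f := fun q : (LipPath X × (ℕ → ℝ)) × (ℕ → ℝ) => (q.1.1, q.1.2, q.2)) (by fun_prop)
  have h3 : Measurable fun q : (LipPath X × (ℕ → ℝ)) × (ℕ → ℝ) =>
      query selX q.1.1.1 q.1.2 q.2 t :=
    (hm t).comp (f := fun q : (LipPath X × (ℕ → ℝ)) × (ℕ → ℝ) =>
      (dataset selX q.1.1.1 q.1.2 q.2 t, q.2 t)) (h2.prodMk (by fun_prop))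
  exact measurable_uncurry_path.comp (h3.prodMk h1)

theorem abs_pathRegret_le [CompactSpace X] (hr : 0 < r)
    (hbox : ∀ x ∈ X, ∀ j, x j ∈ Icc 0 r) (selX : ∀ t : ℕ, (Fin t → X × ℝ) → ℝ → X) (T : ℕ)
    (q : (LipPath X × (ℕ → ℝ)) × (ℕ → ℝ)) :
    |pathRegret selX T q| ≤ T * (lipConst q.1.1 * (√d * r)) := by
  rw [pathRegret]
  refine (Finset.abs_sum_le_sum_abs _ _).trans ?_
  refine (Finset.sum_le_card_nsmul _ _ (lipConst q.1.1 * (√d * r)) fun t _ => ?_).trans_eq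
    (by rw [Finset.card_range, nsmul_eq_mul])
  have h1 := le_ciSup (bddAbove_path q.1.1) (query selX q.1.1.1 q.1.2 q.2 t)
  rw [abs_of_nonneg (sub_nonneg.2 h1), sub_le_iff_le_add]
  exact ciSup_le fun x => by
    have := path_sub_le hr hbox q.1.1 x (query selX q.1.1.1 q.1.2 q.2 t)
    linarith

end

theorem cumRegret_eq_pathRegret (hsel : IsArgmaxRule X k σ sel) {g : EuclideanSpace ℝ (Fin d) → ℝ}
    {g' : LipPath X} (hg : ∀ x, g'.1 x = g x) (e z : ℕ → ℝ) (T : ℕ) :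
    cumRegret X sel g e z T = pathRegret (restrictSel hsel) T ((g', e), z) := by
  rw [cumRegret, pathRegret]
  refine Finset.sum_congr rfl fun t _ => ?_
  rw [query_restrictSel hsel hg, ← hg]
  simp only [hg]

theorem integral_pathRegret {selX : ∀ t : ℕ, (Fin t → X × ℝ) → ℝ → X} {μ : Measure (LipPath X)}
    [IsProbabilityMeasure μ] (hεm : ∀ t, Measurable (ε t)) {T : ℕ}
    (hR : Measurable (pathRegret selX T)) (z : ℕ → ℝ) :
    ∫ u, pathRegret selX T (u, z) ∂μ.prod (P.map fun ω t => ε t ω) =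
      ∫ p, ∑ t ∈ Finset.range T,
        roundRegret (fun (x : X) (g : LipPath X) => g.1 x) ε selX z t p ∂(μ.prod P) := by
  have hε : Measurable fun ω t => ε t ω := measurable_pi_iff.2 hεm
  have h1 := Measure.map_prod_map μ P measurable_id hε
  rw [Measure.map_id] at h1
  have hRz : Measurable fun u : LipPath X × (ℕ → ℝ) => pathRegret selX T (u, z) :=
    hR.comp (f := fun u : LipPath X × (ℕ → ℝ) => (u, z)) (by fun_prop)
  rw [h1, integral_map (f := fun u : LipPath X × (ℕ → ℝ) => pathRegret selX T (u, z))
    (by fun_prop) hRz.aestronglyMeasurable]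
  rfl

end Assembly

-- High-probability bounds, uniform in the horizon.

section HighProbability

variable {Ω : Type*} [MeasurableSpace Ω] {P : Measure Ω} [IsProbabilityMeasure P]

/-- The extra 1 is absorbed by the sixth copy of √(T · logTerm) ≥ 1. The alternative S ≤ 0 covers
horizons before the first counted round, where the last radicand of the bound may be negative. -/
theorem le_regretBound {C γ s δ R M S : ℝ} {T : ℕ} (hT : 1 ≤ T) (hδ : 0 < δ) (hδ1 : δ < 1)
    (hC : 0 ≤ C * γ) (hR : R ≤ Real.pi ^ 2 / 6 + 1 + M + √(C * γ * S))
    (hM : M ≤ 5 * √(T * logTerm T δ))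
    (hS : S ≤ 0 ∨ S ≤ T * s + T + 2 * √(T * logTerm T δ) + 2 * logTerm T δ) :
    R ≤ regretBound C γ s T δ := by
  have h1 := one_le_logTerm hδ hδ1 hT
  have hT' : (1 : ℝ) ≤ T := by exact_mod_cast hT
  have h2 : 1 ≤ √(T * logTerm T δ) := Real.one_le_sqrt.2 (one_le_mul_of_one_le_of_one_le hT' h1)
  have h3 : √(C * γ * S) ≤
      √(C * γ * (T * s + T + 2 * √(T * logTerm T δ) + 2 * logTerm T δ)) := by
    rcases hS with hS | hS
    · rw [Real.sqrt_eq_zero'.2 (mul_nonpos_of_nonneg_of_nonpos hC hS)]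
      exact Real.sqrt_nonneg _
    · exact Real.sqrt_le_sqrt (mul_le_mul_of_nonneg_left hS hC)
  rw [regretBound]
  linarith

theorem measure_iUnion_failure_le {s : ℕ → ℝ} {ζ : ℕ → Ω → ℝ}
    (hζ : IsShiftedExpSeq P s (1 / 2) ζ) {m : ℕ} (hs : ∀ t, m ≤ t → 0 ≤ s (t + 1))
    (hstep : ∀ t : ℕ, 1 ≤ t → 4 * Real.log 2 ≤ t * (s (t + 1) - s t))
    {u : ℕ → (ℕ → ℝ) → ℝ → ℝ} (hu : ∀ t, Measurable (Function.uncurry (u t)))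
    (hdep : ∀ (t : ℕ) (z z' : ℕ → ℝ) β, (∀ i < t, z i = z' i) → u t z β = u t z' β)
    (hlip : ∀ t z β β', |u t z β - u t z β'| ≤ |√β - √β'|) {δ : ℝ} (hδ : 0 < δ) (hδ1 : δ < 1) :
    P (⋃ n : ℕ,
      {ω | 5 * √((n + 1 : ℕ) * logTerm (n + 1) δ) < ∑ t ∈ Finset.Ico m (n + 1),
        (∫ β, u t (fun i => ζ i ω) β ∂shiftedExp (s (t + 1)) (1 / 2) -
          u t (fun i => ζ i ω) (ζ t ω))} ∪
      {ω | m < n + 1 ∧ (n + 1 : ℕ) * s (n + 1) + (n + 1 : ℕ) +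
        2 * √((n + 1 : ℕ) * logTerm (n + 1) δ) + 2 * logTerm (n + 1) δ <
          ∑ t ∈ Finset.Ico m (n + 1), ζ t ω}) ≤ ENNReal.ofReal δ := by
  refine (measure_iUnion_le _).trans ((ENNReal.tsum_le_tsum fun n => ?_).trans_eq
    (tsum_failure hδ))
  have hl := zero_le_one.trans (one_le_logTerm hδ hδ1 (Nat.succ_pos n))
  refine (measure_union_le _ _).trans (add_le_add
    (hζ.martingale_tail hs hu hdep hlip (Nat.succ_pos n) hl) ?_)
  by_cases hn : m < n + 1
  · simpa only [hn, true_and] using hζ.sum_tail_shift hs hstep hn hl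
  · simp [hn]

theorem ofReal_one_sub_le_measure {s : Set Ω} {δ : ℝ} (hδ : 0 ≤ δ)
    (h : P sᶜ ≤ ENNReal.ofReal δ) : ENNReal.ofReal (1 - δ) ≤ P s := by
  rw [ENNReal.ofReal_sub _ hδ, ENNReal.ofReal_one, tsub_le_iff_right]
  have h1 := measure_union_le (μ := P) s sᶜ
  rw [union_compl_self, measure_univ] at h1
  exact h1.trans (by gcongr)

theorem IsShiftedExpSeq.ae_nonneg {s : ℕ → ℝ} {ζ : ℕ → Ω → ℝ}
    (hζ : IsShiftedExpSeq P s (1 / 2) ζ) {m : ℕ} (hs : ∀ t, m ≤ t → 0 ≤ s (t + 1)) :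
    ∀ᵐ ω ∂P, ∀ t, m ≤ t → 0 ≤ ζ t ω := by
  refine ae_all_iff.2 fun t => ?_
  have h1 := shiftedExp_ge (s (t + 1))
  rw [← hζ.law] at h1
  filter_upwards [ae_of_ae_map (hζ.measurable t).aemeasurable h1] with ω hω ht
  exact (hs t ht).trans hω

end HighProbability

-- Conditional expectation of the regret.

section Regret

variable {Ω : Type*} [MeasurableSpace Ω] {P : Measure Ω} [IsProbabilityMeasure P] {d : ℕ}
  {r : ℝ} {X : Set (EuclideanSpace ℝ (Fin d))}
  {k : EuclideanSpace ℝ (Fin d) → EuclideanSpace ℝ (Fin d) → ℝ}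
  {f : EuclideanSpace ℝ (Fin d) → Ω → ℝ} {a b σ : ℝ} {ε ζ : ℕ → Ω → ℝ}
  {sel : ∀ t : ℕ, (Fin t → EuclideanSpace ℝ (Fin d) × ℝ) → ℝ → EuclideanSpace ℝ (Fin d)}
  {Ψ : Ω → LipPath X}

/-- Integrability of the regret, and its conditional expectation given the confidence parameters
as an integral over path and noise. -/
theorem condExp_cumRegret [Nonempty X] [CompactSpace X] (hr : 0 < r)
    (hbox : ∀ x ∈ X, ∀ j, x j ∈ Icc 0 r) (hsel : IsArgmaxRule X k σ sel) (hΨ : Measurable Ψ)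
    (hΨf : ∀ᵐ ω ∂P, ∀ x : X, (Ψ ω).1 x = f x ω) (hlip : Integrable lipConst (P.map Ψ))
    (hε : ∀ t, Measurable (ε t)) (hζ : ∀ t, Measurable (ζ t))
    (hindep_f : IndepFun (fun ω (x : X) => f x ω) (fun ω => (fun t => ε t ω, fun t => ζ t ω)) P)
    (hindep_ε : IndepFun (fun ω t => ε t ω) (fun ω t => ζ t ω) P) (T : ℕ) :
    Integrable (fun ω =>
      cumRegret X sel (fun x => f x ω) (fun t => ε t ω) (fun t => ζ t ω) T) P ∧
    condExp (sigmaOf ζ) P (fun ω =>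
        cumRegret X sel (fun x => f x ω) (fun t => ε t ω) (fun t => ζ t ω) T) =ᵐ[P]
      fun ω => ∫ p, ∑ t ∈ Finset.range T, roundRegret (fun (x : X) (g : LipPath X) => g.1 x) ε
        (restrictSel hsel) (fun t => ζ t ω) t p ∂((P.map Ψ).prod P) := by
  have : IsProbabilityMeasure (P.map Ψ) := Measure.isProbabilityMeasure_map hΨ.aemeasurable
  have hεm : Measurable fun ω t => ε t ω := measurable_pi_iff.2 hε
  have hζm : Measurable fun ω t => ζ t ω := measurable_pi_iff.2 hζ
  have hR := measurable_pathRegret (measurable_restrictSel hsel) T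
  have heq : (fun ω => cumRegret X sel (fun x => f x ω) (fun t => ε t ω) (fun t => ζ t ω) T)
      =ᵐ[P] fun ω =>
        pathRegret (restrictSel hsel) T ((Ψ ω, fun t => ε t ω), fun t => ζ t ω) := by
    filter_upwards [hΨf] with ω hω using cumRegret_eq_pathRegret hsel hω _ _ T
  have hΨW := indepFun_path hindep_f hΨf
  have hΨε : IndepFun Ψ (fun ω t => ε t ω) P := hΨW.comp measurable_id measurable_fst
  have hmap := (indepFun_iff_map_prod_eq_prod_map_map hΨ.aemeasurable hεm.aemeasurable).1 hΨε
  have hI : Integrable (fun ω =>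
      pathRegret (restrictSel hsel) T ((Ψ ω, fun t => ε t ω), fun t => ζ t ω)) P := by
    have h1 : Integrable (fun ω => lipConst (Ψ ω)) P :=
      (integrable_map_measure measurable_lipConst.aestronglyMeasurable hΨ.aemeasurable).1 hlip
    refine ((h1.mul_const (√d * r)).const_mul (T : ℝ)).mono'
      (hR.comp ((hΨ.prodMk hεm).prodMk hζm)).aestronglyMeasurable (.of_forall fun ω => ?_)
    exact abs_pathRegret_le hr hbox _ T ((Ψ ω, fun t => ε t ω), fun t => ζ t ω)
  refine ⟨hI.congr heq.symm, (condExp_congr_ae heq).trans ?_⟩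
  refine (condExp_comap_of_indepFun (hΨ.prodMk hεm) hζm
    (indepFun_prodMk_assoc hΨ hεm hζm hΨW hindep_ε) hR hI).trans (.of_forall fun ω => ?_)
  dsimp only
  rw [hmap]
  exact integral_pathRegret hε hR _

end Regret

end GPBandit
end

-- The regret bound.

open GPBandit in
theorem mainTheorem6 {Ω : Type*} [MeasurableSpace Ω] (P : Measure Ω) [IsProbabilityMeasure P]
    (d : ℕ) (hd : 0 < d)
    (r : ℝ) (hr : 0 < r)
    (X : Set (EuclideanSpace ℝ (Fin d))) (hXne : X.Nonempty) (hXcompact : IsCompact X)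
    (hXconvex : Convex ℝ X) (hXbox : ∀ x ∈ X, ∀ j, x j ∈ Set.Icc 0 r)
    (k : EuclideanSpace ℝ (Fin d) → EuclideanSpace ℝ (Fin d) → ℝ)
    (hk : ∀ x ∈ X, k x x ≤ 1)
    (f : EuclideanSpace ℝ (Fin d) → Ω → ℝ) (hf : GPBandit.IsCenteredGP P X k f)
    (a b : ℝ) (ha : 0 < a) (hb : 0 < b) (hderiv : GPBandit.HasDerivTail P X f a b)
    (σ : ℝ) (hσ : 0 < σ)
    (ε : ℕ → Ω → ℝ) (hε : GPBandit.IsGaussianNoise P σ ε)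
    (ζ : ℕ → Ω → ℝ) (hζ : GPBandit.IsShiftedExpSeq P (GPBandit.shift d a b r) (1 / 2) ζ)
    (hindep_f : IndepFun (fun ω (x : X) => f x ω) (fun ω => (fun t => ε t ω, fun t => ζ t ω)) P)
    (hindep_ε : IndepFun (fun ω t => ε t ω) (fun ω t => ζ t ω) P)
    (sel : ∀ t : ℕ, (Fin t → EuclideanSpace ℝ (Fin d) × ℝ) → ℝ → EuclideanSpace ℝ (Fin d))
    (hsel : GPBandit.IsArgmaxRule X k σ sel)
    (δ : ℝ) (hδ : 0 < δ) (hδ1 : δ < 1) :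
    (∀ T : ℕ, Integrable (fun ω =>
      GPBandit.cumRegret X sel (fun x => f x ω) (fun t => ε t ω) (fun t => ζ t ω) T) P) ∧
    ENNReal.ofReal (1 - δ) ≤
      P {ω | ∀ T : ℕ, 1 ≤ T →
        condExp (GPBandit.sigmaOf ζ) P (fun ω' =>
          GPBandit.cumRegret X sel (fun x => f x ω') (fun t => ε t ω') (fun t => ζ t ω') T) ω
        ≤ GPBandit.regretBound (GPBandit.C₁ σ) (GPBandit.maxInfoGain P X f ε T)
            (GPBandit.shift d a b r T) T δ} := by
  have hne : Nonempty X := hXne.to_subtype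
  have hcs : CompactSpace X := isCompact_iff_compactSpace.1 hXcompact
  obtain ⟨x₀⟩ := id hne
  obtain ⟨Ψ, hΨ, hΨf, htail⟩ := exists_path hf hXconvex hb hderiv
  have hprob : IsProbabilityMeasure (P.map Ψ) :=
    Measure.isProbabilityMeasure_map hΨ.aemeasurable
  obtain ⟨hlip, hlip_le⟩ := integral_lipConst hd ha hb hΨ htail
  have hB := isBandit_path hr hXbox x₀ hk hf hσ hε hsel hΨ hΨf hlip
  have hsup : Measurable fun g : LipPath X => ⨆ x, g.1 x := measurable_iSup_path
  have hce := fun T => condExp_cumRegret hr hXbox hsel hΨ hΨf hlip hε.measurable hζ.measurable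
    hindep_f hindep_ε T
  refine ⟨fun T => (hce T).1, ?_⟩
  obtain ⟨m, hm1, hm2⟩ := exists_first_round (a := a) hd hb hr
  have hs : ∀ t, m ≤ t → 0 ≤ shift d a b r (t + 1) := fun t ht =>
    shift_nonneg hd (by have := hm2 t ht; push_cast; exact this)
  -- The oscillation is at most the Lipschitz constant times the diameter √d r of the box, and its
  -- mean is again at most κ.
  have hb₀ : ∫ g : LipPath X, lipConst g * (√d * r) ∂P.map Ψ ≤ shiftCoeff d a b r := by
    rw [integral_mul_const]
    refine (mul_le_mul_of_nonneg_right hlip_le (by positivity)).trans_eq ?_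
    calc _ = √(d : ℝ) * √(d : ℝ) * (b * r * (√(Real.log (a * d)) + √Real.pi / 2)) := by ring
      _ = _ := by
        rw [Real.mul_self_sqrt (Nat.cast_nonneg d), shiftCoeff]
        ring
  have hfε : IndepFun (fun ω (x : X) => f x ω) (fun ω t => ε t ω) P :=
    hindep_f.comp measurable_id measurable_fst
  have hΓ : ∀ (T : ℕ) (A : ℕ → X), ∑ t ∈ Finset.range T,
      seqVar (fun x y : X => k x y) σ A t ≤ C₁ σ * maxInfoGain P X f ε T := fun T A =>
    hf.centeredGP.sum_seqVar_le hσ hε hfε A (fun x => hk x x.2) T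
  have hΓ0 : ∀ T, 0 ≤ C₁ σ * maxInfoGain P X f ε T := fun T =>
    (Finset.sum_nonneg fun t _ => hf.centeredGP.postVar_nonneg hσ _ _).trans
      (hΓ T fun _ => x₀)
  have hfail := measure_iUnion_failure_le hζ hs (fun t ht => shift_step hd hb hr ht)
    (fun t => hB.measurable_meanUcb t) (fun t z z' β hz => meanUcb_congr hz β)
    (fun t z β β' => hB.abs_meanUcb_sub_le z β β') hδ hδ1
  -- It suffices that the complement lies, up to a null set, in the union of failure events; the
  -- good event need not be shown measurable.
  refine ofReal_one_sub_le_measure hδ.le ((measure_mono_ae ?_).trans hfail)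
  filter_upwards [ae_all_iff.2 fun T => (hce T).2, hζ.ae_nonneg hs] with ω hω hζω
  refine not_imp_not.1 fun hbad => ?_
  refine notMem_compl_iff.2 fun T hT => ?_
  obtain ⟨n, rfl⟩ : ∃ n, T = n + 1 := ⟨T - 1, by omega⟩
  rw [hω]
  have hmean := hB.integral_sum_roundRegret_le hsup (hΓ (n + 1)) (hlip.mul_const _)
    (fun x y g => path_sub_le hr hXbox g x y) hb₀
    (fun t ht => exists_grid_max hd hr hb hXcompact hXconvex hXbox hlip hlip_le
      hB.integrable_max (hB.integrable_sup hsup) t (hm2 t ht)) hζω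
  have hdisc := discretization_sum_le (shiftCoeff_pos (a := a) hd hb hr) hm1 (n + 1)
  have hn := not_exists.1 (mt mem_iUnion.2 hbad) n
  simp only [mem_union, mem_ofPred_eq, not_or, not_and, not_lt] at hn
  refine le_regretBound hT hδ hδ1 (hΓ0 _) (hmean.trans (by gcongr)) hn.1 ?_
  rcases lt_or_ge m (n + 1) with hmn | hmn
  · exact .inr (hn.2 hmn)
  · exact .inl (by rw [Finset.Ico_eq_empty (by omega), Finset.sum_empty])
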